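/- **Setting.** Let $d\ge 1$ and let $\mathcal A$ be a unital complex Banach $*$-algebra with isometric involution, on which space-time translations act by isometric $*$-automorphisms $A\mapsto A(\mathbf x,\tau)$, $(\mathbf x,\tau)\in\mathbb R^d\times\mathbb R$ (an additive action). Let $\omega$ be a translation-invariant stationary state, $\overline{\mathcal H}$ the completion of its GNS space $\mathcal H$, $A\mapsto\hat A$ the GNS representation and $\theta$ the cyclic vector, and let $T_{\mathbf x},T_\tau$ also denote the induced translations of $\overline{\mathcal H}$. Let $\mathcal J$ be a countable set of kinds of particles, split into bosonic and fermionic ones, and for each $j\in\mathcal J$ let $\epsilon(\cdot,j):\mathbb R^d\to\mathbb R$ be smooth and strictly convex. Let $\Phi$ be an elementary excitation: linear maps $f\mapsto\Phi(f,j)\in\overline{\mathcal H}$ on Schwartz functions with $\langle\Phi(f,j),\Phi(g,k)\rangle=\delta_{jk}\int\bar f g\,d\mathbf k$, such that $T_{\mathbf x}T_\tau\Phi(f,j)=\Phi(e^{i\mathbf k\mathbf x-i\tau\epsilon(\mathbf k,j)}f,j)$ (whenever the function on the right is Schwartz). Let $(B_i)_{i\in I}$ be a family of elements of $\mathcal A$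 with kinds $\kappa(i)\in\mathcal J$ and Schwartz functions $\phi_i$ such that $\hat B_i\theta=\Phi(\phi_i,\kappa(i))$ (several, even infinitely many, $B_i$ of the same kind are allowed), such that $(\mathbf x,\tau)\mapsto B_i(\mathbf x,\tau)$ is norm continuous and such that for every $j$ and almost every $\mathbf k$ some $\phi_i$ with $\kappa(i)=j$ has $\phi_i(\mathbf k)\neq0$. Assume: * *(asymptotic (anti)commutativity)* for all $i,l$ and $N$ there are a constant $C$ and an integer $M$ with $\|[\hat B_i(\mathbf x,\tau),\hat B_l]_\mp\|\le C(1+|\tau|)^M/(1+\|\mathbf x\|^N)$, with the anticommutator if both kinds are fermionic and the commutator otherwise; * *(strong cluster property)* for all $n$, $N$ and $A_1,\dots,A_n\in\{B_i,B_i^*: i\in I\}$ there are $C,M$ such that the truncated correlation functions $w_n^T$ obtained from $\omega(A_1(\mathbf x_1,\tau_1)\cdots A_n(\mathbf x_n,\tau_n))$ satisfy $|w^T_n|\le C(1+\sum_m|\tau_m|)^M/(1+\|\mathbf x_a-\mathbf x_b\|^N)$ for all $a,b$. (Truncated functions are defined by $w_n=\sum_P\pm\prod_{b\in P}w^T_{|b|}$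 over partitions $P$ of $\{1,\dots,n\}$; the sign is that of the permutation of the fermionic factors that puts the blocks one after another in the order of their smallest elements.) For a Schwartz function $f$ let $f_\tau(\mathbf x)=(2\pi)^{-d}\int f(\mathbf k)e^{i\tau\epsilon(\mathbf k,\kappa(i))-i\mathbf k\mathbf x}d\mathbf k$ and $B_i(f,\tau)=\int f_\tau(\mathbf x)B_i(\mathbf x,\tau)d\mathbf x$. Given $i_1,\dots,i_n$, compactly supported $f_1,\dots,f_n$ are *non-overlapping* if the sets $\{\nabla\epsilon(\mathbf k,\kappa(i_m)):\mathbf k\in\operatorname{supp}f_m\}$ are pairwise disjoint. Let $\mathcal H_{as}$ be the Fock space generated from the vacuum $|0\rangle$ by creation operators $b^+(g,j)$, $g\in L^2(\mathbb R^d)$, $j\in\mathcal J$, with anticommutation relations for two fermionic kinds and commutation relations otherwise. **Theorem.** There is a linear isometry $S_-:\mathcal H_{as}\to\overline{\mathcal H}$ with the following properties. 1. For all $n\ge 0$, $i_1,\dots,i_n\in I$ and non-overlapping $f_1,\dots,f_n$ the in-state $$\Psi(f_1,i_1,\dots,f_n,i_n|-\infty)=\lim\hat B_{i_1}(f_1,\tau_1)\cdots\hat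 B_{i_n}(f_n,\tau_n)\theta$$ exists and equals $S_-\big(b^+(f_1\phi_{i_1},\kappa(i_1))\cdots b^+(f_n\phi_{i_n},\kappa(i_n))|0\rangle\big)$. Here $\tau_1,\dots,\tau_n\to-\infty$ subject to $|\tau_a|\le|\tau_b|^M$ for $a<b$, with $M$ an arbitrary fixed natural number (for $M=1$ this includes $\tau_1=\dots=\tau_n=\tau\to-\infty$). 2. $S_-|0\rangle=\theta$ and $a^+_{in}(f\phi_i,\kappa(i))S_-=S_-b^+(f\phi_i,\kappa(i))$, where $a^+_{in}(f\phi_i,\kappa(i))=\lim_{\tau\to-\infty}\hat B_i(f,\tau)$: if $f,f_1,\dots,f_n$ are non-overlapping (for $i,i_1,\dots,i_n$) and $v=b^+(f_1\phi_{i_1},\kappa(i_1))\cdots b^+(f_n\phi_{i_n},\kappa(i_n))|0\rangle$, then $\hat B_i(f,\tau)S_-v\to S_-b^+(f\phi_i,\kappa(i))v$ as $\tau\to-\infty$. 3. $S_-$ is single-valued: every bounded linear operator $\mathcal H_{as}\to\overline{\mathcal H}$ which satisfies 1 or satisfies 2 coincides with $S_-$. -/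

import Mathlib

open scoped InnerProductSpace ComplexOrder SchwartzMap Topology ENNReal
open MeasureTheory

namespace HaagRuelle

/-! ### States, the GNS construction, translations -/

/-- A state of a unital Banach `*`-algebra: a normalized positive continuous functional. -/
structure State (A : Type*) [NormedRing A] [StarRing A] [NormedAlgebra ℂ A] where
  toCLM : A →L[ℂ] ℂ
  nonneg : ∀ a, 0 ≤ toCLM (star a * a)
  map_one : toCLM 1 = 1

/-- The algebra `A` regarded as the GNS pre-Hilbert space of `ω`; the element `a` stands for the
vector `â θ`, and vectors of seminorm zero are identified in the completion. -/
@[nolint unusedArguments]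
def PreGNS {A : Type*} [NormedRing A] [StarRing A] [NormedAlgebra ℂ A] (_ω : State A) : Type _ := A

section GNS

variable {A : Type*} [NormedRing A] [StarRing A] [NormedAlgebra ℂ A] (ω : State A)

instance : AddCommGroup (PreGNS ω) := inferInstanceAs (AddCommGroup A)
instance : Module ℂ (PreGNS ω) := inferInstanceAs (Module ℂ A)

/-- The identity map from `A` to its GNS pre-Hilbert space. -/
noncomputable def toPre : A ≃ₗ[ℂ] PreGNS ω := LinearEquiv.refl ℂ A

variable [StarModule ℂ A]

theorem State.map_star (a : A) : ω.toCLM (star a) = star (ω.toCLM a) := by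
  have h1 := (Complex.nonneg_iff.mp (ω.nonneg (1 + a))).2
  have h2 := (Complex.nonneg_iff.mp (ω.nonneg (1 + Complex.I • a))).2
  have h3 := (Complex.nonneg_iff.mp (ω.nonneg a)).2
  simp only [star_add, star_one, star_smul, add_mul, mul_add, one_mul, mul_one, map_add,
    ω.map_one, smul_mul_assoc, mul_smul_comm, map_smul, smul_eq_mul, Complex.add_im,
    Complex.mul_im, Complex.one_im, Complex.star_def, Complex.conj_I, Complex.neg_re,
    Complex.neg_im, Complex.I_re, Complex.I_im, Complex.mul_re, ← h3] at h1 h2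
  apply Complex.ext
  · simp only [Complex.star_def, Complex.conj_re]; linarith
  · simp only [Complex.star_def, Complex.conj_im]; linarith

/-- The scalar product `⟨a, b⟩ = ω(a* b)`. -/
noncomputable abbrev preGNSCore : PreInnerProductSpace.Core ℂ (PreGNS ω) where
  inner a b := ω.toCLM (star ((toPre ω).symm a) * (toPre ω).symm b)
  conj_inner_symm a b := by
    rw [← Complex.star_def, ← ω.map_star]; simp
  re_inner_nonneg a := (RCLike.nonneg_iff.mp (ω.nonneg ((toPre ω).symm a))).1
  add_left a b c := by simp [add_mul]
  smul_left a b r := by simp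

noncomputable instance : SeminormedAddCommGroup (PreGNS ω) :=
  InnerProductSpace.Core.toSeminormedAddCommGroup (c := preGNSCore ω)

noncomputable instance : InnerProductSpace ℂ (PreGNS ω) :=
  InnerProductSpace.ofCore (preGNSCore ω)

/-- The completed GNS Hilbert space. -/
abbrev GNS : Type _ := UniformSpace.Completion (PreGNS ω)

/-- The vector `â θ` of the GNS Hilbert space; `gnsVec ω 1` is the cyclic vector `θ`. -/
noncomputable def gnsVec (a : A) : GNS ω := ((toPre ω a : PreGNS ω) : GNS ω)

theorem inner_toPre (a b : A) : ⟪toPre ω a, toPre ω b⟫_ℂ = ω.toCLM (star a * b) := rfl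

theorem norm_toPre_sq (a : A) : ‖toPre ω a‖ ^ 2 = (ω.toCLM (star a * a)).re := by
  rw [← inner_toPre, ← inner_self_eq_norm_sq (𝕜 := ℂ)]; rfl

theorem le_of_pow_two_pow_le {x y K : ℝ} (hy : 0 ≤ y)
    (h : ∀ n : ℕ, x ^ 2 ^ n ≤ K * y ^ 2 ^ n) : x ≤ y := by
  by_contra! hlt
  rcases hy.eq_or_lt with rfl | hy
  · have := h 1
    norm_num at this
    nlinarith [pow_pos hlt 2]
  · have h1 : 1 < x / y := (one_lt_div hy).2 hlt
    obtain ⟨n, hn⟩ := pow_unbounded_of_one_lt K h1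
    have h2 : (x / y) ^ n ≤ (x / y) ^ 2 ^ n := pow_le_pow_right₀ h1.le Nat.lt_two_pow_self.le
    have h3 : (x / y) ^ 2 ^ n ≤ K := by
      rw [div_pow, div_le_iff₀ (by positivity)]; exact h n
    linarith

theorem norm_toPre_mul_sq_le (a b : A) :
    ‖toPre ω (a * b)‖ ^ 2 ≤ ‖toPre ω b‖ * ‖toPre ω (star a * a * b)‖ := by
  rw [norm_toPre_sq]
  have h : star (a * b) * (a * b) = star b * (star a * a * b) := by
    simp [mul_assoc]
  rw [h, ← inner_toPre]
  exact (Complex.re_le_norm _).trans (norm_inner_le_norm _ _)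

variable [NormedStarGroup A]

theorem norm_toPre_le (a : A) : ‖toPre ω a‖ ≤ √‖ω.toCLM‖ * ‖a‖ := by
  rw [← sq_le_sq₀ (norm_nonneg _) (by positivity), norm_toPre_sq, mul_pow,
    Real.sq_sqrt (norm_nonneg _)]
  calc (ω.toCLM (star a * a)).re ≤ ‖ω.toCLM (star a * a)‖ := Complex.re_le_norm _
    _ ≤ ‖ω.toCLM‖ * ‖star a * a‖ := ω.toCLM.le_opNorm _
    _ ≤ ‖ω.toCLM‖ * ‖a‖ ^ 2 := by
      gcongr
      calc ‖star a * a‖ ≤ ‖star a‖ * ‖a‖ := norm_mul_le _ _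
        _ = ‖a‖ ^ 2 := by rw [norm_star, sq]

/-- Left multiplication is bounded for the GNS seminorm. -/
theorem norm_toPre_mul_le (a b : A) : ‖toPre ω (a * b)‖ ≤ ‖a‖ * ‖toPre ω b‖ := by
  rcases (norm_nonneg (toPre ω b)).eq_or_lt with h0 | hb
  · have := norm_toPre_mul_sq_le ω a b
    rw [← h0, zero_mul] at this
    rw [← h0, mul_zero]
    nlinarith [norm_nonneg (toPre ω (a * b))]
  set h : A := star a * a with hh
  have hsa : star h = h := by simp [hh]
  have hn : ‖h‖ ≤ ‖a‖ ^ 2 := by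
    calc ‖star a * a‖ ≤ ‖star a‖ * ‖a‖ := norm_mul_le _ _
      _ = ‖a‖ ^ 2 := by rw [norm_star, sq]
  set r : ℕ → ℝ := fun n => ‖toPre ω (h ^ 2 ^ n * b)‖ / ‖toPre ω b‖ with hr
  have hstep : ∀ n, r n ^ 2 ≤ r (n + 1) := by
    intro n
    have := norm_toPre_mul_sq_le ω (h ^ 2 ^ n) b
    rw [star_pow, hsa, ← pow_add, ← two_mul, ← pow_succ'] at this
    simp only [hr, div_pow]
    rw [div_le_div_iff₀ (by positivity) hb]
    nlinarith
  have hpow : ∀ n, r 0 ^ 2 ^ n ≤ r n := by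
    intro n
    induction n with
    | zero => simp
    | succ n ih =>
      calc r 0 ^ 2 ^ (n + 1) = (r 0 ^ 2 ^ n) ^ 2 := by rw [← pow_mul, pow_succ]
        _ ≤ r n ^ 2 := by
          have : 0 ≤ r 0 ^ 2 ^ n := by positivity
          gcongr
        _ ≤ _ := hstep n
  have hr0 : r 0 ≤ ‖a‖ ^ 2 := by
    refine le_of_pow_two_pow_le (K := √‖ω.toCLM‖ * ‖b‖ / ‖toPre ω b‖)
      (by positivity) fun n => (hpow n).trans ?_
    simp only [hr]
    rw [div_mul_eq_mul_div, div_le_div_iff_of_pos_right hb]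
    calc ‖toPre ω (h ^ 2 ^ n * b)‖ ≤ √‖ω.toCLM‖ * ‖h ^ 2 ^ n * b‖ := norm_toPre_le ω _
      _ ≤ √‖ω.toCLM‖ * (‖h ^ 2 ^ n‖ * ‖b‖) := by gcongr; exact norm_mul_le _ _
      _ ≤ √‖ω.toCLM‖ * ((‖a‖ ^ 2) ^ 2 ^ n * ‖b‖) := by
        gcongr
        exact (norm_pow_le' h (by positivity)).trans (by gcongr)
      _ = _ := by ring
  have h1 := norm_toPre_mul_sq_le ω a b
  have h2 : ‖toPre ω (h * b)‖ ≤ ‖a‖ ^ 2 * ‖toPre ω b‖ := by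
    have := hr0
    simp only [hr, pow_zero, pow_one] at this
    rwa [div_le_iff₀ hb] at this
  rw [← sq_le_sq₀ (norm_nonneg _) (by positivity)]
  calc _ ≤ _ := h1
    _ ≤ ‖toPre ω b‖ * (‖a‖ ^ 2 * ‖toPre ω b‖) := by gcongr
    _ = _ := by ring

/-- The GNS representation: `gnsRep ω a` is the bounded operator `â` on the GNS Hilbert space,
the continuous extension of `b̂ θ ↦ (ab)^ θ`. -/
noncomputable def gnsRep (a : A) : GNS ω →L[ℂ] GNS ω :=
  (((toPre ω).toLinearMap ∘ₗ LinearMap.mulLeft ℂ a ∘ₗ (toPre ω).symm.toLinearMap).mkContinuous ‖a‖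
    fun x => norm_toPre_mul_le ω a ((toPre ω).symm x)).completion

theorem gnsRep_gnsVec (a b : A) : gnsRep ω a (gnsVec ω b) = gnsVec ω (a * b) := by
  simp only [gnsRep, gnsVec, ContinuousLinearMap.completion_apply_coe]
  rfl

end GNS

/-- Momentum space, and also position space: `ℝ^d` with the Euclidean norm. -/
abbrev Momentum (d : ℕ) : Type := EuclideanSpace ℝ (Fin d)

/-- Space-time translations `(x, τ) ∈ ℝ^d × ℝ` acting on `A` by isometric
`*`-automorphisms; `α.toFun x τ a` is `a(x, τ)`. (For a C*-algebra the isometry is automatic.) -/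
structure Translations (d : ℕ) (A : Type*) [NormedRing A] [StarRing A] [NormedAlgebra ℂ A] where
  toFun : Momentum d → ℝ → A ≃⋆ₐ[ℂ] A
  map_add : ∀ x y s t a, toFun (x + y) (s + t) a = toFun x s (toFun y t a)
  norm_map : ∀ x s a, ‖toFun x s a‖ = ‖a‖

/-- A translation-invariant stationary state. -/
structure StationaryState {d : ℕ} {A : Type*} [NormedRing A] [StarRing A] [NormedAlgebra ℂ A]
    (α : Translations d A) extends State A where
  invariant : ∀ x s a, toCLM (α.toFun x s a) = toCLM a

section Setup

variable {d : ℕ} {A : Type*} [NormedRing A] [StarRing A] [NormedAlgebra ℂ A]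
  [StarModule ℂ A] {α : Translations d A}

theorem StationaryState.norm_toPre_translate (ω : StationaryState α) (x : Momentum d) (s : ℝ)
    (a : A) : ‖toPre ω.toState (α.toFun x s a)‖ = ‖toPre ω.toState a‖ := by
  rw [← sq_eq_sq₀ (norm_nonneg _) (norm_nonneg _), norm_toPre_sq, norm_toPre_sq, ← map_star,
    ← map_mul, ω.invariant]

/-- The translation operator `T_x T_s` on the GNS Hilbert space, the continuous extension of
`â θ ↦ (α x s a)^ θ`. -/
noncomputable def StationaryState.translate (ω : StationaryState α) (x : Momentum d) (s : ℝ) :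
    GNS ω.toState →L[ℂ] GNS ω.toState :=
  (((toPre ω.toState).toLinearMap ∘ₗ (α.toFun x s : A →ₗ[ℂ] A) ∘ₗ
    (toPre ω.toState).symm.toLinearMap).mkContinuous 1
    fun v => by
      rw [one_mul]
      exact (ω.norm_toPre_translate x s ((toPre ω.toState).symm v)).le).completion

theorem StationaryState.translate_gnsVec (ω : StationaryState α) (x : Momentum d) (s : ℝ) (a : A) :
    ω.translate x s (gnsVec ω.toState a) = gnsVec ω.toState (α.toFun x s a) := by
  simp [StationaryState.translate, gnsVec]

end Setup

open Classical in
/-- An elementary excitation (the particles of the theory): an isometric embedding of the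
elementary space of Schwartz functions `f(k, j)` (momentum `k`, discrete index `j`) into the GNS
space, intertwining translations. In the elementary space spatial translations act in the momentum
representation as multiplication by `e^{i⟨k, x⟩}`, time translations as multiplication by
`e^{-i s ε(k, j)}`. -/
structure ElementaryExcitation {d : ℕ} {A J : Type*} [NormedRing A] [StarRing A]
    [NormedAlgebra ℂ A] [StarModule ℂ A] {α : Translations d A} (ω : StationaryState α)
    (ε : J → Momentum d → ℝ) where
  toFun : J → 𝓢(Momentum d, ℂ) →ₗ[ℂ] GNS ω.toState
  inner_eq : ∀ j k f g, ⟪toFun j f, toFun k g⟫_ℂ =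
    if j = k then ∫ p, star (f p) * g p else 0
  covariant : ∀ j x s f g,
    (∀ p, g p = Complex.exp (Complex.I * ((⟪p, x⟫_ℝ - s * ε j p : ℝ) : ℂ)) * f p) →
      toFun j g = ω.translate x s (toFun j f)

/-! ### Exchange signs, asymptotic (anti)commutativity -/

open Classical in
/-- The sign `-1` if both indices are fermionic, and `1` otherwise. -/
noncomputable def exchangeSign {J : Type*} (fermi : Set J) (j k : J) : ℂ :=
  if j ∈ fermi ∧ k ∈ fermi then -1 else 1

/-- Asymptotic (anti)commutativity: the operator norm of the anticommutator (both kinds fermionic)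
or commutator (otherwise) of `B̂ᵢ(x, s)` and `B̂ₗ` decays faster than any power of `‖x‖`, with
coefficients growing at most polynomially in `s`. -/
def AsymptoticallyCommuting {d : ℕ} {A J ι : Type*} [NormedRing A] [StarRing A] [NormedStarGroup A]
    [NormedAlgebra ℂ A] [StarModule ℂ A] {α : Translations d A} (ω : StationaryState α)
    (fermi : Set J) (κ : ι → J) (B : ι → A) : Prop :=
  ∀ i l, ∀ N : ℕ, ∃ (C : ℝ) (M : ℕ), ∀ x s,
    ‖gnsRep ω.toState (α.toFun x s (B i) * B l -
      exchangeSign fermi (κ i) (κ l) • (B l * α.toFun x s (B i)))‖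
      ≤ C * (1 + |s|) ^ M / (1 + ‖x‖ ^ N)

/-! ### Truncated correlation functions and the strong cluster property -/

/-- The sublist of `l` formed by the positions in `b`, in increasing order. -/
def subword {Z : Type*} (l : List Z) (b : Finset (Fin l.length)) : List Z :=
  (b.sort (· ≤ ·)).map l.get

open Classical in
/-- The sign of the permutation of the odd entries of `l` that puts the blocks of `P` one after
another, in the order of their smallest elements. -/
noncomputable def partitionSign {Z : Type*} (odd : Set Z) (l : List Z)
    (P : Finpartition (Finset.univ : Finset (Fin l.length))) : ℂ :=
  ∏ p : Fin l.length × Fin l.length,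
    if p.1 < p.2 ∧ l.get p.1 ∈ odd ∧ l.get p.2 ∈ odd ∧ (P.part p.2).min < (P.part p.1).min
    then -1 else 1

theorem card_lt_of_univ_notMem {n : ℕ} {P : Finpartition (Finset.univ : Finset (Fin n))}
    (hP : Finset.univ ∉ P.parts) {b : Finset (Fin n)} (hb : b ∈ P.parts) : b.card < n := by
  have hle : b.card ≤ n := by simpa using Finset.card_le_univ b
  refine lt_of_le_of_ne hle fun h => hP ?_
  have hbu : b = Finset.univ := Finset.eq_univ_of_card b (by simpa using h)
  exact Eq.mp (congrArg (· ∈ P.parts) hbu) hb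

open Classical in
/-- The truncated functions `wᵀ` of a family of functions `w`. They are determined recursively, for
words `l` of positive length, by `w(l) = ∑_P ± ∏_{b ∈ P} wᵀ(l|b)`, the sum over all partitions `P`
of the positions of `l`; here the partition with the single block `l` is split off. -/
noncomputable def truncated {Z : Type*} (odd : Set Z) (w : List Z → ℂ) (l : List Z) : ℂ :=
  w l - ∑ P : {P : Finpartition (Finset.univ : Finset (Fin l.length)) // Finset.univ ∉ P.parts},
    partitionSign odd l P.1 * ∏ b : P.1.parts, truncated odd w (subword l b.1)
termination_by l.length
decreasing_by
  simpa [subword] using card_lt_of_univ_notMem P.2 b.2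

/-- The operators whose correlation functions are considered: `((i, false), x, s)` stands for
`Bᵢ(x, s)` and `((i, true), x, s)` for its adjoint `Bᵢ(x, s)*`. -/
def fieldAt {d : ℕ} {A ι : Type*} [NormedRing A] [StarRing A] [NormedAlgebra ℂ A]
    (α : Translations d A) (B : ι → A) (z : (ι × Bool) × (Momentum d × ℝ)) : A :=
  α.toFun z.2.1 z.2.2 (if z.1.2 then star (B z.1.1) else B z.1.1)

/-- The correlation functions `⟨θ, Â₁(x₁, s₁) ⋯ Âₙ(xₙ, sₙ) θ⟩ = ω(A₁(x₁, s₁) ⋯ Aₙ(xₙ, sₙ))`, where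
each `Aₗ` is one of the `Bᵢ` or `Bᵢ*`. -/
noncomputable def correlation {d : ℕ} {A ι : Type*} [NormedRing A] [StarRing A] [NormedAlgebra ℂ A]
    {α : Translations d A} (ω : StationaryState α) (B : ι → A)
    (l : List ((ι × Bool) × (Momentum d × ℝ))) : ℂ :=
  ω.toCLM (l.map (fieldAt α B)).prod

/-- Strong cluster property: the truncated correlation functions decay faster than any power of
each `‖x_a - x_b‖` and grow at most polynomially in the time variables. -/
def StrongClusterProperty {d : ℕ} {A J ι : Type*} [NormedRing A] [StarRing A] [NormedAlgebra ℂ A]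
    {α : Translations d A} (ω : StationaryState α) (fermi : Set J) (κ : ι → J) (B : ι → A) : Prop :=
  ∀ (n : ℕ) (c : Fin n → ι × Bool) (N : ℕ), ∃ (C : ℝ) (M : ℕ),
    ∀ (x : Fin n → Momentum d) (s : Fin n → ℝ) (a b : Fin n),
      ‖truncated {z | κ z.1.1 ∈ fermi} (correlation ω B) (List.ofFn fun m => (c m, x m, s m))‖
        ≤ C * (1 + ∑ m, |s m|) ^ M / (1 + ‖x a - x b‖ ^ N)

/-! ### Wave packets, smeared operators -/

/-- `f_τ(x) = (2π)^{-d} ∫ f(k) e^{iτε(k)} e^{-i⟨k, x⟩} dk`. -/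
noncomputable def packet {d : ℕ} (ε : Momentum d → ℝ) (f : 𝓢(Momentum d, ℂ)) (τ : ℝ)
    (x : Momentum d) : ℂ :=
  (((2 * Real.pi) ^ d : ℝ) : ℂ)⁻¹ *
    ∫ k, Complex.exp (Complex.I * ((τ * ε k - ⟪k, x⟫_ℝ : ℝ) : ℂ)) * f k

/-- `B(f, τ) = ∫ f_τ(x) B(x, τ) dx`. -/
noncomputable def smeared {d : ℕ} {A : Type*} [NormedRing A] [StarRing A] [NormedAlgebra ℂ A]
    (α : Translations d A) (ε : Momentum d → ℝ) (b : A) (f : 𝓢(Momentum d, ℂ)) (τ : ℝ) : A :=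
  ∫ x, packet ε f τ x • α.toFun x τ b

/-- The vector `B̂_{i₁}(f₁, τ₁) ⋯ B̂_{iₙ}(fₙ, τₙ) θ`. -/
noncomputable def scatteringVec {d : ℕ} {A J ι : Type*} [NormedRing A] [StarRing A]
    [NormedStarGroup A] [NormedAlgebra ℂ A] [StarModule ℂ A] {α : Translations d A}
    (ω : StationaryState α) (ε : J → Momentum d → ℝ) (κ : ι → J) (B : ι → A)
    {n : ℕ} (i : Fin n → ι) (f : Fin n → 𝓢(Momentum d, ℂ)) (τ : Fin n → ℝ) : GNS ω.toState :=
  gnsVec ω.toState (List.ofFn fun m => smeared α (ε (κ (i m))) (B (i m)) (f m) (τ m)).prod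

/-- The compactly supported wave functions `f₁, …, fₙ` of particles of kinds `j₁, …, jₙ` do not
overlap: the compact sets of velocities `∇ε(k, j_m)`, `k ∈ supp f_m`, are pairwise disjoint. -/
def NonOverlapping {d : ℕ} {J : Type*} (ε : J → Momentum d → ℝ) {n : ℕ} (j : Fin n → J)
    (f : Fin n → 𝓢(Momentum d, ℂ)) : Prop :=
  (∀ m, HasCompactSupport (f m)) ∧
    Pairwise fun a b => Disjoint (gradient (ε (j a)) '' tsupport (f a))
      (gradient (ε (j b)) '' tsupport (f b))

/-- The times tend to `-∞`, with no time being larger in modulus than the `M`-th power of the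
modulus of a time further to the right. For `M = 1` this contains the case of equal times. -/
def inFilter (n M : ℕ) : Filter (Fin n → ℝ) :=
  Filter.pi (fun _ => Filter.atBot) ⊓ Filter.principal {τ | ∀ a b, a < b → |τ a| ≤ |τ b| ^ M}

/-! ### The asymptotic Fock space -/

section Fock

variable (d : ℕ) (J : Type*) [MeasurableSpace J]

/-- Lebesgue measure on momenta times counting measure on the discrete index. -/
noncomputable def modeMeasure : Measure (Momentum d × J) := (volume : Measure (Momentum d)).prod .count

/-- The one-particle space `L²(ℝ^d × J)`. -/
abbrev OneParticle : Type _ := Lp ℂ 2 (modeMeasure d J)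

/-- The space `L²((ℝ^d × J)^n)` of (not yet symmetrized) `n`-particle wave functions. -/
abbrev NParticle (n : ℕ) : Type _ := Lp ℂ 2 (Measure.pi fun _ : Fin n => modeMeasure d J)

/-- The Hilbert sum of the spaces `L²((ℝ^d × J)^n)`. -/
abbrev FullFock : Type _ := lp (fun n => NParticle d J n) 2

variable {d J}

theorem memLp_vacuumFun : MemLp (fun _ : Fin 0 → Momentum d × J => (1 : ℂ)) 2
    (Measure.pi fun _ : Fin 0 => modeMeasure d J) := by
  rw [Measure.pi_of_empty _ Fin.elim0]
  exact memLp_const 1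

variable [Countable J] [DiscreteMeasurableSpace J]

instance : SigmaFinite (modeMeasure d J) := by unfold modeMeasure; infer_instance

theorem memLp_mul_prod {X Y : Type*} [MeasurableSpace X] [MeasurableSpace Y] {μ : Measure X}
    {ν : Measure Y} [SFinite μ] [SFinite ν] {g : X → ℂ} {h : Y → ℂ} (hg : MemLp g 2 μ)
    (hh : MemLp h 2 ν) : MemLp (fun z : X × Y => g z.1 * h z.2) 2 (μ.prod ν) := by
  have hm : AEStronglyMeasurable (fun z : X × Y => g z.1 * h z.2) (μ.prod ν) :=
    hg.1.comp_fst.mul hh.1.comp_snd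
  rw [memLp_two_iff_integrable_sq_norm hm]
  simpa only [norm_mul, mul_pow] using
    ((memLp_two_iff_integrable_sq_norm hg.1).1 hg).mul_prod
      ((memLp_two_iff_integrable_sq_norm hh.1).1 hh)

theorem memLp_mul_succAbove {X : Type*} [MeasurableSpace X] {μ : Measure X} [SigmaFinite μ] {n : ℕ}
    (m : Fin (n + 1)) {g : X → ℂ} {F : (Fin n → X) → ℂ} (hg : MemLp g 2 μ)
    (hF : MemLp F 2 (Measure.pi fun _ : Fin n => μ)) :
    MemLp (fun x : Fin (n + 1) → X => g (x m) * F fun l => x (m.succAbove l)) 2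
      (Measure.pi fun _ : Fin (n + 1) => μ) :=
  (memLp_mul_prod hg hF).comp_measurePreserving
    (measurePreserving_piFinSuccAbove (fun _ : Fin (n + 1) => μ) m)

/-- The wave function of `b⁺(g) F`, for an `n`-particle wave function `F`:
`(b⁺(g)F)(x₀, …, xₙ) = (n+1)^{-1/2} ∑ₘ ± g(xₘ) F(x₀, …, x̂ₘ, …, xₙ)`,
with a factor `-1` for every fermion that a fermionic `xₘ` is moved past. -/
noncomputable def creationFun (fermi : Set J) {n : ℕ} (g : Momentum d × J → ℂ)
    (F : (Fin n → Momentum d × J) → ℂ) (x : Fin (n + 1) → Momentum d × J) : ℂ :=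
  ((√(n + 1 : ℝ))⁻¹ : ℝ) * ∑ m, (∏ l ∈ Finset.Iio m, exchangeSign fermi (x l).2 (x m).2) *
    (g (x m) * F fun l => x (m.succAbove l))

theorem memLp_creationFun (fermi : Set J) {n : ℕ} (g : OneParticle d J) (F : NParticle d J n) :
    MemLp (creationFun fermi g F) 2 (Measure.pi fun _ : Fin (n + 1) => modeMeasure d J) := by
  suffices h : ∀ m : Fin (n + 1), MemLp (fun x : Fin (n + 1) → Momentum d × J =>
      (∏ l ∈ Finset.Iio m, exchangeSign fermi (x l).2 (x m).2) *
        (g (x m) * F fun l => x (m.succAbove l))) 2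
      (Measure.pi fun _ : Fin (n + 1) => modeMeasure d J) by
    have hsum := memLp_finsetSum Finset.univ fun m _ => h m
    exact hsum.const_mul _
  intro m
  have h1 : MemLp (fun x : Fin (n + 1) → Momentum d × J => g (x m) * F fun l => x (m.succAbove l))
      2 (Measure.pi fun _ : Fin (n + 1) => modeMeasure d J) :=
    memLp_mul_succAbove m (Lp.memLp g) (Lp.memLp F)
  have hs : Measurable fun x : Fin (n + 1) → Momentum d × J =>
      ∏ l ∈ Finset.Iio m, exchangeSign fermi (x l).2 (x m).2 := by
    refine Finset.measurable_prod _ fun l _ => ?_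
    have : Measurable fun p : J × J => exchangeSign fermi p.1 p.2 := measurable_of_countable _
    exact this.comp (by fun_prop : Measurable fun x : Fin (n + 1) → Momentum d × J =>
      ((x l).2, (x m).2))
  refine h1.of_le (hs.aestronglyMeasurable.mul h1.1) (.of_forall fun x => ?_)
  rw [norm_mul, norm_prod]
  refine mul_le_of_le_one_left (norm_nonneg _) (Finset.prod_le_one (fun _ _ => norm_nonneg _) ?_)
  intro l _
  unfold exchangeSign
  split_ifs <;> simp

/-- The creation operator `b⁺(g) = ∑_j ∫ g(k, j) b⁺(k, j) dk` from `n`-particle to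
`(n+1)`-particle wave functions. -/
noncomputable def creation (fermi : Set J) {n : ℕ} (g : OneParticle d J) (F : NParticle d J n) :
    NParticle d J (n + 1) :=
  (memLp_creationFun fermi g F).toLp

/-- `b⁺(g₁) ⋯ b⁺(gₙ) |0⟩` as an `n`-particle wave function. -/
noncomputable def creationProduct (fermi : Set J) :
    (n : ℕ) → (Fin n → OneParticle d J) → NParticle d J n
  | 0, _ => memLp_vacuumFun.toLp
  | n + 1, g => creation fermi (g 0) (creationProduct fermi n (Fin.tail g))

variable (d) in
/-- The asymptotic Fock space: the closed subspace of the full Fock space generated by the vectors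
`b⁺(g₁) ⋯ b⁺(gₙ) |0⟩`. It consists of the square integrable wave functions with the symmetry
prescribed by the canonical (anti)commutation relations, with anticommutators for two fermionic
indices and commutators otherwise. -/
noncomputable def asymptoticFock (fermi : Set J) : Submodule ℂ (FullFock d J) :=
  (Submodule.span ℂ (Set.range fun p : Σ n, Fin n → OneParticle d J =>
    (lp.single 2 p.1 (creationProduct fermi p.1 p.2) : FullFock d J))).topologicalClosure

/-- The vector `b⁺(g₁) ⋯ b⁺(gₙ) |0⟩` of the asymptotic Fock space. -/
noncomputable def fockVec (fermi : Set J) {n : ℕ} (g : Fin n → OneParticle d J) :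
    asymptoticFock d fermi :=
  ⟨lp.single 2 n (creationProduct fermi n g),
    Submodule.le_topologicalClosure _ (Submodule.subset_span ⟨⟨n, g⟩, rfl⟩)⟩

/-- The Fock vacuum `|0⟩`. -/
noncomputable def vacuum (fermi : Set J) : asymptoticFock d fermi :=
  fockVec fermi (Fin.elim0 : Fin 0 → OneParticle d J)

open Classical in
theorem memLp_mode (j : J) (f φ : 𝓢(Momentum d, ℂ)) :
    MemLp (fun p : Momentum d × J => if p.2 = j then f p.1 * φ p.1 else 0) 2 (modeMeasure d J) := by
  have h1 : MemLp (fun k => f k * φ k) 2 (volume : Measure (Momentum d)) :=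
    (φ.memLp 2).mul (f.memLp_top)
  have h2 : MemLp (Set.indicator {j} fun _ : J => (1 : ℂ)) 2 (Measure.count : Measure J) :=
    memLp_indicator_const 2 (.singleton j) 1 (.inr (by simp))
  have h3 := memLp_mul_prod h1 h2
  unfold modeMeasure
  convert h3 using 2 with p
  by_cases hp : p.2 = j <;> simp [hp]

open Classical in
/-- The one-particle vector with wave function `f φ` and discrete index `j`. -/
noncomputable def mode (j : J) (f φ : 𝓢(Momentum d, ℂ)) : OneParticle d J :=
  (memLp_mode j f φ).toLp

end Fock

/-! ### The Møller matrix -/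

section Moller

variable {d : ℕ} {A J ι : Type*} [NormedRing A] [StarRing A] [NormedStarGroup A]
  [NormedAlgebra ℂ A] [StarModule ℂ A] [MeasurableSpace J] [Countable J]
  [DiscreteMeasurableSpace J] {α : Translations d A}

/-- The formula
`S₋ (b⁺(f₁φ_{i₁}, κ i₁) ⋯ b⁺(fₙφ_{iₙ}, κ iₙ) |0⟩) = lim B̂_{i₁}(f₁, τ₁) ⋯ B̂_{iₙ}(fₙ, τₙ) θ` for
non-overlapping families; the limit is part of the statement. -/
def MapsProductsToInStates (ω : StationaryState α) (ε : J → Momentum d → ℝ) (fermi : Set J)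
    (κ : ι → J) (φ : ι → 𝓢(Momentum d, ℂ)) (B : ι → A)
    (S : asymptoticFock d fermi → GNS ω.toState) : Prop :=
  ∀ (n : ℕ) (i : Fin n → ι) (f : Fin n → 𝓢(Momentum d, ℂ)),
    NonOverlapping ε (fun m => κ (i m)) f → ∀ M : ℕ,
      Filter.Tendsto (scatteringVec ω ε κ B i f) (inFilter n M)
        (𝓝 (S (fockVec fermi fun m => mode (κ (i m)) (f m) (φ (i m)))))

/-- The relations `S₋|0⟩ = θ` and `a⁺_in(g) S₋ = S₋ b⁺(g)`, where
`a⁺_in(fφᵢ, κ i) = lim_{τ → -∞} B̂ᵢ(f, τ)` is the strong limit on the vectors `S₋ Ψ`, with `Ψ` a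
product of creation operators applied to the vacuum whose wave functions do not overlap with each
other and with `f`. -/
def IntertwinesCreation (ω : StationaryState α) (ε : J → Momentum d → ℝ) (fermi : Set J)
    (κ : ι → J) (φ : ι → 𝓢(Momentum d, ℂ)) (B : ι → A)
    (S : asymptoticFock d fermi → GNS ω.toState) : Prop :=
  S (vacuum fermi) = gnsVec ω.toState 1 ∧
  ∀ (n : ℕ) (i₀ : ι) (f₀ : 𝓢(Momentum d, ℂ)) (i : Fin n → ι) (f : Fin n → 𝓢(Momentum d, ℂ)),
    NonOverlapping ε (Fin.cons (κ i₀) fun m => κ (i m)) (Fin.cons f₀ f) →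
      Filter.Tendsto
        (fun τ => gnsRep ω.toState (smeared α (ε (κ i₀)) (B i₀) f₀ τ)
          (S (fockVec fermi fun m => mode (κ (i m)) (f m) (φ (i m)))))
        Filter.atBot
        (𝓝 (S (fockVec fermi
          (Fin.cons (mode (κ i₀) f₀ (φ i₀)) fun m => mode (κ (i m)) (f m) (φ (i m))))))

end Moller

end HaagRuelle

open HaagRuelle

/-!
Scattering states are built from wave packets that separate at early times.

By the method of non-stationary phase, a wave packet with momentum space wave function `f` is
concentrated near the positions `τ ∇ε(k)`, `k ∈ supp f`, up to errors that decrease faster than any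
power. For two wave packets with disjoint sets of velocities this means that a large time forces a
large distance (`exists_norm_packet_mul_norm_packet_le`). Asymptotic (anti)commutativity therefore
makes the (anti)commutators of smeared operators with disjoint velocities decrease rapidly
(`exists_norm_commutator_smeared_le`). On the other hand `B̂(f, τ)θ` does not depend on `τ`, as the
time dependence of the packet cancels that of the one-particle vector (`gnsVec_smeared`). In the
difference of `B̂₁(f₁, τ) ⋯ B̂ₙ(fₙ, τ)θ` at two nearby times, every increment of an operator can be
moved to the right, where it annihilates `θ`; so these differences decrease rapidly, and a discrete
form of Cook's criterion yields the in-state, again with a rapidly decreasing error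
(`exists_rapid_limit`, `exists_isInState`). Since the norms of the smeared operators grow only
polynomially, this error survives the application of further operators at other times. That gives
the limit at different times (`IsInState.tendsto_inFilter`) and the action of `a⁺_in` on in-states
(`IsInState.tendsto_gnsRep`).

The scalar product of two in-states is the limit of vacuum expectations at equal times, which are
expanded into truncated functions. A partition with a singleton does not contribute, because the
vacuum expectation of an operator creating a one-particle vector vanishes
(`map_eq_zero_of_gnsVec_eq`). A block containing two operators of the same in-state has disjoint
velocities, and by the strong cluster property its contribution tends to zero
(`tendsto_clusterTerm_zero`). There remain the partitions into pairs of one operator from each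
state. Their contributions are products of scalar products of one-particle vectors
(`clusterTerm_pairing`), with the signs of the corresponding permutations (`wordSign_pairing`). The
result (`tendsto_inner_scatteringVec`) is the formula for the scalar products of Fock vectors
(`inner_fockVec_mode`).

A map between Hilbert spaces that preserves scalar products on a total set extends to an isometry
(`exists_linearIsometry_apply_eq`), so it remains to see that the products of creation operators
with non-overlapping wave functions are total in the Fock space. Strict convexity makes the velocity
an injective function of the momentum (`gradient_injective`); hence almost every configuration of
momenta has pairwise different velocities (`ae_ne_of_injective`), and near such a configuration all
products of sufficiently localized wave functions are non-overlapping. By Lebesgue's differentiation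
theorem a wave function orthogonal to all of them vanishes
(`ae_eq_zero_of_integral_mul_prod_eq_zero`, `eq_zero_of_inner_fockVec_eq_zero`). Totality also
gives uniqueness (`eq_of_forall_fockVec_eq`), since either property of `S₋` determines its values on
these products; for the second one this follows by induction on the number of particles
(`apply_fockVec_eq_of_intertwines`).
-/

namespace HaagRuelle

/-! ### Non-stationary phase -/

section NonstationaryPhase

open scoped ContDiff

variable {d : ℕ}

theorem contDiff_gradient {ε : Momentum d → ℝ} (hε : ContDiff ℝ ∞ ε) :
    ContDiff ℝ ∞ (gradient ε) := by
  have h : ContDiff ℝ ∞ (fderiv ℝ ε) := hε.fderiv_right (by simp)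
  exact (InnerProductSpace.toDual ℝ (Momentum d)).symm.toContinuousLinearEquiv.contDiff.comp h

/-- The gradient in `k` of the phase `a ε(k) - ⟨k, y⟩`, where `p = (a, y)`. -/
noncomputable def phaseGrad (ε : Momentum d → ℝ) (p : ℝ × Momentum d) (k : Momentum d) :
    Momentum d :=
  p.1 • gradient ε k - p.2

/-- The oscillatory factor `exp(iρ(a ε(k) - ⟨k, y⟩))`, where `p = (a, y)`. -/
noncomputable def phaseExp (ε : Momentum d → ℝ) (ρ : ℝ) (p : ℝ × Momentum d) (k : Momentum d) : ℂ :=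
  Complex.exp (Complex.I * ((ρ * (p.1 * ε k - ⟪k, p.2⟫_ℝ) : ℝ) : ℂ))

/-- The oscillatory integral with large parameter `ρ`, phase direction `p = (a, y)` and an
amplitude `H` that may itself depend on `p`. -/
noncomputable def oscIntegral (ε : Momentum d → ℝ) (H : (ℝ × Momentum d) × Momentum d → ℂ) (ρ : ℝ)
    (p : ℝ × Momentum d) : ℂ :=
  ∫ k, H (p, k) * phaseExp ε ρ p k

theorem norm_phaseExp (ε : Momentum d → ℝ) (ρ : ℝ) (p : ℝ × Momentum d) (k : Momentum d) :
    ‖phaseExp ε ρ p k‖ = 1 := by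
  rw [phaseExp, mul_comm, Complex.norm_exp_ofReal_mul_I]

theorem contDiff_phaseExp {ε : Momentum d → ℝ} (hε : ContDiff ℝ ∞ ε) (ρ : ℝ)
    (p : ℝ × Momentum d) : ContDiff ℝ ∞ (phaseExp ε ρ p) := by
  unfold phaseExp
  refine Complex.contDiff_exp.comp (contDiff_const.mul (Complex.ofRealCLM.contDiff.comp ?_))
  exact contDiff_const.mul ((contDiff_const.mul hε).sub (contDiff_id.inner ℝ contDiff_const))

theorem fderiv_phaseExp {ε : Momentum d → ℝ} (hε : ContDiff ℝ ∞ ε) (ρ : ℝ)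
    (p : ℝ × Momentum d) (k v : Momentum d) :
    fderiv ℝ (phaseExp ε ρ p) k v =
      Complex.I * ρ * (⟪phaseGrad ε p k, v⟫_ℝ : ℂ) * phaseExp ε ρ p k := by
  have h0 : HasFDerivAt ε (fderiv ℝ ε k) k :=
    (hε.differentiable (by simp) k).hasFDerivAt
  have h1 : HasFDerivAt (fun k : Momentum d => ρ * (p.1 * ε k - ⟪k, p.2⟫_ℝ))
      (ρ • (p.1 • fderiv ℝ ε k - innerSL ℝ p.2)) k := by
    refine HasFDerivAt.const_mul (HasFDerivAt.sub (h0.const_mul _) ?_) ρ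
    have := (innerSL ℝ p.2).hasFDerivAt (x := k)
    refine this.congr_of_eventuallyEq (.of_forall fun x => ?_)
    simp [real_inner_comm]
  have h2 := ((Complex.ofRealCLM.hasFDerivAt.comp k h1).const_mul Complex.I).cexp
  have h3 : fderiv ℝ (phaseExp ε ρ p) k = _ := h2.fderiv
  rw [h3, phaseGrad, inner_sub_left, real_inner_smul_left, inner_gradient_left]
  change Complex.exp _ * (Complex.I * ((ρ * (p.1 * fderiv ℝ ε k v - ⟪p.2, v⟫_ℝ) : ℝ) : ℂ)) = _
  rw [phaseExp]
  simp only [Function.comp_apply, Complex.ofRealCLM_apply]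
  push_cast
  ring

/-- Integration by parts along the vector field `∇ψ / |∇ψ|²`: the new amplitude. -/
noncomputable def divAmplitude (ε : Momentum d → ℝ) (H : (ℝ × Momentum d) × Momentum d → ℂ)
    (z : (ℝ × Momentum d) × Momentum d) : ℂ :=
  ∑ l : Fin d, fderiv ℝ (fun z : (ℝ × Momentum d) × Momentum d =>
    H z * (‖phaseGrad ε z.1 z.2‖ ^ 2 : ℂ)⁻¹ *
      (⟪phaseGrad ε z.1 z.2, EuclideanSpace.basisFun (Fin d) ℝ l⟫_ℝ : ℂ)) z
    (0, EuclideanSpace.basisFun (Fin d) ℝ l)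

theorem contDiff_phaseGrad {ε : Momentum d → ℝ} (hε : ContDiff ℝ ∞ ε) :
    ContDiff ℝ ∞ fun z : (ℝ × Momentum d) × Momentum d => phaseGrad ε z.1 z.2 := by
  unfold phaseGrad
  exact (contDiff_fst.fst.smul ((contDiff_gradient hε).comp contDiff_snd)).sub contDiff_fst.snd

theorem contDiff_fieldAmplitude {ε : Momentum d → ℝ} (hε : ContDiff ℝ ∞ ε)
    {H : (ℝ × Momentum d) × Momentum d → ℂ} (hH : ContDiff ℝ ∞ H)
    (hne : ∀ z ∈ tsupport H, phaseGrad ε z.1 z.2 ≠ 0) (v : Momentum d) :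
    ContDiff ℝ ∞ fun z : (ℝ × Momentum d) × Momentum d =>
      H z * (‖phaseGrad ε z.1 z.2‖ ^ 2 : ℂ)⁻¹ * (⟪phaseGrad ε z.1 z.2, v⟫_ℝ : ℂ) := by
  refine ContDiff.mul ?_
    (Complex.ofRealCLM.contDiff.comp ((contDiff_phaseGrad hε).inner ℝ contDiff_const))
  rw [contDiff_iff_contDiffAt]
  intro z
  by_cases hz : z ∈ tsupport H
  · refine hH.contDiffAt.mul (ContDiffAt.inv ?_ ?_)
    · have : ContDiff ℝ ∞ fun z : (ℝ × Momentum d) × Momentum d =>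
          ((‖phaseGrad ε z.1 z.2‖ ^ 2 : ℝ) : ℂ) :=
        Complex.ofRealCLM.contDiff.comp ((contDiff_phaseGrad hε).norm_sq ℝ)
      simpa using this.contDiffAt
    · simpa using hne z hz
  · have : (fun z : (ℝ × Momentum d) × Momentum d =>
        H z * (‖phaseGrad ε z.1 z.2‖ ^ 2 : ℂ)⁻¹) =ᶠ[𝓝 z] fun _ => 0 := by
      filter_upwards [notMem_tsupport_iff_eventuallyEq.mp hz] with y hy
      simp [hy]
    exact contDiffAt_const.congr_of_eventuallyEq this

theorem tsupport_fieldAmplitude_subset (ε : Momentum d → ℝ)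
    (H : (ℝ × Momentum d) × Momentum d → ℂ) (v : Momentum d) :
    tsupport (fun z : (ℝ × Momentum d) × Momentum d =>
      H z * (‖phaseGrad ε z.1 z.2‖ ^ 2 : ℂ)⁻¹ * (⟪phaseGrad ε z.1 z.2, v⟫_ℝ : ℂ)) ⊆ tsupport H := by
  refine closure_mono fun z hz => ?_
  contrapose! hz
  simp only [Function.mem_support, ne_eq, not_not] at hz ⊢
  simp [hz]

theorem contDiff_divAmplitude {ε : Momentum d → ℝ} (hε : ContDiff ℝ ∞ ε)
    {H : (ℝ × Momentum d) × Momentum d → ℂ} (hH : ContDiff ℝ ∞ H)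
    (hne : ∀ z ∈ tsupport H, phaseGrad ε z.1 z.2 ≠ 0) : ContDiff ℝ ∞ (divAmplitude ε H) := by
  unfold divAmplitude
  refine ContDiff.sum fun l _ => ?_
  exact ((contDiff_fieldAmplitude hε hH hne _).fderiv_right (by simp)).clm_apply contDiff_const

theorem tsupport_divAmplitude_subset (ε : Momentum d → ℝ)
    (H : (ℝ × Momentum d) × Momentum d → ℂ) : tsupport (divAmplitude ε H) ⊆ tsupport H := by
  refine closure_minimal (fun z hz => ?_) (isClosed_tsupport _)
  by_contra hz'
  refine hz (Finset.sum_eq_zero fun l _ => ?_)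
  have h1 := fun h => hz' (tsupport_fieldAmplitude_subset ε H
    (EuclideanSpace.basisFun (Fin d) ℝ l) (tsupport_fderiv_subset ℝ h))
  rw [image_eq_zero_of_notMem_tsupport h1]
  rfl

theorem hasCompactSupport_slice {H : (ℝ × Momentum d) × Momentum d → ℂ} (hc : HasCompactSupport H)
    (p : ℝ × Momentum d) : HasCompactSupport fun k => H (p, k) := by
  refine HasCompactSupport.intro (hc.isCompact.image continuous_snd) fun k hk => ?_
  by_contra h
  exact hk ⟨(p, k), subset_tsupport _ h, rfl⟩

/-- One integration by parts along `∇ψ / |∇ψ|²` gains a factor `ρ⁻¹`: the phase `ψ` satisfies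
`(∇ψ / |∇ψ|²) · ∇ e^{iρψ} = iρ e^{iρψ}`. -/
theorem oscIntegral_divAmplitude {ε : Momentum d → ℝ} (hε : ContDiff ℝ ∞ ε)
    {H : (ℝ × Momentum d) × Momentum d → ℂ} (hH : ContDiff ℝ ∞ H) (hc : HasCompactSupport H)
    (hne : ∀ z ∈ tsupport H, phaseGrad ε z.1 z.2 ≠ 0) (ρ : ℝ) (p : ℝ × Momentum d) :
    oscIntegral ε (divAmplitude ε H) ρ p = -(Complex.I * ρ) * oscIntegral ε H ρ p := by
  set b := EuclideanSpace.basisFun (Fin d) ℝ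
  set W : Fin d → (ℝ × Momentum d) × Momentum d → ℂ := fun l z =>
    H z * (‖phaseGrad ε z.1 z.2‖ ^ 2 : ℂ)⁻¹ * (⟪phaseGrad ε z.1 z.2, b l⟫_ℝ : ℂ) with hW
  have hWs : ∀ l, ContDiff ℝ ∞ (W l) := fun l => contDiff_fieldAmplitude hε hH hne (b l)
  have hWc : ∀ l, HasCompactSupport (W l) := fun l =>
    hc.of_isClosed_subset (isClosed_tsupport _) (tsupport_fieldAmplitude_subset ε H (b l))
  have hslice : ∀ l, ContDiff ℝ ∞ fun k => W l (p, k) := fun l =>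
    (hWs l).comp (contDiff_const.prodMk contDiff_id)
  have hE := contDiff_phaseExp hε ρ p
  have hpart : ∀ l k, fderiv ℝ (W l) (p, k) (0, b l) = fderiv ℝ (fun k => W l (p, k)) k (b l) := by
    intro l k
    have h1 : HasFDerivAt (fun k : Momentum d => (p, k))
        (ContinuousLinearMap.inr ℝ (ℝ × Momentum d) (Momentum d)) k := by
      exact hasFDerivAt_prodMk_right p k
    have h2 := ((hWs l).differentiable (by simp) (p, k)).hasFDerivAt.comp k h1
    have h3 : fderiv ℝ (fun k => W l (p, k)) k = _ := h2.fderiv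
    rw [h3]
    rfl
  have hi1 : ∀ l, Integrable fun k =>
      fderiv ℝ (fun k => W l (p, k)) k (b l) * phaseExp ε ρ p k := by
    intro l
    refine Continuous.integrable_of_hasCompactSupport ?_ ?_
    · exact (((hslice l).continuous_fderiv (by simp)).clm_apply continuous_const).mul hE.continuous
    · exact ((hasCompactSupport_slice (hWc l) p).fderiv_apply ℝ (b l)).mul_right
  have hi2 : ∀ l, Integrable fun k => W l (p, k) * fderiv ℝ (phaseExp ε ρ p) k (b l) := by
    intro l
    refine Continuous.integrable_of_hasCompactSupport ?_ ?_
    · exact (hslice l).continuous.mul ((hE.continuous_fderiv (by simp)).clm_apply continuous_const)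
    · exact (hasCompactSupport_slice (hWc l) p).mul_right
  have hi3 : ∀ l, Integrable fun k => W l (p, k) * phaseExp ε ρ p k := by
    intro l
    refine Continuous.integrable_of_hasCompactSupport ?_ ?_
    · exact (hslice l).continuous.mul hE.continuous
    · exact (hasCompactSupport_slice (hWc l) p).mul_right
  have hparts : ∀ l, ∫ k, fderiv ℝ (fun k => W l (p, k)) k (b l) * phaseExp ε ρ p k =
      -∫ k, W l (p, k) * fderiv ℝ (phaseExp ε ρ p) k (b l) := by
    intro l
    rw [integral_mul_fderiv_eq_neg_fderiv_mul_of_integrable (hi1 l) (hi2 l) (hi3 l)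
      (fun x _ => (hslice l).differentiable (by simp) x)
      (fun x _ => hE.differentiable (by simp) x), neg_neg]
  calc oscIntegral ε (divAmplitude ε H) ρ p
      = ∫ k, ∑ l, fderiv ℝ (fun k => W l (p, k)) k (b l) * phaseExp ε ρ p k := by
        refine integral_congr_ae (.of_forall fun k => ?_)
        simp only [divAmplitude, Finset.sum_mul]
        exact Finset.sum_congr rfl fun l _ => by rw [← hpart]
    _ = ∑ l, -∫ k, W l (p, k) * fderiv ℝ (phaseExp ε ρ p) k (b l) := by
        rw [integral_finsetSum _ fun l _ => hi1 l]
        exact Finset.sum_congr rfl fun l _ => hparts l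
    _ = -∫ k, ∑ l, W l (p, k) * fderiv ℝ (phaseExp ε ρ p) k (b l) := by
        rw [integral_finsetSum _ fun l _ => hi2 l, Finset.sum_neg_distrib]
    _ = -∫ k, Complex.I * ρ * (H (p, k) * phaseExp ε ρ p k) := by
        congr 1
        refine integral_congr_ae (.of_forall fun k => ?_)
        simp only [fderiv_phaseExp hε, hW]
        by_cases hk : (p, k) ∈ tsupport H
        · have hg := hne _ hk
          have hsum : ∑ l, (⟪phaseGrad ε p k, b l⟫_ℝ : ℂ) * (⟪phaseGrad ε p k, b l⟫_ℝ : ℂ)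
              = (‖phaseGrad ε p k‖ ^ 2 : ℂ) := by
            have := b.sum_sq_inner_left (phaseGrad ε p k)
            rw [← Complex.ofReal_pow, ← this]
            push_cast
            exact Finset.sum_congr rfl fun l _ => by rw [sq, real_inner_comm]
          have hg' : (‖phaseGrad ε p k‖ ^ 2 : ℂ) ≠ 0 := by simpa using hg
          calc _ = ∑ l, Complex.I * ρ * (H (p, k) * (‖phaseGrad ε p k‖ ^ 2 : ℂ)⁻¹ *
                phaseExp ε ρ p k) *
                ((⟪phaseGrad ε p k, b l⟫_ℝ : ℂ) * (⟪phaseGrad ε p k, b l⟫_ℝ : ℂ)) :=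
                Finset.sum_congr rfl fun l _ => by ring
            _ = _ := by
                rw [← Finset.mul_sum, hsum]
                field_simp
        · rw [image_eq_zero_of_notMem_tsupport hk]
          simp
    _ = _ := by
        rw [integral_const_mul, oscIntegral, neg_mul]

/-- Non-stationary phase for amplitudes supported away from the critical points. -/
theorem norm_oscIntegral_le {ε : Momentum d → ℝ} (hε : ContDiff ℝ ∞ ε) (N : ℕ) :
    ∀ {H : (ℝ × Momentum d) × Momentum d → ℂ}, ContDiff ℝ ∞ H → HasCompactSupport H →
    (∀ z ∈ tsupport H, phaseGrad ε z.1 z.2 ≠ 0) →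
    ∃ C, ∀ ρ, 0 ≤ ρ → ∀ p, ‖oscIntegral ε H ρ p‖ * ρ ^ N ≤ C := by
  induction N with
  | zero =>
    intro H hH hc _
    obtain ⟨C, hC⟩ := hc.exists_bound_of_continuous hH.continuous
    have hK : IsCompact (Prod.snd '' tsupport H) := hc.isCompact.image continuous_snd
    refine ⟨C * volume.real (Prod.snd '' tsupport H), fun ρ _ p => ?_⟩
    rw [pow_zero, mul_one, oscIntegral]
    rw [← setIntegral_eq_integral_of_forall_compl_eq_zero (s := Prod.snd '' tsupport H)]
    · refine norm_setIntegral_le_of_norm_le_const hK.measure_lt_top fun k _ => ?_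
      rw [norm_mul, norm_phaseExp, mul_one]
      exact hC _
    · intro k hk
      have : H (p, k) = 0 := by
        by_contra h
        exact hk ⟨(p, k), subset_tsupport _ h, rfl⟩
      rw [this, zero_mul]
  | succ N ih =>
    intro H hH hc hne
    obtain ⟨C, hC⟩ := ih (contDiff_divAmplitude hε hH hne)
      (hc.of_isClosed_subset (isClosed_tsupport _) (tsupport_divAmplitude_subset ε H))
      (fun z hz => hne z (tsupport_divAmplitude_subset ε H hz))
    refine ⟨C, fun ρ hρ p => ?_⟩
    have := hC ρ hρ p
    rw [oscIntegral_divAmplitude hε hH hc hne, norm_mul, norm_neg, norm_mul, Complex.norm_I,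
      one_mul, Complex.norm_real, Real.norm_of_nonneg hρ] at this
    calc _ = ρ * ‖oscIntegral ε H ρ p‖ * ρ ^ N := by ring
      _ ≤ C := this

/-- Non-stationary phase, locally uniformly in the direction of the phase. -/
theorem exists_nhds_norm_oscIntegral_le {ε : Momentum d → ℝ} (hε : ContDiff ℝ ∞ ε)
    {f : Momentum d → ℂ} (hf : ContDiff ℝ ∞ f) (hc : HasCompactSupport f) (N : ℕ)
    {p₀ : ℝ × Momentum d} (hp : ∀ k ∈ tsupport f, phaseGrad ε p₀ k ≠ 0) :
    ∃ U ∈ 𝓝 p₀, ∃ C, ∀ ρ, 0 ≤ ρ → ∀ p ∈ U, ‖oscIntegral ε (fun z => f z.2) ρ p‖ * ρ ^ N ≤ C := by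
  have hs : ∀ᶠ p in 𝓝 p₀, ∀ k ∈ tsupport f, phaseGrad ε p k ≠ 0 := by
    refine hc.isCompact.eventually_forall_of_forall_eventually fun k hk => ?_
    exact (contDiff_phaseGrad hε).continuous.continuousAt.eventually_ne (hp k hk)
  obtain ⟨χ, hχs, hχc, hχ, -, hχ1⟩ := exists_contDiff_tsupport_subset (n := (⊤ : ℕ∞)) hs
  set H : (ℝ × Momentum d) × Momentum d → ℂ := fun z => (χ z.1 : ℂ) * f z.2 with hH
  have hsub : tsupport H ⊆ tsupport χ ×ˢ tsupport f := by
    refine closure_minimal (fun z hz => ⟨subset_tsupport _ fun h => hz ?_,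
      subset_tsupport _ fun h => hz ?_⟩) ((isClosed_tsupport _).prod (isClosed_tsupport _))
    · simp only [hH]; rw [h]; simp
    · simp only [hH]; rw [h]; simp
  have hHs : ContDiff ℝ ∞ H :=
    (Complex.ofRealCLM.contDiff.comp (hχ.comp contDiff_fst)).mul (hf.comp contDiff_snd)
  have hHc : HasCompactSupport H :=
    (hχc.isCompact.prod hc.isCompact).of_isClosed_subset (isClosed_tsupport _) hsub
  obtain ⟨C, hC⟩ := norm_oscIntegral_le hε N hHs hHc
    fun z hz => hχs (hsub hz).1 _ (hsub hz).2
  have hU : ∀ᶠ p in 𝓝 p₀, 1 / 2 < χ p :=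
    hχ.continuous.continuousAt.eventually_const_lt (by rw [hχ1]; norm_num)
  refine ⟨_, hU, 2 * C, fun ρ hρ p hpU => ?_⟩
  have h1 : oscIntegral ε H ρ p = χ p * oscIntegral ε (fun z => f z.2) ρ p := by
    simp only [oscIntegral, hH, mul_assoc]
    rw [integral_const_mul]
  have h2 := hC ρ hρ p
  have hpos : (0 : ℝ) < χ p := lt_trans (by norm_num) hpU
  rw [h1, norm_mul, Complex.norm_real, Real.norm_of_nonneg hpos.le] at h2
  have h3 : 1 / 2 * (‖oscIntegral ε (fun z => f z.2) ρ p‖ * ρ ^ N) ≤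
      χ p * (‖oscIntegral ε (fun z => f z.2) ρ p‖ * ρ ^ N) := by
    gcongr
    exact le_of_lt hpU
  linarith

/-- Non-stationary phase, uniformly on a compact set of directions of the phase. -/
theorem exists_norm_oscIntegral_le_of_isCompact {ε : Momentum d → ℝ} (hε : ContDiff ℝ ∞ ε)
    {f : Momentum d → ℂ} (hf : ContDiff ℝ ∞ f) (hc : HasCompactSupport f) (N : ℕ)
    {P : Set (ℝ × Momentum d)} (hP : IsCompact P)
    (hp : ∀ p ∈ P, ∀ k ∈ tsupport f, phaseGrad ε p k ≠ 0) :
    ∃ C, ∀ ρ, 0 ≤ ρ → ∀ p ∈ P, ‖oscIntegral ε (fun z => f z.2) ρ p‖ * ρ ^ N ≤ C := by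
  refine hP.induction_on (p := fun s => ∃ C, ∀ ρ, 0 ≤ ρ → ∀ p ∈ s,
    ‖oscIntegral ε (fun z => f z.2) ρ p‖ * ρ ^ N ≤ C) ?_ ?_ ?_ ?_
  · exact ⟨0, by simp⟩
  · rintro s t hst ⟨C, hC⟩
    exact ⟨C, fun ρ hρ p hp => hC ρ hρ p (hst hp)⟩
  · rintro s t ⟨C, hC⟩ ⟨D, hD⟩
    refine ⟨max C D, fun ρ hρ p hp => ?_⟩
    rcases hp with hp | hp
    · exact (hC ρ hρ p hp).trans (le_max_left _ _)
    · exact (hD ρ hρ p hp).trans (le_max_right _ _)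
  · intro p hpP
    obtain ⟨U, hU, hC⟩ := exists_nhds_norm_oscIntegral_le hε hf hc N (hp p hpP)
    exact ⟨U, mem_nhdsWithin_of_mem_nhds hU, hC⟩

end NonstationaryPhase

/-! ### Decay of wave packets -/

section Packets

open scoped ContDiff

variable {d : ℕ}

theorem packet_eq_oscIntegral (ε : Momentum d → ℝ) (f : 𝓢(Momentum d, ℂ)) (τ : ℝ)
    (x : Momentum d) {ρ : ℝ} (hρ : ρ ≠ 0) :
    packet ε f τ x = (((2 * Real.pi) ^ d : ℝ) : ℂ)⁻¹ *
      oscIntegral ε (fun z => f z.2) ρ (ρ⁻¹ * τ, ρ⁻¹ • x) := by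
  rw [packet, oscIntegral]
  congr 1
  refine integral_congr_ae (.of_forall fun k => ?_)
  simp only [phaseExp, real_inner_smul_right]
  rw [mul_comm]
  congr 5
  field_simp

/-- The velocities occurring in a wave packet form a bounded set. -/
theorem exists_norm_gradient_le {ε : Momentum d → ℝ} (hε : ContDiff ℝ ∞ ε)
    {f : 𝓢(Momentum d, ℂ)} (hc : HasCompactSupport f) :
    ∃ R, 0 ≤ R ∧ ∀ k ∈ tsupport f, ‖gradient ε k‖ ≤ R := by
  obtain ⟨R, hR⟩ := hc.isCompact.exists_bound_of_continuousOn
    (contDiff_gradient hε).continuous.continuousOn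
  exact ⟨max R 0, le_max_right _ _, fun k hk => (hR k hk).trans (le_max_left _ _)⟩

theorem norm_packet_le (ε : Momentum d → ℝ) (f : 𝓢(Momentum d, ℂ)) (τ : ℝ) (x : Momentum d) :
    ‖packet ε f τ x‖ ≤ ((2 * Real.pi) ^ d)⁻¹ * ∫ k, ‖f k‖ := by
  rw [packet, norm_mul, norm_inv, Complex.norm_real, Real.norm_of_nonneg (by positivity)]
  gcongr
  refine (norm_integral_le_integral_norm _).trans_eq ?_
  refine integral_congr_ae (.of_forall fun k => ?_)
  simp only [norm_mul]
  rw [mul_comm Complex.I, Complex.norm_exp_ofReal_mul_I, one_mul]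

/-- Outside every conical neighbourhood of the set of its velocities a wave packet decays faster
than any power of the space-time distance to the origin. -/
theorem exists_norm_packet_mul_pow_le {ε : Momentum d → ℝ} (hε : ContDiff ℝ ∞ ε)
    {f : 𝓢(Momentum d, ℂ)} (hc : HasCompactSupport f) (N : ℕ) {δ : ℝ} (hδ : 0 < δ) :
    ∃ C, ∀ τ x, (∀ k ∈ tsupport f, δ * (|τ| + ‖x‖) ≤ ‖x - τ • gradient ε k‖) →
      ‖packet ε f τ x‖ * (1 + |τ| + ‖x‖) ^ N ≤ C := by
  set P : Set (ℝ × Momentum d) := {p | |p.1| + ‖p.2‖ = 1 ∧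
    ∀ k ∈ tsupport f, δ ≤ ‖p.2 - p.1 • gradient ε k‖} with hPdef
  have hPc : IsClosed P := by
    have h1 : IsClosed {p : ℝ × Momentum d | |p.1| + ‖p.2‖ = 1} :=
      isClosed_eq (by fun_prop) continuous_const
    have h2 : IsClosed {p : ℝ × Momentum d |
        ∀ k ∈ tsupport f, δ ≤ ‖p.2 - p.1 • gradient ε k‖} := by
      simp only [Set.ofPred_forall]
      exact isClosed_biInter fun k _ => isClosed_le continuous_const (by fun_prop)
    exact h1.inter h2
  have hP : IsCompact P := by
    refine Metric.isCompact_of_isClosed_isBounded hPc ?_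
    refine (Metric.isBounded_closedBall (x := (0 : ℝ × Momentum d)) (r := 1)).subset fun p hp => ?_
    rw [mem_closedBall_zero_iff, Prod.norm_def, Real.norm_eq_abs]
    have := hp.1
    exact max_le (by linarith [norm_nonneg p.2]) (by linarith [abs_nonneg p.1])
  obtain ⟨C, hC⟩ := exists_norm_oscIntegral_le_of_isCompact hε (f.smooth ⊤) hc N hP (by
    intro p hp k hk h0
    have := hp.2 k hk
    rw [← norm_neg, neg_sub] at this
    rw [phaseGrad] at h0
    rw [h0, norm_zero] at this
    linarith)
  set c : ℝ := ((2 * Real.pi) ^ d)⁻¹ with hcdef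
  have hcpos : 0 < c := by positivity
  set I0 : ℝ := ∫ k, ‖f k‖
  have hI0 : 0 ≤ I0 := integral_nonneg fun _ => norm_nonneg _
  refine ⟨max (c * I0 * 2 ^ N) (c * C * 2 ^ N), fun τ x hx => ?_⟩
  rcases le_or_gt (|τ| + ‖x‖) 1 with hle | hgt
  · refine le_trans ?_ (le_max_left _ _)
    gcongr
    · exact norm_packet_le ε f τ x
    · linarith
  · refine le_trans ?_ (le_max_right _ _)
    set ρ := |τ| + ‖x‖ with hρ
    have hρ0 : 0 < ρ := by linarith
    have hmem : (ρ⁻¹ * τ, ρ⁻¹ • x) ∈ P := by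
      constructor
      · simp only [abs_mul, norm_smul, abs_inv, Real.norm_eq_abs, abs_of_pos hρ0]
        rw [← mul_add, ← hρ, inv_mul_cancel₀ hρ0.ne']
      · intro k hk
        have : ρ⁻¹ • x - (ρ⁻¹ * τ) • gradient ε k = ρ⁻¹ • (x - τ • gradient ε k) := by
          rw [smul_sub, smul_smul]
        simp only [this, norm_smul, norm_inv, Real.norm_eq_abs, abs_of_pos hρ0]
        rw [inv_mul_eq_div, le_div_iff₀ hρ0]
        exact hx k hk
    have h1 := hC ρ hρ0.le _ hmem
    rw [packet_eq_oscIntegral ε f τ x hρ0.ne', norm_mul, norm_inv, Complex.norm_real,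
      Real.norm_of_nonneg (by positivity), ← hcdef]
    calc _ ≤ c * ‖oscIntegral ε (fun z => f z.2) ρ (ρ⁻¹ * τ, ρ⁻¹ • x)‖ * (2 * ρ) ^ N := by
          gcongr
          linarith
      _ = c * (‖oscIntegral ε (fun z => f z.2) ρ (ρ⁻¹ * τ, ρ⁻¹ • x)‖ * ρ ^ N) * 2 ^ N := by
          rw [mul_pow]; ring
      _ ≤ _ := by gcongr

/-- A wave packet decays in space faster than any power, with coefficients that grow polynomially
in time. -/
theorem exists_norm_packet_mul_pow_le_pow {ε : Momentum d → ℝ} (hε : ContDiff ℝ ∞ ε)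
    {f : 𝓢(Momentum d, ℂ)} (hc : HasCompactSupport f) (K : ℕ) :
    ∃ C, 0 ≤ C ∧ ∀ τ x, ‖packet ε f τ x‖ * (1 + ‖x‖) ^ K ≤ C * (1 + |τ|) ^ K := by
  obtain ⟨R, hR0, hR⟩ := exists_norm_gradient_le hε hc
  obtain ⟨C, hC⟩ := exists_norm_packet_mul_pow_le hε hc K (δ := 1 / 2) (by norm_num)
  set c : ℝ := ((2 * Real.pi) ^ d)⁻¹ * ∫ k, ‖f k‖
  have hc0 : 0 ≤ c := mul_nonneg (by positivity) (integral_nonneg fun _ => norm_nonneg _)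
  refine ⟨max C (c * (2 * R + 2) ^ K), le_max_of_le_right (by positivity), fun τ x => ?_⟩
  have hτ := abs_nonneg τ
  have hx := norm_nonneg x
  rcases le_or_gt ((2 * R + 1) * |τ|) ‖x‖ with h | h
  · have h1 : ‖packet ε f τ x‖ * (1 + |τ| + ‖x‖) ^ K ≤ C := by
      refine hC τ x fun k hk => ?_
      have h2 : ‖τ • gradient ε k‖ ≤ |τ| * R := by
        rw [norm_smul, Real.norm_eq_abs]
        gcongr
        exact hR k hk
      have h3 := norm_sub_norm_le x (τ • gradient ε k)
      linarith
    have hC0 : 0 ≤ C := le_trans (by positivity) h1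
    calc _ ≤ ‖packet ε f τ x‖ * (1 + |τ| + ‖x‖) ^ K := by gcongr; linarith
      _ ≤ C := h1
      _ ≤ max C (c * (2 * R + 2) ^ K) * 1 := by rw [mul_one]; exact le_max_left _ _
      _ ≤ _ := by
        gcongr
        exact one_le_pow₀ (by linarith)
  · calc _ ≤ c * ((2 * R + 2) * (1 + |τ|)) ^ K := by
          gcongr
          · exact norm_packet_le ε f τ x
          · nlinarith
      _ = c * (2 * R + 2) ^ K * (1 + |τ|) ^ K := by rw [mul_pow]; ring
      _ ≤ _ := by gcongr; exact le_max_right _ _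

theorem one_add_pow_le {a : ℝ} (ha : 0 ≤ a) (n : ℕ) : (1 + a) ^ n ≤ 2 ^ n * (1 + a ^ n) := by
  rcases le_total a 1 with h | h
  · calc (1 + a) ^ n ≤ 2 ^ n := by gcongr; linarith
      _ = 2 ^ n * 1 := by ring
      _ ≤ _ := by gcongr; linarith [pow_nonneg ha n]
  · calc (1 + a) ^ n ≤ (2 * a) ^ n := by gcongr; linarith
      _ = 2 ^ n * a ^ n := mul_pow _ _ _
      _ ≤ _ := by gcongr; linarith

/-- Two wave packets with disjoint sets of velocities separate linearly in time: where both are not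
small, the distance of the positions is at least of the order of the time. -/
theorem exists_norm_packet_mul_norm_packet_le {ε η : Momentum d → ℝ} (hε : ContDiff ℝ ∞ ε)
    (hη : ContDiff ℝ ∞ η) {f g : 𝓢(Momentum d, ℂ)} (hf : HasCompactSupport f)
    (hg : HasCompactSupport g)
    (hfg : Disjoint (gradient ε '' tsupport f) (gradient η '' tsupport g)) (N K : ℕ) :
    ∃ C, 0 ≤ C ∧ ∀ s t x y, |s - t| ≤ 1 →
      ‖packet ε f s x‖ * ‖packet η g t y‖ * ((1 + |s|) ^ N * (1 + ‖x‖) ^ K * (1 + ‖y‖) ^ K) ≤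
        C * (1 + ‖x - y‖ ^ (N + 2 * K)) := by
  obtain ⟨R₁, hR₁0, hR₁⟩ := exists_norm_gradient_le hε hf
  obtain ⟨R₂, hR₂0, hR₂⟩ := exists_norm_gradient_le hη hg
  set R := max R₁ R₂
  have hR0 : 0 ≤ R := le_max_of_le_left hR₁0
  have hRf : ∀ k ∈ tsupport f, ‖gradient ε k‖ ≤ R := fun k hk => (hR₁ k hk).trans (le_max_left _ _)
  have hRg : ∀ k ∈ tsupport g, ‖gradient η k‖ ≤ R := fun k hk => (hR₂ k hk).trans (le_max_right _ _)
  obtain ⟨D, hD0, hD⟩ : ∃ D : ℝ, 0 < D ∧ ∀ k ∈ tsupport f, ∀ l ∈ tsupport g,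
      D ≤ ‖gradient ε k - gradient η l‖ := by
    obtain ⟨r, hr, h⟩ := Metric.exists_pos_forall_lt_edist
      (hf.isCompact.image (contDiff_gradient hε).continuous)
      (hg.isCompact.image (contDiff_gradient hη).continuous).isClosed hfg
    refine ⟨r, hr, fun k hk l hl => ?_⟩
    have := h _ ⟨k, hk, rfl⟩ _ ⟨l, hl, rfl⟩
    rw [edist_nndist, ENNReal.coe_lt_coe] at this
    rw [← dist_eq_norm, ← coe_nndist]
    exact_mod_cast this.le
  set δ : ℝ := min (1 / 2) (D / (4 * (2 * R + 2))) with hδ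
  have hδ0 : 0 < δ := by positivity
  have hδ1 : δ ≤ 1 / 2 := min_le_left _ _
  have hδ2 : δ * (2 * R + 2) ≤ D / 4 := by
    have : δ ≤ D / (4 * (2 * R + 2)) := min_le_right _ _
    calc δ * (2 * R + 2) ≤ D / (4 * (2 * R + 2)) * (2 * R + 2) := by gcongr
      _ = D / 4 := by field_simp
  obtain ⟨A₁, hA₁⟩ := exists_norm_packet_mul_pow_le hε hf (N + 2 * K) hδ0
  obtain ⟨A₂, hA₂⟩ := exists_norm_packet_mul_pow_le hη hg (N + 2 * K) hδ0
  obtain ⟨B₁, hB₁0, hB₁⟩ := exists_norm_packet_mul_pow_le_pow hε hf K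
  obtain ⟨B₂, hB₂0, hB₂⟩ := exists_norm_packet_mul_pow_le_pow hη hg K
  set E : ℝ := 1 + 2 / D * (1 + R + D / 4) with hE
  have hE0 : 0 < E := by positivity
  set L := N + 2 * K with hL
  refine ⟨max (max (A₁ * (B₂ * 2 ^ K)) (2 ^ L * A₂ * B₁)) (B₁ * (B₂ * 2 ^ K) * (E ^ L * 2 ^ L)),
    le_max_of_le_right (by positivity), fun s t x y hst => ?_⟩
  have hs := abs_nonneg s
  have ht := abs_nonneg t
  have hx := norm_nonneg x
  have hy := norm_nonneg y
  have hpf := norm_nonneg (packet ε f s x)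
  have hpg := norm_nonneg (packet η g t y)
  have hts : |t| ≤ |s| + 1 := by
    have := abs_sub_abs_le_abs_sub t s
    rw [abs_sub_comm] at this
    linarith
  have hst' : |s| ≤ |t| + 1 := by
    have := abs_sub_abs_le_abs_sub s t
    linarith
  have hone : (1 : ℝ) ≤ 1 + ‖x - y‖ ^ L := by linarith [pow_nonneg (norm_nonneg (x - y)) L]
  have hf' := hB₁ s x
  have hg' : ‖packet η g t y‖ * (1 + ‖y‖) ^ K ≤ B₂ * 2 ^ K * (1 + |s|) ^ K := by
    calc _ ≤ B₂ * (1 + |t|) ^ K := hB₂ t y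
      _ ≤ B₂ * (2 * (1 + |s|)) ^ K := by gcongr; linarith
      _ = _ := by rw [mul_pow]; ring
  by_cases h1 : ∀ k ∈ tsupport f, δ * (|s| + ‖x‖) ≤ ‖x - s • gradient ε k‖
  · have hA := hA₁ s x h1
    have hA0 : 0 ≤ A₁ := le_trans (by positivity) hA
    have key : (1 + |s|) ^ N * (1 + ‖x‖) ^ K * (1 + |s|) ^ K ≤ (1 + |s| + ‖x‖) ^ L := by
      have e : (1 + |s| + ‖x‖) ^ L =
          (1 + |s| + ‖x‖) ^ N * (1 + |s| + ‖x‖) ^ K * (1 + |s| + ‖x‖) ^ K := by rw [hL]; ring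
      have i1 : 1 + |s| ≤ 1 + |s| + ‖x‖ := by linarith
      have i2 : 1 + ‖x‖ ≤ 1 + |s| + ‖x‖ := by linarith
      rw [e]
      exact mul_le_mul (mul_le_mul (pow_le_pow_left₀ (by positivity) i1 N)
        (pow_le_pow_left₀ (by positivity) i2 K) (by positivity) (by positivity))
        (pow_le_pow_left₀ (by positivity) i1 K) (by positivity) (by positivity)
    calc _ = ‖packet ε f s x‖ * ((1 + |s|) ^ N * (1 + ‖x‖) ^ K) *
          (‖packet η g t y‖ * (1 + ‖y‖) ^ K) := by ring
      _ ≤ ‖packet ε f s x‖ * ((1 + |s|) ^ N * (1 + ‖x‖) ^ K) *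
          (B₂ * 2 ^ K * (1 + |s|) ^ K) := by gcongr
      _ = ‖packet ε f s x‖ * ((1 + |s|) ^ N * (1 + ‖x‖) ^ K * (1 + |s|) ^ K) * (B₂ * 2 ^ K) := by
          ring
      _ ≤ ‖packet ε f s x‖ * (1 + |s| + ‖x‖) ^ L * (B₂ * 2 ^ K) := by gcongr
      _ ≤ A₁ * (B₂ * 2 ^ K) * 1 := by rw [mul_one]; gcongr
      _ ≤ _ := mul_le_mul (le_max_of_le_left (le_max_left _ _)) hone zero_le_one
          (le_max_of_le_right (by positivity))
  by_cases h2 : ∀ k ∈ tsupport g, δ * (|t| + ‖y‖) ≤ ‖y - t • gradient η k‖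
  · have hA := hA₂ t y h2
    have hA0 : 0 ≤ A₂ := le_trans (by positivity) hA
    have key : (1 + |s|) ^ N * (1 + ‖y‖) ^ K * (1 + |s|) ^ K ≤
        2 ^ L * (1 + |t| + ‖y‖) ^ L := by
      have e : 2 ^ L * (1 + |t| + ‖y‖) ^ L = (2 * (1 + |t| + ‖y‖)) ^ N *
          (2 * (1 + |t| + ‖y‖)) ^ K * (2 * (1 + |t| + ‖y‖)) ^ K := by rw [← mul_pow, hL]; ring
      have i1 : 1 + |s| ≤ 2 * (1 + |t| + ‖y‖) := by linarith
      have i2 : 1 + ‖y‖ ≤ 2 * (1 + |t| + ‖y‖) := by linarith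
      rw [e]
      exact mul_le_mul (mul_le_mul (pow_le_pow_left₀ (by positivity) i1 N)
        (pow_le_pow_left₀ (by positivity) i2 K) (by positivity) (by positivity))
        (pow_le_pow_left₀ (by positivity) i1 K) (by positivity) (by positivity)
    calc _ = ‖packet η g t y‖ * ((1 + |s|) ^ N * (1 + ‖y‖) ^ K) *
          (‖packet ε f s x‖ * (1 + ‖x‖) ^ K) := by ring
      _ ≤ ‖packet η g t y‖ * ((1 + |s|) ^ N * (1 + ‖y‖) ^ K) * (B₁ * (1 + |s|) ^ K) := by gcongr
      _ = ‖packet η g t y‖ * ((1 + |s|) ^ N * (1 + ‖y‖) ^ K * (1 + |s|) ^ K) * B₁ := by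
          ring
      _ ≤ ‖packet η g t y‖ * (2 ^ L * (1 + |t| + ‖y‖) ^ L) * B₁ := by gcongr
      _ = 2 ^ L * (‖packet η g t y‖ * (1 + |t| + ‖y‖) ^ L) * B₁ := by ring
      _ ≤ 2 ^ L * A₂ * B₁ * 1 := by rw [mul_one]; gcongr
      _ ≤ _ := mul_le_mul (le_max_of_le_left (le_max_right _ _)) hone zero_le_one
          (le_max_of_le_right (by positivity))
  push Not at h1 h2
  obtain ⟨k, hk, h1⟩ := h1
  obtain ⟨l, hl, h2⟩ := h2
  -- Both positions lie close to the classical trajectories, so `‖x - y‖` is of the order of `|s|`.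
  have hsk : ‖s • gradient ε k‖ ≤ |s| * R := by
    rw [norm_smul, Real.norm_eq_abs]
    gcongr
    exact hRf k hk
  have htl : ‖t • gradient η l‖ ≤ |t| * R := by
    rw [norm_smul, Real.norm_eq_abs]
    gcongr
    exact hRg l hl
  have hx1 : ‖x‖ ≤ (2 * R + 1) * |s| := by
    have := norm_sub_norm_le x (s • gradient ε k)
    nlinarith
  have hy1 : ‖y‖ ≤ (2 * R + 1) * |t| := by
    have := norm_sub_norm_le y (t • gradient η l)
    nlinarith
  have hsep : |s| * D ≤ ‖x - y‖ + R + δ * (|s| + ‖x‖) + δ * (|t| + ‖y‖) := by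
    have e : s • (gradient ε k - gradient η l) = (x - y) - (x - s • gradient ε k)
        + (y - t • gradient η l) - (s - t) • gradient η l := by
      rw [smul_sub, sub_smul]; abel
    calc |s| * D ≤ ‖s • (gradient ε k - gradient η l)‖ := by
          rw [norm_smul, Real.norm_eq_abs]
          gcongr
          exact hD k hk l hl
      _ ≤ ‖x - y‖ + ‖x - s • gradient ε k‖ + ‖y - t • gradient η l‖
          + ‖(s - t) • gradient η l‖ := by
          rw [e]
          exact (norm_sub_le _ _).trans (add_le_add_left ((norm_add_le _ _).trans
            (add_le_add_left (norm_sub_le _ _) _)) _)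
      _ ≤ _ := by
          have : ‖(s - t) • gradient η l‖ ≤ R := by
            rw [norm_smul, Real.norm_eq_abs]
            calc _ ≤ 1 * R := by
                  gcongr
                  exact hRg l hl
              _ = R := one_mul R
          linarith
  have hsE : 1 + |s| ≤ E * (1 + ‖x - y‖) := by
    have h3 : δ * (|s| + ‖x‖) + δ * (|t| + ‖y‖) ≤ D / 4 * (2 * |s| + 1) := by
      calc _ ≤ δ * (|s| + (2 * R + 1) * |s|) + δ * (|t| + (2 * R + 1) * |t|) := by gcongr
        _ = δ * (2 * R + 2) * (|s| + |t|) := by ring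
        _ ≤ D / 4 * (2 * |s| + 1) :=
          mul_le_mul hδ2 (by linarith) (by positivity) (by positivity)
    have h4 : |s| * D / 2 ≤ ‖x - y‖ + R + D / 4 := by linarith
    have h5 : |s| ≤ 2 / D * (‖x - y‖ + R + D / 4) := by
      rw [div_mul_eq_mul_div, le_div_iff₀ hD0]
      linarith
    have h6 : 0 ≤ 2 / D * (R + D / 4) * ‖x - y‖ := by positivity
    have h7 := norm_nonneg (x - y)
    have h8 : 0 ≤ 2 / D := by positivity
    rw [hE]
    linarith
  calc _ = (‖packet ε f s x‖ * (1 + ‖x‖) ^ K) * (‖packet η g t y‖ * (1 + ‖y‖) ^ K) *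
        (1 + |s|) ^ N := by ring
    _ ≤ (B₁ * (1 + |s|) ^ K) * (B₂ * 2 ^ K * (1 + |s|) ^ K) * (1 + |s|) ^ N := by gcongr
    _ = B₁ * (B₂ * 2 ^ K) * (1 + |s|) ^ L := by rw [hL]; ring
    _ ≤ B₁ * (B₂ * 2 ^ K) * (E * (1 + ‖x - y‖)) ^ L := by gcongr
    _ ≤ B₁ * (B₂ * 2 ^ K) * (E ^ L * (2 ^ L * (1 + ‖x - y‖ ^ L))) := by
        rw [mul_pow]
        gcongr
        exact one_add_pow_le (norm_nonneg _) L
    _ = B₁ * (B₂ * 2 ^ K) * (E ^ L * 2 ^ L) * (1 + ‖x - y‖ ^ L) := by ring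
    _ ≤ _ := by gcongr; exact le_max_right _ _

end Packets

/-! ### Wave packets as Fourier transforms -/

section PacketFourier

open scoped FourierTransform ContDiff

variable {d : ℕ}

/-- The product of two Schwartz functions. -/
noncomputable def schwartzMul (f g : 𝓢(Momentum d, ℂ)) : 𝓢(Momentum d, ℂ) :=
  SchwartzMap.smulLeftCLM ℂ f g

theorem schwartzMul_apply (f g : 𝓢(Momentum d, ℂ)) (p : Momentum d) :
    schwartzMul f g p = f p * g p := by
  rw [schwartzMul, SchwartzMap.smulLeftCLM_apply_apply f.hasTemperateGrowth, smul_eq_mul]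

theorem iteratedDeriv_cexp_I_mul (n : ℕ) :
    iteratedDeriv n (fun t : ℝ => Complex.exp (Complex.I * t)) =
      fun t : ℝ => Complex.I ^ n * Complex.exp (Complex.I * t) := by
  induction n with
  | zero => simp
  | succ n ih =>
    rw [iteratedDeriv_succ, ih]
    funext t
    have h : HasDerivAt (fun t : ℝ => Complex.I ^ n * Complex.exp (Complex.I * t))
        (Complex.I ^ n * (Complex.exp (Complex.I * t) * (Complex.I * 1))) t :=
      (((Complex.ofRealCLM.hasDerivAt (x := t)).const_mul Complex.I).cexp).const_mul _
    rw [h.deriv]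
    ring

theorem hasTemperateGrowth_planeWave (x : Momentum d) :
    (fun k : Momentum d => Complex.exp (Complex.I * (⟪k, x⟫_ℝ : ℂ))).HasTemperateGrowth := by
  have h1 : (fun t : ℝ => Complex.exp (Complex.I * t)).HasTemperateGrowth := by
    refine ⟨?_, fun n => ⟨0, 1, fun t => ?_⟩⟩
    · exact Complex.contDiff_exp.comp (contDiff_const.mul Complex.ofRealCLM.contDiff)
    · rw [norm_iteratedFDeriv_eq_norm_iteratedDeriv, iteratedDeriv_cexp_I_mul, norm_mul, norm_pow,
        Complex.norm_I, mul_comm Complex.I, Complex.norm_exp_ofReal_mul_I]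
      simp
  have h2 : (fun k : Momentum d => ⟪k, x⟫_ℝ).HasTemperateGrowth := by
    have := (innerSL ℝ x).hasTemperateGrowth
    convert this using 2 with k
    exact real_inner_comm _ _
  exact h1.comp h2

/-- The product of a plane wave `e^{i⟨k, x⟩}` with a Schwartz function. -/
noncomputable def planeWaveMul (x : Momentum d) (f : 𝓢(Momentum d, ℂ)) : 𝓢(Momentum d, ℂ) :=
  SchwartzMap.smulLeftCLM ℂ (fun k : Momentum d => Complex.exp (Complex.I * (⟪k, x⟫_ℝ : ℂ))) f

theorem planeWaveMul_apply (x : Momentum d) (f : 𝓢(Momentum d, ℂ)) (k : Momentum d) :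
    planeWaveMul x f k = Complex.exp (Complex.I * (⟪k, x⟫_ℝ : ℂ)) * f k := by
  rw [planeWaveMul, SchwartzMap.smulLeftCLM_apply_apply (hasTemperateGrowth_planeWave x),
    smul_eq_mul]

theorem packet_zero_eq_fourier (ε : Momentum d → ℝ) (F : 𝓢(Momentum d, ℂ)) (x : Momentum d) :
    packet ε F 0 x = (((2 * Real.pi) ^ d : ℝ) : ℂ)⁻¹ * 𝓕 F ((2 * Real.pi)⁻¹ • x) := by
  rw [packet, SchwartzMap.fourier_coe, Real.fourier_eq']
  congr 1
  refine integral_congr_ae (.of_forall fun k => ?_)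
  simp only [real_inner_smul_right, smul_eq_mul]
  congr 2
  have : (Real.pi : ℂ) ≠ 0 := by exact_mod_cast Real.pi_ne_zero
  push_cast
  field_simp
  ring

theorem continuous_packet_zero (ε : Momentum d → ℝ) (F : 𝓢(Momentum d, ℂ)) :
    Continuous (packet ε F 0) := by
  have : packet ε F 0 = fun x =>
      (((2 * Real.pi) ^ d : ℝ) : ℂ)⁻¹ * 𝓕 F ((2 * Real.pi)⁻¹ • x) :=
    funext (packet_zero_eq_fourier ε F)
  rw [this]
  exact continuous_const.mul ((𝓕 F).continuous.comp (continuous_const_smul _))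

theorem integrable_packet_zero (ε : Momentum d → ℝ) (F : 𝓢(Momentum d, ℂ)) :
    Integrable (packet ε F 0) := by
  have : packet ε F 0 = fun x =>
      (((2 * Real.pi) ^ d : ℝ) : ℂ)⁻¹ * 𝓕 F ((2 * Real.pi)⁻¹ • x) :=
    funext (packet_zero_eq_fourier ε F)
  rw [this]
  exact ((𝓕 F).integrable.comp_smul (inv_ne_zero (by positivity))).const_mul _

/-- Fourier inversion for wave packets. -/
theorem integral_packet_zero_mul_planeWave (ε : Momentum d → ℝ) (F : 𝓢(Momentum d, ℂ))
    (k : Momentum d) :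
    ∫ x, packet ε F 0 x * Complex.exp (Complex.I * (⟪k, x⟫_ℝ : ℂ)) = F k := by
  have hinv : 𝓕⁻ (𝓕 F) k = F k := by rw [FourierTransform.fourierInv_fourier_eq]
  rw [SchwartzMap.fourierInv_coe, Real.fourierInv_eq'] at hinv
  rw [← hinv]
  have h := Measure.integral_comp_inv_smul (volume : Measure (Momentum d))
    (fun v => (((2 * Real.pi) ^ d : ℝ) : ℂ)⁻¹ *
      (Complex.exp ((↑(2 * Real.pi * ⟪v, k⟫_ℝ) * Complex.I)) • 𝓕 F v)) (2 * Real.pi)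
  rw [integral_const_mul, integral_const_mul, finrank_euclideanSpace_fin,
    abs_of_pos (by positivity),
    Complex.real_smul, ← mul_assoc, mul_inv_cancel₀ (by norm_cast; positivity), one_mul] at h
  rw [← h, ← integral_const_mul]
  refine integral_congr_ae (.of_forall fun x => ?_)
  simp only [packet_zero_eq_fourier, real_inner_smul_left, smul_eq_mul, real_inner_comm k x]
  rw [mul_assoc]
  congr 1
  rw [mul_comm]
  congr 2
  have : (Real.pi : ℂ) ≠ 0 := by exact_mod_cast Real.pi_ne_zero
  push_cast
  field_simp

/-- Smearing with a wave packet in position space is, after Fourier transformation, multiplication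
by its momentum space wave function. -/
theorem integral_packet_zero_mul_integral (ε : Momentum d → ℝ) (F : 𝓢(Momentum d, ℂ))
    {G : Momentum d → ℂ} (hG : Integrable G) :
    ∫ x, packet ε F 0 x * ∫ k, Complex.exp (Complex.I * (⟪k, x⟫_ℝ : ℂ)) * G k =
      ∫ k, F k * G k := by
  have hint : Integrable (Function.uncurry fun x k : Momentum d =>
      packet ε F 0 x * (Complex.exp (Complex.I * (⟪k, x⟫_ℝ : ℂ)) * G k))
      ((volume : Measure (Momentum d)).prod volume) := by
    refine ((integrable_packet_zero ε F).mul_prod hG).mono ?_ (.of_forall fun z => ?_)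
    · refine (continuous_packet_zero ε F).comp_aestronglyMeasurable
        measurable_fst.aestronglyMeasurable |>.mul (AEStronglyMeasurable.mul ?_ ?_)
      · exact Continuous.aestronglyMeasurable (by fun_prop)
      · exact hG.1.comp_snd
    · simp only [Function.uncurry, norm_mul]
      rw [mul_comm Complex.I, Complex.norm_exp_ofReal_mul_I, one_mul]
  simp_rw [← integral_const_mul]
  rw [integral_integral_swap hint]
  refine integral_congr_ae (.of_forall fun k => ?_)
  simp only [← mul_assoc]
  rw [integral_mul_const, integral_packet_zero_mul_planeWave]

theorem contDiff_schwartz_phase {ε : Momentum d → ℝ} (hε : ContDiff ℝ ∞ ε)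
    (f : 𝓢(Momentum d, ℂ)) (τ : ℝ) :
    ContDiff ℝ ∞ fun k => Complex.exp (Complex.I * ((τ * ε k : ℝ) : ℂ)) * f k := by
  refine ContDiff.mul (Complex.contDiff_exp.comp (contDiff_const.mul
    (Complex.ofRealCLM.contDiff.comp (contDiff_const.mul hε)))) (f.smooth ⊤)

/-- The momentum space wave function `e^{iτε} f` of a compactly supported wave packet at time
`τ`. -/
noncomputable def evolved {ε : Momentum d → ℝ} (hε : ContDiff ℝ ∞ ε) {f : 𝓢(Momentum d, ℂ)}
    (hf : HasCompactSupport f) (τ : ℝ) : 𝓢(Momentum d, ℂ) :=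
  HasCompactSupport.toSchwartzMap
    (f := fun k => Complex.exp (Complex.I * ((τ * ε k : ℝ) : ℂ)) * f k)
    hf.mul_left (contDiff_schwartz_phase hε f τ)

theorem packet_eq_packet_evolved {ε : Momentum d → ℝ} (hε : ContDiff ℝ ∞ ε)
    {f : 𝓢(Momentum d, ℂ)} (hf : HasCompactSupport f) (τ : ℝ) :
    packet ε f τ = packet ε (evolved hε hf τ) 0 := by
  funext x
  rw [packet, packet]
  congr 1
  refine integral_congr_ae (.of_forall fun k => ?_)
  change _ = _ * (Complex.exp (Complex.I * ((τ * ε k : ℝ) : ℂ)) * f k)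
  simp only
  rw [← mul_assoc, ← Complex.exp_add]
  congr 2
  push_cast
  ring

theorem continuous_packet {ε : Momentum d → ℝ} (hε : ContDiff ℝ ∞ ε)
    {f : 𝓢(Momentum d, ℂ)} (hf : HasCompactSupport f) (τ : ℝ) : Continuous (packet ε f τ) := by
  rw [packet_eq_packet_evolved hε hf]
  exact continuous_packet_zero _ _

theorem integrable_packet {ε : Momentum d → ℝ} (hε : ContDiff ℝ ∞ ε)
    {f : 𝓢(Momentum d, ℂ)} (hf : HasCompactSupport f) (τ : ℝ) : Integrable (packet ε f τ) := by
  rw [packet_eq_packet_evolved hε hf]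
  exact integrable_packet_zero _ _

end PacketFourier

/-! ### The GNS representation as a bounded homomorphism -/

theorem inner_gnsVec {A : Type*} [NormedRing A] [StarRing A] [NormedAlgebra ℂ A] [StarModule ℂ A]
    (ω : State A) (a b : A) : ⟪gnsVec ω a, gnsVec ω b⟫_ℂ = ω.toCLM (star a * b) := by
  rw [gnsVec, gnsVec, UniformSpace.Completion.inner_coe, inner_toPre]

theorem Translations.zero_apply {d : ℕ} {A : Type*} [NormedRing A] [StarRing A] [NormedAlgebra ℂ A]
    (α : Translations d A) (a : A) : α.toFun 0 0 a = a := by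
  have h := α.map_add 0 0 0 0 a
  rw [add_zero, add_zero] at h
  exact ((α.toFun 0 0).injective h).symm

section GNSRep

variable {A : Type*} [NormedRing A] [StarRing A] [NormedAlgebra ℂ A] [StarModule ℂ A]
  (ω : State A)

theorem denseRange_gnsVec : DenseRange (gnsVec ω) := by
  have h : Set.range (gnsVec ω) = Set.range ((↑) : PreGNS ω → GNS ω) :=
    (toPre ω).surjective.range_comp ((↑) : PreGNS ω → GNS ω)
  rw [DenseRange, h]
  exact UniformSpace.Completion.denseRange_coe

theorem gnsRep_ext {S T : GNS ω →L[ℂ] GNS ω} (h : ∀ a, S (gnsVec ω a) = T (gnsVec ω a)) :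
    S = T :=
  ContinuousLinearMap.ext fun v =>
    congrFun ((denseRange_gnsVec ω).equalizer S.continuous T.continuous (funext h)) v

variable [NormedStarGroup A]

/-- The map `a ↦ â θ` as a bounded linear map. -/
noncomputable def gnsVecL : A →L[ℂ] GNS ω :=
  UniformSpace.Completion.toComplL.comp
    ((toPre ω).toLinearMap.mkContinuous (√‖ω.toCLM‖) (norm_toPre_le ω))

theorem gnsVecL_apply (a : A) : gnsVecL ω a = gnsVec ω a := rfl

theorem norm_gnsRep_le (a : A) : ‖gnsRep ω a‖ ≤ ‖a‖ := by
  refine ContinuousLinearMap.opNorm_le_bound _ (norm_nonneg _) fun v => ?_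
  refine (denseRange_gnsVec ω).induction_on
    (p := fun v => ‖gnsRep ω a v‖ ≤ ‖a‖ * ‖v‖) v ?_ fun b => ?_
  · exact isClosed_le (by fun_prop) (by fun_prop)
  · rw [gnsRep_gnsVec]
    simp only [gnsVec, UniformSpace.Completion.norm_coe]
    exact norm_toPre_mul_le ω a b

theorem gnsRep_mul (a b : A) : gnsRep ω (a * b) = gnsRep ω a * gnsRep ω b :=
  gnsRep_ext ω fun c => by
    rw [mul_apply_eq_comp, gnsRep_gnsVec, gnsRep_gnsVec, gnsRep_gnsVec, mul_assoc]

/-- The GNS representation as a bounded linear map. -/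
noncomputable def gnsRepL : A →L[ℂ] (GNS ω →L[ℂ] GNS ω) :=
  LinearMap.mkContinuous
    { toFun := gnsRep ω
      map_add' := fun a b => gnsRep_ext ω fun c => by
        rw [add_apply, gnsRep_gnsVec, gnsRep_gnsVec, gnsRep_gnsVec, add_mul,
          ← gnsVecL_apply, ← gnsVecL_apply, ← gnsVecL_apply, map_add]
      map_smul' := fun r a => gnsRep_ext ω fun c => by
        rw [RingHom.id_apply, smul_apply, gnsRep_gnsVec, gnsRep_gnsVec,
          smul_mul_assoc, ← gnsVecL_apply, ← gnsVecL_apply, map_smul] } 1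
    fun a => by simpa using norm_gnsRep_le ω a

theorem gnsRepL_apply (a : A) : gnsRepL ω a = gnsRep ω a := rfl

end GNSRep

section Translate

variable {d : ℕ} {A : Type*} [NormedRing A] [StarRing A] [NormedStarGroup A] [NormedAlgebra ℂ A]
  [StarModule ℂ A] {α : Translations d A}

/-- The translations of the GNS space are isometric and conjugate `â` into the operator of the
translated element, so they do not increase its norm. -/
theorem norm_gnsRep_translate_le (ω : StationaryState α) (x : Momentum d) (s : ℝ) (a : A) :
    ‖gnsRep ω.toState (α.toFun x s a)‖ ≤ ‖gnsRep ω.toState a‖ := by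
  refine ContinuousLinearMap.opNorm_le_bound _ (norm_nonneg _) fun v => ?_
  refine (denseRange_gnsVec ω.toState).induction_on
    (p := fun v => ‖gnsRep ω.toState (α.toFun x s a) v‖ ≤ ‖gnsRep ω.toState a‖ * ‖v‖) v ?_
    fun b => ?_
  · exact isClosed_le (by fun_prop) (by fun_prop)
  · have hb : α.toFun x s (α.toFun (-x) (-s) b) = b := by
      rw [← α.map_add, add_neg_cancel, add_neg_cancel, α.zero_apply]
    have hn : ∀ c, ‖gnsVec ω.toState (α.toFun x s c)‖ = ‖gnsVec ω.toState c‖ := fun c => by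
      simp only [gnsVec, UniformSpace.Completion.norm_coe]
      exact ω.norm_toPre_translate x s c
    have h1 : gnsRep ω.toState (α.toFun x s a) (gnsVec ω.toState b) =
        gnsVec ω.toState (α.toFun x s (a * α.toFun (-x) (-s) b)) := by
      rw [gnsRep_gnsVec, map_mul, hb]
    have h2 : ‖gnsVec ω.toState (α.toFun (-x) (-s) b)‖ = ‖gnsVec ω.toState b‖ := by
      rw [← hn, hb]
    rw [h1, hn, ← gnsRep_gnsVec, ← h2]
    exact (gnsRep ω.toState a).le_opNorm _

end Translate

/-! ### Smeared operators -/

section Weight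

variable {d : ℕ}

/-- An integrable weight on position space. -/
noncomputable def weight (x : Momentum d) : ℝ := ((1 + ‖x‖) ^ (d + 1))⁻¹

theorem weight_nonneg (x : Momentum d) : 0 ≤ weight x := by
  unfold weight
  positivity

theorem integrable_weight : Integrable (weight : Momentum d → ℝ) := by
  have h := integrable_one_add_norm (E := Momentum d) (μ := volume) (r := ((d + 1 : ℕ) : ℝ))
    (by rw [finrank_euclideanSpace_fin]; exact_mod_cast Nat.lt_succ_self d)
  refine h.congr (.of_forall fun x => ?_)
  simp only [weight]
  rw [Real.rpow_neg (by positivity), Real.rpow_natCast]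

/-- The packet spreads over a region whose diameter grows linearly in time; hence the power of the
time. -/
theorem exists_norm_packet_le_weight {ε : Momentum d → ℝ}
    (hε : ContDiff ℝ ((⊤ : ℕ∞) : WithTop ℕ∞) ε) {f : 𝓢(Momentum d, ℂ)}
    (hf : HasCompactSupport f) :
    ∃ C, 0 ≤ C ∧ ∀ τ x, ‖packet ε f τ x‖ ≤ C * (1 + |τ|) ^ (d + 1) * weight x := by
  obtain ⟨C, hC0, hC⟩ := exists_norm_packet_mul_pow_le_pow hε hf (d + 1)
  refine ⟨C, hC0, fun τ x => ?_⟩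
  rw [weight, ← div_eq_mul_inv, le_div_iff₀ (by positivity)]
  exact hC τ x

/-- The joint decay of two wave packets with disjoint sets of velocities, in the form in which it is
used: multiplied by a rapidly decreasing function of the distance, they are bounded by integrable
weights and by any negative power of the time. -/
theorem exists_norm_packet_mul_norm_packet_le_weight {ε η : Momentum d → ℝ}
    (hε : ContDiff ℝ ((⊤ : ℕ∞) : WithTop ℕ∞) ε) (hη : ContDiff ℝ ((⊤ : ℕ∞) : WithTop ℕ∞) η)
    {f g : 𝓢(Momentum d, ℂ)} (hf : HasCompactSupport f) (hg : HasCompactSupport g)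
    (hfg : Disjoint (gradient ε '' tsupport f) (gradient η '' tsupport g)) (N : ℕ) :
    ∃ C L, 0 ≤ C ∧ ∀ s t x y, |s - t| ≤ 1 →
      ‖packet ε f s x‖ * ‖packet η g t y‖ * (1 + ‖x - y‖ ^ L)⁻¹ * (1 + |s|) ^ N ≤
        C * (weight x * weight y) := by
  obtain ⟨C, hC0, hC⟩ := exists_norm_packet_mul_norm_packet_le hε hη hf hg hfg N (d + 1)
  refine ⟨C, N + 2 * (d + 1), hC0, fun s t x y hst => ?_⟩
  have h := hC s t x y hst
  have hpos : 0 < 1 + ‖x - y‖ ^ (N + 2 * (d + 1)) := by positivity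
  calc _ = ‖packet ε f s x‖ * ‖packet η g t y‖ *
        ((1 + |s|) ^ N * (1 + ‖x‖) ^ (d + 1) * (1 + ‖y‖) ^ (d + 1)) *
        ((1 + ‖x - y‖ ^ (N + 2 * (d + 1)))⁻¹ * (weight x * weight y)) := by
        rw [weight, weight]
        field_simp
    _ ≤ C * (1 + ‖x - y‖ ^ (N + 2 * (d + 1))) *
        ((1 + ‖x - y‖ ^ (N + 2 * (d + 1)))⁻¹ * (weight x * weight y)) := by
        have := weight_nonneg x
        have := weight_nonneg y
        gcongr
    _ = _ := by field_simp

end Weight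

/-- A bilinear expression in two integrals is the double integral of the expression of the
integrands, and is bounded accordingly. -/
theorem norm_bilin_integral_le {X E F : Type*} [MeasurableSpace X] {μ : Measure X}
    [NormedAddCommGroup E] [NormedSpace ℂ E] [CompleteSpace E]
    [NormedAddCommGroup F] [NormedSpace ℂ F] [CompleteSpace F]
    (T : E →L[ℂ] E →L[ℂ] F) {a b : X → E} (ha : Integrable a μ) (hb : Integrable b μ)
    {w : X → ℝ} (hw : Integrable w μ) {D : ℝ}
    (h : ∀ x y, ‖T (a x) (b y)‖ ≤ D * (w x * w y)) :
    ‖T (∫ x, a x ∂μ) (∫ y, b y ∂μ)‖ ≤ D * (∫ x, w x ∂μ) ^ 2 := by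
  have h1 : T (∫ x, a x ∂μ) (∫ y, b y ∂μ) = ∫ x, ∫ y, T (a x) (b y) ∂μ ∂μ := by
    rw [← T.integral_comp_comm ha,
      ContinuousLinearMap.integral_apply (T.integrable_comp ha) (∫ y, b y ∂μ)]
    refine integral_congr_ae (.of_forall fun x => ?_)
    exact ((T (a x)).integral_comp_comm hb).symm
  rw [h1]
  have h2 : ∀ x, ‖∫ y, T (a x) (b y) ∂μ‖ ≤ D * (∫ y, w y ∂μ) * w x := fun x => by
    refine (norm_integral_le_of_norm_le ((hw.const_mul (w x)).const_mul D)
      (.of_forall fun y => h x y)).trans_eq ?_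
    rw [integral_const_mul, integral_const_mul]
    ring
  refine (norm_integral_le_of_norm_le (hw.const_mul _) (.of_forall h2)).trans_eq ?_
  rw [integral_const_mul]
  ring

section Smeared

variable {d : ℕ} {A : Type*} [NormedRing A] [StarRing A] [NormedAlgebra ℂ A] {α : Translations d A}

theorem continuous_translate_space {b : A}
    (hb : Continuous fun p : Momentum d × ℝ => α.toFun p.1 p.2 b) (τ : ℝ) :
    Continuous fun x => α.toFun x τ b :=
  hb.comp (continuous_id.prodMk continuous_const)

theorem integrable_packet_smul {ε : Momentum d → ℝ}
    (hε : ContDiff ℝ ((⊤ : ℕ∞) : WithTop ℕ∞) ε) {f : 𝓢(Momentum d, ℂ)}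
    (hf : HasCompactSupport f) {b : A}
    (hb : Continuous fun p : Momentum d × ℝ => α.toFun p.1 p.2 b) (τ : ℝ) :
    Integrable fun x => packet ε f τ x • α.toFun x τ b := by
  refine ((integrable_packet hε hf τ).norm.mul_const ‖b‖).mono' ?_ (.of_forall fun x => ?_)
  · exact ((continuous_packet hε hf τ).smul (continuous_translate_space hb τ)).aestronglyMeasurable
  · rw [norm_smul, α.norm_map]

theorem exists_norm_smeared_le {ε : Momentum d → ℝ}
    (hε : ContDiff ℝ ((⊤ : ℕ∞) : WithTop ℕ∞) ε) {f : 𝓢(Momentum d, ℂ)}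
    (hf : HasCompactSupport f) (b : A) :
    ∃ C, 1 ≤ C ∧ ∀ τ, ‖smeared α ε b f τ‖ ≤ C * (1 + |τ|) ^ (d + 1) := by
  obtain ⟨C, hC0, hC⟩ := exists_norm_packet_le_weight hε hf
  refine ⟨max 1 (C * ‖b‖ * ∫ x : Momentum d, weight x), le_max_left _ _, fun τ => ?_⟩
  have h : ‖smeared α ε b f τ‖ ≤ ∫ x : Momentum d, C * (1 + |τ|) ^ (d + 1) * ‖b‖ * weight x := by
    refine norm_integral_le_of_norm_le (integrable_weight.const_mul _) (.of_forall fun x => ?_)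
    rw [norm_smul, α.norm_map]
    calc _ ≤ C * (1 + |τ|) ^ (d + 1) * weight x * ‖b‖ := by gcongr; exact hC τ x
      _ = _ := by ring
  rw [integral_const_mul] at h
  calc _ ≤ _ := h
    _ = (C * ‖b‖ * ∫ x : Momentum d, weight x) * (1 + |τ|) ^ (d + 1) := by ring
    _ ≤ _ := by gcongr; exact le_max_right _ _

variable [NormedStarGroup A] [StarModule ℂ A] [CompleteSpace A]

/-- Smeared operators with disjoint sets of velocities asymptotically (anti)commute, faster than
any power of the time. -/
theorem exists_norm_commutator_smeared_le {J ι : Type*} {ω : StationaryState α} {fermi : Set J}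
    {κ : ι → J} {B : ι → A} (hcomm : AsymptoticallyCommuting ω fermi κ B)
    (hB : ∀ i, Continuous fun p : Momentum d × ℝ => α.toFun p.1 p.2 (B i))
    {ε : J → Momentum d → ℝ} (hε : ∀ j, ContDiff ℝ ((⊤ : ℕ∞) : WithTop ℕ∞) (ε j)) (i l : ι)
    {f g : 𝓢(Momentum d, ℂ)} (hf : HasCompactSupport f) (hg : HasCompactSupport g)
    (hfg : Disjoint (gradient (ε (κ i)) '' tsupport f) (gradient (ε (κ l)) '' tsupport g))
    (N : ℕ) :
    ∃ C, ∀ s t, |s - t| ≤ 1 →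
      ‖gnsRep ω.toState (smeared α (ε (κ i)) (B i) f s * smeared α (ε (κ l)) (B l) g t -
        exchangeSign fermi (κ i) (κ l) •
          (smeared α (ε (κ l)) (B l) g t * smeared α (ε (κ i)) (B i) f s))‖ *
            (1 + |s|) ^ N ≤ C := by
  obtain ⟨C₁, L, hC₁0, hC₁⟩ := exists_norm_packet_mul_norm_packet_le_weight (hε (κ i)) (hε (κ l))
    hf hg hfg N
  obtain ⟨C₂, M, hC₂⟩ := hcomm i l L
  set c := exchangeSign fermi (κ i) (κ l)
  have hC₂0 : 0 ≤ C₂ := by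
    have := (norm_nonneg _).trans (hC₂ 0 0)
    have h2 : (0 : ℝ) < 1 + ‖(0 : Momentum d)‖ ^ L := by positivity
    rw [le_div_iff₀ h2] at this
    simpa using this
  set T : A →L[ℂ] A →L[ℂ] (GNS ω.toState →L[ℂ] GNS ω.toState) :=
    (ContinuousLinearMap.compL ℂ A A _ (gnsRepL ω.toState)).comp
      (ContinuousLinearMap.mul ℂ A - c • (ContinuousLinearMap.mul ℂ A).flip) with hT
  have hTapp : ∀ a b, T a b = gnsRep ω.toState (a * b - c • (b * a)) := fun a b => rfl
  -- translation invariance reduces the commutator at times `s` and `t` to one with time difference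
  -- at most `1`
  have hloc : ∀ s t x y, |s - t| ≤ 1 →
      ‖T (α.toFun x s (B i)) (α.toFun y t (B l))‖ ≤ C₂ * 2 ^ M * (1 + ‖x - y‖ ^ L)⁻¹ := by
    intro s t x y hst
    have e1 : α.toFun x s (B i) = α.toFun y t (α.toFun (x - y) (s - t) (B i)) := by
      rw [← α.map_add, add_sub_cancel, add_sub_cancel]
    have e2 : α.toFun x s (B i) * α.toFun y t (B l) - c • (α.toFun y t (B l) * α.toFun x s (B i)) =
        α.toFun y t (α.toFun (x - y) (s - t) (B i) * B l -
          c • (B l * α.toFun (x - y) (s - t) (B i))) := by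
      rw [e1, map_sub, map_smul, map_mul, map_mul]
    rw [hTapp, e2]
    refine (norm_gnsRep_translate_le ω _ _ _).trans ((hC₂ _ _).trans ?_)
    rw [div_eq_mul_inv]
    gcongr
    linarith
  refine ⟨C₂ * 2 ^ M * C₁ * (∫ x : Momentum d, weight x) ^ 2, fun s t hst => ?_⟩
  have hs : 0 < (1 + |s|) ^ N := by positivity
  rw [← le_div_iff₀ hs, ← hTapp, smeared, smeared]
  refine (norm_bilin_integral_le T (integrable_packet_smul (hε _) hf (hB i) s)
    (integrable_packet_smul (hε _) hg (hB l) t) integrable_weight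
    (D := C₂ * 2 ^ M * C₁ / (1 + |s|) ^ N) fun x y => ?_).trans_eq (by ring)
  rw [map_smul, map_smul, smul_apply, norm_smul, norm_smul]
  have h1 := hC₁ s t x y hst
  rw [div_mul_eq_mul_div, le_div_iff₀ hs]
  calc _ ≤ ‖packet (ε (κ l)) g t y‖ * (‖packet (ε (κ i)) f s x‖ *
        (C₂ * 2 ^ M * (1 + ‖x - y‖ ^ L)⁻¹)) * (1 + |s|) ^ N := by
        gcongr
        exact hloc s t x y hst
    _ = C₂ * 2 ^ M * (‖packet (ε (κ i)) f s x‖ * ‖packet (ε (κ l)) g t y‖ *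
        (1 + ‖x - y‖ ^ L)⁻¹ * (1 + |s|) ^ N) := by ring
    _ ≤ C₂ * 2 ^ M * (C₁ * (weight x * weight y)) := by gcongr
    _ = _ := by ring

end Smeared

/-! ### One-particle vectors -/

theorem integrable_star_mul {d : ℕ} (f g : 𝓢(Momentum d, ℂ)) :
    Integrable fun p => star (f p) * g p :=
  (g.integrable.bdd_mul (c := SchwartzMap.seminorm ℂ 0 0 f)
    (f.continuous.star.aestronglyMeasurable) (.of_forall fun p => by
      rw [norm_star]; exact SchwartzMap.norm_le_seminorm ℂ f p))

section OneParticle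

variable {d : ℕ} {A J : Type*} [NormedRing A] [StarRing A] [NormedAlgebra ℂ A]
  [StarModule ℂ A] {α : Translations d A} {ω : StationaryState α}
  {ε : J → Momentum d → ℝ}

theorem norm_toFun_planeWaveMul (Φ : ElementaryExcitation ω ε) (j : J) (φ : 𝓢(Momentum d, ℂ))
    (x : Momentum d) : ‖Φ.toFun j (planeWaveMul x φ)‖ = ‖Φ.toFun j φ‖ := by
  rw [← sq_eq_sq₀ (norm_nonneg _) (norm_nonneg _)]
  have h : ∀ v : GNS ω.toState, ((‖v‖ ^ 2 : ℝ) : ℂ) = ⟪v, v⟫_ℂ := fun v => by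
    rw [inner_self_eq_norm_sq_to_K]; norm_cast
  rw [← Complex.ofReal_inj, h, h, Φ.inner_eq, Φ.inner_eq, if_pos rfl, if_pos rfl]
  refine integral_congr_ae (.of_forall fun p => ?_)
  simp only [planeWaveMul_apply, star_mul']
  have : star (Complex.exp (Complex.I * (⟪p, x⟫_ℝ : ℂ))) * Complex.exp (Complex.I * (⟪p, x⟫_ℝ : ℂ))
      = 1 := by
    rw [Complex.star_def, ← Complex.normSq_eq_conj_mul_self, Complex.normSq_eq_norm_sq,
      mul_comm Complex.I, Complex.norm_exp_ofReal_mul_I]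
    simp
  linear_combination (star (φ p) * φ p) * this

theorem integrable_packet_zero_smul (Φ : ElementaryExcitation ω ε) (j : J) (η : Momentum d → ℝ)
    (F φ : 𝓢(Momentum d, ℂ)) (hc : Continuous fun x => Φ.toFun j (planeWaveMul x φ)) :
    Integrable fun x => packet η F 0 x • Φ.toFun j (planeWaveMul x φ) := by
  refine ((integrable_packet_zero η F).norm.mul_const ‖Φ.toFun j φ‖).mono' ?_
    (.of_forall fun x => ?_)
  · exact ((continuous_packet_zero η F).smul hc).aestronglyMeasurable
  · rw [norm_smul, norm_toFun_planeWaveMul]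

/-- Smearing a one-particle vector with a wave packet multiplies its wave function. -/
theorem integral_packet_zero_smul (Φ : ElementaryExcitation ω ε) (j : J) (η : Momentum d → ℝ)
    (F φ : 𝓢(Momentum d, ℂ)) (hc : Continuous fun x => Φ.toFun j (planeWaveMul x φ)) :
    ∫ x, packet η F 0 x • Φ.toFun j (planeWaveMul x φ) = Φ.toFun j (schwartzMul F φ) := by
  have hip : ∀ f g, ⟪Φ.toFun j f, Φ.toFun j g⟫_ℂ = ∫ p, star (f p) * g p := fun f g => by
    rw [Φ.inner_eq, if_pos rfl]
  have hint := integrable_packet_zero_smul Φ j η F φ hc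
  set u := ∫ x, packet η F 0 x • Φ.toFun j (planeWaveMul x φ) with hu
  set w := Φ.toFun j (schwartzMul F φ)
  have h1 : ∀ h, ⟪Φ.toFun j h, u⟫_ℂ = ∫ p, star (h p) * (F p * φ p) := by
    intro h
    calc ⟪Φ.toFun j h, u⟫_ℂ = ∫ x, ⟪Φ.toFun j h, packet η F 0 x • Φ.toFun j (planeWaveMul x φ)⟫_ℂ :=
          (integral_inner hint _).symm
      _ = ∫ x, packet η F 0 x * ∫ p, Complex.exp (Complex.I * (⟪p, x⟫_ℝ : ℂ)) *
            (star (h p) * φ p) := by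
          refine integral_congr_ae (.of_forall fun x => ?_)
          simp only [inner_smul_right, hip, planeWaveMul_apply]
          congr 1
          refine integral_congr_ae (.of_forall fun p => ?_)
          simp only
          ring
      _ = _ := by
          rw [integral_packet_zero_mul_integral η F (integrable_star_mul h φ)]
          refine integral_congr_ae (.of_forall fun p => ?_)
          simp only
          ring
  have hwu : ⟪w, u⟫_ℂ = ⟪w, w⟫_ℂ := by
    rw [h1, hip]
    simp only [schwartzMul_apply]
  have huu : ⟪u, u⟫_ℂ = ⟪w, w⟫_ℂ := by
    calc ⟪u, u⟫_ℂ = ∫ x, ⟪u, packet η F 0 x • Φ.toFun j (planeWaveMul x φ)⟫_ℂ :=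
          (integral_inner hint _).symm
      _ = ∫ x, packet η F 0 x * ∫ p, Complex.exp (Complex.I * (⟪p, x⟫_ℝ : ℂ)) *
            (star (schwartzMul F φ p) * φ p) := by
          refine integral_congr_ae (.of_forall fun x => ?_)
          simp only [inner_smul_right]
          congr 1
          rw [← inner_conj_symm, h1, ← integral_conj]
          refine integral_congr_ae (.of_forall fun p => ?_)
          simp only [planeWaveMul_apply, schwartzMul_apply, Complex.star_def, map_mul,
            Complex.conj_conj]
          ring
      _ = _ := by
          rw [integral_packet_zero_mul_integral η F (integrable_star_mul _ φ), hip]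
          refine integral_congr_ae (.of_forall fun p => ?_)
          simp only [schwartzMul_apply]
          ring
  have huw : ⟪u, w⟫_ℂ = ⟪w, w⟫_ℂ := by
    rw [← inner_conj_symm, hwu, inner_conj_symm]
  refine sub_eq_zero.1 (inner_self_eq_zero (𝕜 := ℂ).1 ?_)
  rw [inner_sub_left, inner_sub_right, inner_sub_right, huu, huw, hwu]
  ring

/-- The vector `B̂(f, τ)θ` is the one-particle vector with wave function `fφ`, at all times `τ`. -/
theorem gnsVec_smeared [NormedStarGroup A] [CompleteSpace A] (Φ : ElementaryExcitation ω ε)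
    (hε : ∀ j, ContDiff ℝ ((⊤ : ℕ∞) : WithTop ℕ∞) (ε j)) {j : J} {φ : 𝓢(Momentum d, ℂ)} {b : A}
    (hb : gnsVec ω.toState b = Φ.toFun j φ)
    (hbc : Continuous fun p : Momentum d × ℝ => α.toFun p.1 p.2 b)
    {f : 𝓢(Momentum d, ℂ)} (hf : HasCompactSupport f) (τ : ℝ) :
    gnsVec ω.toState (smeared α (ε j) b f τ) = Φ.toFun j (schwartzMul f φ) := by
  have hx : ∀ x, gnsVec ω.toState (α.toFun x 0 b) = Φ.toFun j (planeWaveMul x φ) := by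
    intro x
    rw [← ω.translate_gnsVec, hb]
    refine (Φ.covariant j x 0 _ _ fun p => ?_).symm
    rw [planeWaveMul_apply, zero_mul, sub_zero]
  have hxτ : ∀ x, gnsVec ω.toState (α.toFun x τ b) =
      ω.translate 0 τ (Φ.toFun j (planeWaveMul x φ)) := by
    intro x
    rw [← hx, ω.translate_gnsVec, ← α.map_add, zero_add, add_zero]
  have hcont : Continuous fun x => Φ.toFun j (planeWaveMul x φ) := by
    have := (gnsVecL ω.toState).continuous.comp (continuous_translate_space hbc 0)
    refine this.congr fun x => ?_
    exact hx x
  have hint := integrable_packet_smul (hε j) hf hbc τ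
  rw [smeared, ← gnsVecL_apply, ← (gnsVecL ω.toState).integral_comp_comm hint]
  have e : ∀ x, gnsVecL ω.toState (packet (ε j) f τ x • α.toFun x τ b) =
      ω.translate 0 τ (packet (ε j) f τ x • Φ.toFun j (planeWaveMul x φ)) := fun x => by
    rw [map_smul, map_smul, gnsVecL_apply, hxτ]
  simp_rw [e]
  rw [ContinuousLinearMap.integral_comp_comm]
  · rw [packet_eq_packet_evolved (hε j) hf, integral_packet_zero_smul Φ j _ _ _ hcont]
    refine (Φ.covariant j 0 τ _ _ fun p => ?_).symm
    rw [schwartzMul_apply, schwartzMul_apply]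
    change _ = _ * (Complex.exp (Complex.I * ((τ * ε j p : ℝ) : ℂ)) * f p * φ p)
    rw [← mul_assoc, ← mul_assoc, ← Complex.exp_add, ← mul_add, ← Complex.ofReal_add,
      inner_zero_right]
    simp
  · rw [packet_eq_packet_evolved (hε j) hf]
    exact integrable_packet_zero_smul Φ j _ _ _ hcont

/-- The vacuum expectation of an operator creating a one-particle vector vanishes: the zero momentum
alone contributes to it, a null set of momenta. -/
theorem map_eq_zero_of_gnsVec_eq [NormedStarGroup A] [CompleteSpace A] (hd : 0 < d)
    (Φ : ElementaryExcitation ω ε)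
    (hε : ∀ j, ContDiff ℝ ((⊤ : ℕ∞) : WithTop ℕ∞) (ε j)) {j : J} {φ : 𝓢(Momentum d, ℂ)} {b : A}
    (hb : gnsVec ω.toState b = Φ.toFun j φ)
    (hbc : Continuous fun p : Momentum d × ℝ => α.toFun p.1 p.2 b) :
    ω.toCLM b = 0 := by
  have key : ∀ f : 𝓢(Momentum d, ℂ), HasCompactSupport f →
      f 0 * ω.toCLM b = ⟪gnsVec ω.toState 1, Φ.toFun j (schwartzMul f φ)⟫_ℂ := by
    intro f hf
    rw [← gnsVec_smeared Φ hε hb hbc hf 0, inner_gnsVec, star_one, one_mul, smeared,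
      ← ω.toCLM.integral_comp_comm (integrable_packet_smul (hε j) hf hbc 0)]
    simp only [map_smul, ω.invariant, smul_eq_mul]
    rw [integral_mul_const]
    congr 1
    have := integral_packet_zero_mul_planeWave (ε j) f 0
    simpa using this.symm
  have hbound : ∀ r : ℝ, 0 < r → ‖ω.toCLM b‖ ≤ ‖gnsVec ω.toState 1‖ *
      √((SchwartzMap.seminorm ℂ 0 0 φ) ^ 2 * volume.real (Metric.ball (0 : Momentum d) r)) := by
    intro r hr
    -- A wave function `f` with `f 0 = 1`, supported near the origin, has small `L²` norm.
    let β : ContDiffBump (0 : Momentum d) := ⟨r / 2, r, by positivity, by linarith⟩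
    have hβ : ContDiff ℝ ((⊤ : ℕ∞) : WithTop ℕ∞) fun p => ((β p : ℝ) : ℂ) :=
      Complex.ofRealCLM.contDiff.comp β.contDiff
    have hβc : HasCompactSupport fun p => ((β p : ℝ) : ℂ) :=
      β.hasCompactSupport.comp_left Complex.ofReal_zero
    set f : 𝓢(Momentum d, ℂ) := hβc.toSchwartzMap hβ with hf
    have hfa : ∀ p, f p = ((β p : ℝ) : ℂ) := fun p => rfl
    have h1 := key f hβc
    rw [hfa, β.one_of_mem_closedBall (Metric.mem_closedBall_self (half_pos hr).le),
      Complex.ofReal_one, one_mul] at h1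
    rw [h1]
    refine (norm_inner_le_norm _ _).trans ?_
    gcongr
    refine Real.le_sqrt_of_sq_le ?_
    have h2 : ((‖Φ.toFun j (schwartzMul f φ)‖ ^ 2 : ℝ) : ℂ) =
        ⟪Φ.toFun j (schwartzMul f φ), Φ.toFun j (schwartzMul f φ)⟫_ℂ := by
      rw [inner_self_eq_norm_sq_to_K]; norm_cast
    have h3 : ‖Φ.toFun j (schwartzMul f φ)‖ ^ 2 =
        ‖∫ p, star (schwartzMul f φ p) * schwartzMul f φ p‖ := by
      rw [Φ.inner_eq, if_pos rfl] at h2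
      rw [← h2, Complex.norm_real, Real.norm_of_nonneg (by positivity)]
    rw [h3, ← setIntegral_eq_integral_of_forall_compl_eq_zero (s := Metric.ball (0 : Momentum d) r)]
    · refine norm_setIntegral_le_of_norm_le_const measure_ball_lt_top fun p _ => ?_
      have h4 : ‖schwartzMul f φ p‖ ≤ SchwartzMap.seminorm ℂ 0 0 φ := by
        rw [schwartzMul_apply, norm_mul, hfa, Complex.norm_real, Real.norm_of_nonneg β.nonneg]
        calc _ ≤ 1 * SchwartzMap.seminorm ℂ 0 0 φ := by
              gcongr
              · exact β.le_one
              · exact SchwartzMap.norm_le_seminorm ℂ φ p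
          _ = _ := one_mul _
      rw [norm_mul, norm_star, ← sq]
      gcongr
    · intro p hp
      have : β p = 0 := by
        by_contra h
        have := β.support_eq.subset (Function.mem_support.2 h)
        exact hp this
      rw [schwartzMul_apply, hfa, this]
      simp
  have hvol : Filter.Tendsto (fun r : ℝ => volume.real (Metric.ball (0 : Momentum d) r))
      (𝓝[>] 0) (𝓝 0) := by
    have h0 : Filter.Tendsto (fun r : ℝ => r ^ d * volume.real (Metric.ball (0 : Momentum d) 1))
        (𝓝[>] 0) (𝓝 (0 ^ d * volume.real (Metric.ball (0 : Momentum d) 1))) :=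
      (((continuous_pow d).tendsto 0).mul_const _).mono_left nhdsWithin_le_nhds
    rw [zero_pow hd.ne', zero_mul] at h0
    refine h0.congr' ?_
    filter_upwards [self_mem_nhdsWithin] with r hr
    rw [Measure.real, Measure.real, Measure.addHaar_ball_of_pos _ _ hr, finrank_euclideanSpace_fin,
      ENNReal.toReal_mul, ENNReal.toReal_ofReal (pow_nonneg (le_of_lt hr) d)]
  have hlim : Filter.Tendsto (fun r : ℝ => ‖gnsVec ω.toState 1‖ *
      √((SchwartzMap.seminorm ℂ 0 0 φ) ^ 2 * volume.real (Metric.ball (0 : Momentum d) r)))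
      (𝓝[>] 0) (𝓝 (‖gnsVec ω.toState 1‖ * √((SchwartzMap.seminorm ℂ 0 0 φ) ^ 2 * 0))) :=
    ((Real.continuous_sqrt.tendsto _).comp (hvol.const_mul _)).const_mul _
  rw [mul_zero, Real.sqrt_zero, mul_zero] at hlim
  have := ge_of_tendsto hlim (by
    filter_upwards [self_mem_nhdsWithin] with r hr using hbound r hr)
  simpa using this

end OneParticle

/-! ### Existence of the in-states -/

section Cook

theorem one_add_abs_le_two_mul {s t : ℝ} (h : |s - t| ≤ 1) : 1 + |s| ≤ 2 * (1 + |t|) := by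
  have h1 := abs_sub_abs_le_abs_sub s t
  have h2 := abs_nonneg t
  linarith

theorem le_div_pow_of_mul_pow_le {u C s : ℝ} {N : ℕ} (h : u * (1 + |s|) ^ N ≤ C) :
    u ≤ C * ((1 + |s|) ^ N)⁻¹ := by
  have hs : 0 < (1 + |s|) ^ N := by positivity
  rwa [← div_eq_mul_inv, le_div_iff₀ hs]

/-- A discrete form of Cook's criterion: rapidly decreasing increments over unit time steps imply
rapid convergence. -/
theorem exists_rapid_limit {H : Type*} [NormedAddCommGroup H] [CompleteSpace H] {v : ℝ → H}
    (hv : ∀ N : ℕ, ∃ C, ∀ s t, |s - t| ≤ 1 → ‖v s - v t‖ * (1 + |t|) ^ N ≤ C) :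
    ∃ ψ, ∀ N : ℕ, ∃ C, ∀ t ≤ 0, ‖v t - ψ‖ * (1 + |t|) ^ N ≤ C := by
  have key : ∀ N : ℕ, ∃ C, 0 ≤ C ∧ ∀ s t, s ≤ t → t ≤ 0 →
      ‖v s - v t‖ ≤ C * ((1 + |t|) ^ N)⁻¹ * (2 / (1 + |t|)) := by
    intro N
    obtain ⟨C, hC⟩ := hv (N + 2)
    have hC0 : 0 ≤ C := by simpa using hC 0 0 (by simp)
    have hstep : ∀ s t, |s - t| ≤ 1 → ‖v s - v t‖ ≤
        C * ((1 + |t|) ^ N)⁻¹ * (1 / (1 + |t|) ^ 2) := fun s t h => by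
      have := le_div_pow_of_mul_pow_le (hC s t h)
      rw [pow_add, mul_inv] at this
      rw [one_div]
      linarith
    refine ⟨C, hC0, ?_⟩
    have hm : ∀ m : ℕ, ∀ s t : ℝ, s ≤ t → t ≤ 0 → t - m ≤ s →
        ‖v s - v t‖ ≤ C * ((1 + |t|) ^ N)⁻¹ * (2 / (1 + |t|)) := by
      intro m
      induction m with
      | zero =>
        intro s t h1 h2 h3
        have : s = t := le_antisymm h1 (by simpa using h3)
        rw [this, sub_self, norm_zero]
        positivity
      | succ m ih =>
        intro s t h1 h2 h3
        have ha : 1 ≤ 1 + |t| := by linarith [abs_nonneg t]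
        rcases le_or_gt (t - 1) s with h | h
        · refine (hstep s t (by rw [abs_le]; constructor <;> linarith)).trans ?_
          gcongr
          · norm_num
          · nlinarith
        · have h4 := ih s (t - 1) h.le (by linarith) (by push_cast at h3; linarith)
          have h5 := hstep (t - 1) t (by simp)
          have h6 : |t - 1| = |t| + 1 := by
            rw [abs_of_nonpos h2, abs_of_nonpos (by linarith)]
            ring
          calc ‖v s - v t‖ ≤ ‖v s - v (t - 1)‖ + ‖v (t - 1) - v t‖ :=
                norm_sub_le_norm_sub_add_norm_sub _ _ _
            _ ≤ C * ((1 + |t - 1|) ^ N)⁻¹ * (2 / (1 + |t - 1|)) +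
                C * ((1 + |t|) ^ N)⁻¹ * (1 / (1 + |t|) ^ 2) := add_le_add h4 h5
            _ ≤ C * ((1 + |t|) ^ N)⁻¹ * (2 / (1 + |t - 1|)) +
                C * ((1 + |t|) ^ N)⁻¹ * (1 / (1 + |t|) ^ 2) := by
                gcongr C * (?_)⁻¹ * _ + _
                exact pow_le_pow_left₀ (by positivity) (by rw [h6]; linarith) N
            _ = C * ((1 + |t|) ^ N)⁻¹ * (2 / (1 + |t| + 1) + 1 / (1 + |t|) ^ 2) := by
                rw [h6]; ring
            _ ≤ _ := by
                gcongr
                rw [div_add_div _ _ (by positivity) (by positivity),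
                  div_le_div_iff₀ (by positivity) (by positivity)]
                nlinarith [mul_nonneg (sub_nonneg.2 ha) (sub_nonneg.2 ha)]
    intro s t h1 h2
    obtain ⟨m, hm'⟩ := exists_nat_ge (t - s)
    exact hm m s t h1 h2 (by linarith)
  have hcau : CauchySeq fun n : ℕ => v (-n) := by
    obtain ⟨C, hC0, hC⟩ := key 0
    refine cauchySeq_of_le_tendsto_0 (fun n : ℕ => 2 * (C * (2 / (1 + (n : ℝ))))) ?_ ?_
    · have hmain : ∀ n N : ℕ, N ≤ n → dist (v (-n)) (v (-N)) ≤ C * (2 / (1 + (N : ℝ))) := by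
        intro n N hn
        have := hC (-n) (-N) (by simpa using hn) (by simp)
        rw [dist_eq_norm]
        simpa using this
      intro n m N hn hm
      calc dist (v (-n)) (v (-m)) ≤ dist (v (-n)) (v (-N)) + dist (v (-m)) (v (-N)) :=
            dist_triangle_right _ _ _
        _ ≤ _ := by linarith [hmain n N hn, hmain m N hm]
    · have : Filter.Tendsto (fun n : ℕ => 2 * (C * (2 / (1 + (n : ℝ))))) Filter.atTop
          (𝓝 (2 * (C * 0))) := by
        refine (Filter.Tendsto.const_mul _ (Filter.Tendsto.const_mul _ ?_))
        exact Filter.Tendsto.const_div_atTop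
          (Filter.tendsto_atTop_add_const_left _ _ tendsto_natCast_atTop_atTop) 2
      simpa using this
  obtain ⟨ψ, hψ⟩ := cauchySeq_tendsto_of_complete hcau
  refine ⟨ψ, fun N => ?_⟩
  obtain ⟨C, hC0, hC⟩ := key N
  refine ⟨C * 2, fun t ht => ?_⟩
  have h1 : Filter.Tendsto (fun n : ℕ => ‖v t - v (-n)‖) Filter.atTop (𝓝 ‖v t - ψ‖) :=
    (hψ.const_sub _).norm
  have h2 : ‖v t - ψ‖ ≤ C * ((1 + |t|) ^ N)⁻¹ * (2 / (1 + |t|)) := by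
    refine le_of_tendsto h1 ?_
    obtain ⟨m, hm⟩ := exists_nat_ge (-t)
    filter_upwards [Filter.eventually_ge_atTop m] with n hn
    rw [norm_sub_rev]
    refine hC _ _ ?_ ht
    have : (m : ℝ) ≤ n := by exact_mod_cast hn
    linarith
  have h3 : 2 / (1 + |t|) ≤ 2 := by
    rw [div_le_iff₀ (by positivity)]
    linarith [abs_nonneg t]
  have hpos : 0 < (1 + |t|) ^ N := by positivity
  calc _ ≤ C * ((1 + |t|) ^ N)⁻¹ * 2 * (1 + |t|) ^ N := by
        gcongr
        exact h2.trans (by gcongr)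
    _ = C * 2 := by field_simp

variable {A : Type*} [NormedRing A] [StarRing A] [NormedAlgebra ℂ A] [StarModule ℂ A]

/-- Time-dependent operators of at most polynomial growth which create a time-independent vector
from the cyclic vector. -/
structure IsCreator (ω : State A) (S : ℝ → A) : Prop where
  norm_le : ∃ (C : ℝ) (K : ℕ), 1 ≤ C ∧ ∀ τ, ‖S τ‖ ≤ C * (1 + |τ|) ^ K
  vec_eq : ∀ s t, gnsVec ω (S s) = gnsVec ω (S t)

/-- The vector obtained by applying the operators of a list, at a common time, to the cyclic
vector. -/
noncomputable def equalTimeVec (ω : State A) (L : List (ℝ → A)) (τ : ℝ) : GNS ω :=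
  gnsVec ω (L.map fun S => S τ).prod

variable {ω : State A}

/-- `ψ` is the limit, at early times, of the vectors created at equal times, with an error that
decays faster than any power of the time. -/
def IsInState (ω : State A) (L : List (ℝ → A)) (ψ : GNS ω) : Prop :=
  ∀ N : ℕ, ∃ C, ∀ t ≤ 0, ‖equalTimeVec ω L t - ψ‖ * (1 + |t|) ^ N ≤ C

theorem tendsto_inv_one_add_abs_atBot :
    Filter.Tendsto (fun t : ℝ => ((1 + |t|) ^ 1)⁻¹) Filter.atBot (𝓝 0) := by
  simp only [pow_one]
  exact (Filter.tendsto_atTop_add_const_left _ _ Filter.tendsto_abs_atBot_atTop).inv_tendsto_atTop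

theorem tendsto_of_forall_norm_sub_mul_le {H : Type*} [NormedAddCommGroup H] {v : ℝ → H} {ψ : H}
    {C : ℝ} (h : ∀ t ≤ 0, ‖v t - ψ‖ ≤ C * ((1 + |t|) ^ 1)⁻¹) :
    Filter.Tendsto v Filter.atBot (𝓝 ψ) := by
  rw [tendsto_iff_norm_sub_tendsto_zero]
  have h0 : Filter.Tendsto (fun t : ℝ => C * ((1 + |t|) ^ 1)⁻¹) Filter.atBot (𝓝 (C * 0)) :=
    tendsto_inv_one_add_abs_atBot.const_mul _
  rw [mul_zero] at h0
  refine squeeze_zero' (.of_forall fun _ => norm_nonneg _) ?_ h0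
  filter_upwards [Filter.eventually_le_atBot 0] with t ht using h t ht

theorem IsInState.tendsto {L : List (ℝ → A)} {ψ : GNS ω} (h : IsInState ω L ψ) :
    Filter.Tendsto (equalTimeVec ω L) Filter.atBot (𝓝 ψ) := by
  obtain ⟨C, hC⟩ := h 1
  exact tendsto_of_forall_norm_sub_mul_le fun t ht => le_div_pow_of_mul_pow_le (hC t ht)

variable [NormedStarGroup A]

/-- At nearly equal times the operators `S` and `S'` commute up to a phase and up to an error that
decays faster than any power of the time. -/
def RapidlyCommute (ω : State A) (S S' : ℝ → A) : Prop :=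
  ∃ c : ℂ, ‖c‖ ≤ 1 ∧ ∀ N : ℕ, ∃ C, ∀ s t, |s - t| ≤ 1 →
    ‖gnsRep ω (S s * S' t - c • (S' t * S s))‖ * (1 + |s|) ^ N ≤ C

theorem equalTimeVec_cons (S : ℝ → A) (L : List (ℝ → A)) (τ : ℝ) :
    equalTimeVec ω (S :: L) τ = gnsRep ω (S τ) (equalTimeVec ω L τ) := by
  rw [equalTimeVec, equalTimeVec, List.map_cons, List.prod_cons, gnsRep_gnsVec]

theorem norm_gnsRep_apply_le (a : A) (v : GNS ω) : ‖gnsRep ω a v‖ ≤ ‖a‖ * ‖v‖ :=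
  ((gnsRep ω a).le_opNorm v).trans (by gcongr; exact norm_gnsRep_le ω a)

theorem exists_norm_equalTimeVec_le (L : List (ℝ → A)) (hL : ∀ S ∈ L, IsCreator ω S) :
    ∃ (C : ℝ) (K : ℕ), 0 ≤ C ∧ ∀ τ, ‖equalTimeVec ω L τ‖ ≤ C * (1 + |τ|) ^ K := by
  induction L with
  | nil => exact ⟨‖gnsVec ω 1‖, 0, norm_nonneg _, fun τ => by simp [equalTimeVec]⟩
  | cons S L ih =>
    obtain ⟨C, K, hC0, hC⟩ := ih fun T hT => hL T (List.mem_cons_of_mem _ hT)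
    obtain ⟨D, M, hD1, hD⟩ := (hL S List.mem_cons_self).norm_le
    refine ⟨D * C, M + K, by positivity, fun τ => ?_⟩
    rw [equalTimeVec_cons]
    calc _ ≤ ‖S τ‖ * ‖equalTimeVec ω L τ‖ := norm_gnsRep_apply_le _ _
      _ ≤ D * (1 + |τ|) ^ M * (C * (1 + |τ|) ^ K) := by gcongr <;> [exact hD τ; exact hC τ]
      _ = _ := by ring

/-- The difference of a creation operator at two nearby times can be commuted to the right, where it
annihilates the cyclic vector. -/
theorem exists_norm_sub_apply_equalTimeVec_le {S : ℝ → A} (hS : IsCreator ω S)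
    (L : List (ℝ → A)) (hL : ∀ T ∈ L, IsCreator ω T) (hc : ∀ T ∈ L, RapidlyCommute ω S T) (N : ℕ) :
    ∃ C, 0 ≤ C ∧ ∀ s t, |s - t| ≤ 1 →
      ‖gnsRep ω (S s - S t) (equalTimeVec ω L t)‖ * (1 + |t|) ^ N ≤ C := by
  induction L generalizing N with
  | nil =>
    refine ⟨0, le_rfl, fun s t _ => ?_⟩
    have : gnsRep ω (S s - S t) (equalTimeVec ω [] t) = 0 := by
      rw [equalTimeVec, List.map_nil, List.prod_nil, gnsRep_gnsVec, mul_one, ← gnsVecL_apply,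
        map_sub, gnsVecL_apply, gnsVecL_apply, hS.vec_eq s t, sub_self]
    rw [this, norm_zero, zero_mul]
  | cons T L ih =>
    obtain ⟨D, K, hD1, hD⟩ := (hL T List.mem_cons_self).norm_le
    obtain ⟨C₁, hC₁0, hC₁⟩ := ih (fun T hT => hL T (List.mem_cons_of_mem _ hT))
      (fun T hT => hc T (List.mem_cons_of_mem _ hT)) (N + K)
    obtain ⟨C₂, K₂, hC₂0, hC₂⟩ := exists_norm_equalTimeVec_le L
      fun T hT => hL T (List.mem_cons_of_mem _ hT)
    obtain ⟨c, hc1, hcN⟩ := hc T List.mem_cons_self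
    obtain ⟨C₃, hC₃⟩ := hcN (N + K₂)
    have hC₃0 : 0 ≤ C₃ := le_trans (by positivity) (hC₃ 0 0 (by simp))
    refine ⟨(C₃ * 2 ^ (N + K₂) + C₃) * C₂ + D * C₁, by positivity, fun s t hst => ?_⟩
    set v := equalTimeVec ω L t
    have hdec : gnsRep ω (S s - S t) (equalTimeVec ω (T :: L) t) =
        gnsRep ω (S s * T t - c • (T t * S s)) v - gnsRep ω (S t * T t - c • (T t * S t)) v +
          c • gnsRep ω (T t) (gnsRep ω (S s - S t) v) := by
      rw [equalTimeVec_cons]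
      simp only [← gnsRepL_apply, map_sub, map_smul, sub_apply, smul_apply]
      simp only [gnsRepL_apply, gnsRep_mul, mul_apply_eq_comp]
      rw [smul_sub]
      abel
    have ht : 0 < (1 + |t|) := by positivity
    have h1 : ‖gnsRep ω (S s * T t - c • (T t * S s))‖ * (1 + |t|) ^ (N + K₂) ≤
        C₃ * 2 ^ (N + K₂) := by
      have := hC₃ s t hst
      calc _ ≤ ‖gnsRep ω (S s * T t - c • (T t * S s))‖ * (2 * (1 + |s|)) ^ (N + K₂) := by
            gcongr
            exact one_add_abs_le_two_mul (by rwa [abs_sub_comm])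
        _ = ‖gnsRep ω (S s * T t - c • (T t * S s))‖ * (1 + |s|) ^ (N + K₂) * 2 ^ (N + K₂) := by
            rw [mul_pow]; ring
        _ ≤ _ := by gcongr
    have h2 := hC₃ t t (by simp)
    have h3 := hC₁ s t hst
    have h4 := hC₂ t
    calc _ ≤ (‖gnsRep ω (S s * T t - c • (T t * S s))‖ * ‖v‖ +
          ‖gnsRep ω (S t * T t - c • (T t * S t))‖ * ‖v‖ +
          1 * (‖T t‖ * ‖gnsRep ω (S s - S t) v‖)) * (1 + |t|) ^ N := by
          rw [hdec]
          gcongr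
          refine (norm_add_le _ _).trans (add_le_add ((norm_sub_le _ _).trans
            (add_le_add (ContinuousLinearMap.le_opNorm _ _)
              (ContinuousLinearMap.le_opNorm _ _))) ?_)
          rw [norm_smul]
          gcongr
          exact norm_gnsRep_apply_le _ _
      _ ≤ (‖gnsRep ω (S s * T t - c • (T t * S s))‖ * (C₂ * (1 + |t|) ^ K₂) +
          ‖gnsRep ω (S t * T t - c • (T t * S t))‖ * (C₂ * (1 + |t|) ^ K₂) +
          1 * (D * (1 + |t|) ^ K * ‖gnsRep ω (S s - S t) v‖)) * (1 + |t|) ^ N := by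
          gcongr
          exact hD t
      _ = (‖gnsRep ω (S s * T t - c • (T t * S s))‖ * (1 + |t|) ^ (N + K₂) +
          ‖gnsRep ω (S t * T t - c • (T t * S t))‖ * (1 + |t|) ^ (N + K₂)) * C₂ +
          D * (‖gnsRep ω (S s - S t) v‖ * (1 + |t|) ^ (N + K)) := by ring
      _ ≤ _ := by gcongr

/-- The increments of the created vectors over unit time intervals decrease rapidly. The product
rule leaves terms in which one operator is replaced by its increment; each of them is small by
`exists_norm_sub_apply_equalTimeVec_le`. -/
theorem exists_norm_equalTimeVec_sub_le (L : List (ℝ → A)) (hL : ∀ T ∈ L, IsCreator ω T)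
    (hc : L.Pairwise (RapidlyCommute ω)) (N : ℕ) :
    ∃ C, 0 ≤ C ∧ ∀ s t, |s - t| ≤ 1 →
      ‖equalTimeVec ω L s - equalTimeVec ω L t‖ * (1 + |t|) ^ N ≤ C := by
  induction L generalizing N with
  | nil => exact ⟨0, le_rfl, fun s t _ => by simp [equalTimeVec]⟩
  | cons S L ih =>
    obtain ⟨hcS, hcL⟩ := List.pairwise_cons.1 hc
    have hL' : ∀ T ∈ L, IsCreator ω T := fun T hT => hL T (List.mem_cons_of_mem _ hT)
    obtain ⟨D, K, hD1, hD⟩ := (hL S List.mem_cons_self).norm_le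
    obtain ⟨C₁, hC₁0, hC₁⟩ := ih hL' hcL (N + K)
    obtain ⟨C₂, hC₂0, hC₂⟩ :=
      exists_norm_sub_apply_equalTimeVec_le (hL S List.mem_cons_self) L hL' hcS N
    refine ⟨D * 2 ^ K * C₁ + C₂, by positivity, fun s t hst => ?_⟩
    have hdec : equalTimeVec ω (S :: L) s - equalTimeVec ω (S :: L) t =
        gnsRep ω (S s) (equalTimeVec ω L s - equalTimeVec ω L t) +
          gnsRep ω (S s - S t) (equalTimeVec ω L t) := by
      rw [equalTimeVec_cons, equalTimeVec_cons]
      simp only [← gnsRepL_apply, map_sub, sub_apply]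
      abel
    have hS : ‖S s‖ ≤ D * 2 ^ K * (1 + |t|) ^ K := by
      calc _ ≤ D * (1 + |s|) ^ K := hD s
        _ ≤ D * (2 * (1 + |t|)) ^ K := by gcongr; exact one_add_abs_le_two_mul hst
        _ = _ := by rw [mul_pow]; ring
    calc _ ≤ (‖S s‖ * ‖equalTimeVec ω L s - equalTimeVec ω L t‖ +
          ‖gnsRep ω (S s - S t) (equalTimeVec ω L t)‖) * (1 + |t|) ^ N := by
          rw [hdec]
          gcongr
          exact (norm_add_le _ _).trans (add_le_add_left (norm_gnsRep_apply_le _ _) _)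
      _ ≤ (D * 2 ^ K * (1 + |t|) ^ K * ‖equalTimeVec ω L s - equalTimeVec ω L t‖ +
          ‖gnsRep ω (S s - S t) (equalTimeVec ω L t)‖) * (1 + |t|) ^ N := by gcongr
      _ = D * 2 ^ K * (‖equalTimeVec ω L s - equalTimeVec ω L t‖ * (1 + |t|) ^ (N + K)) +
          ‖gnsRep ω (S s - S t) (equalTimeVec ω L t)‖ * (1 + |t|) ^ N := by ring
      _ ≤ _ := add_le_add (mul_le_mul_of_nonneg_left (hC₁ s t hst) (by positivity)) (hC₂ s t hst)

/-- Operators that create time-independent vectors and asymptotically commute up to phases create an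
in-state. -/
theorem exists_isInState (L : List (ℝ → A)) (hL : ∀ T ∈ L, IsCreator ω T)
    (hc : L.Pairwise (RapidlyCommute ω)) : ∃ ψ, IsInState ω L ψ :=
  exists_rapid_limit fun N =>
    let ⟨C, _, hC⟩ := exists_norm_equalTimeVec_sub_le L hL hc N
    ⟨C, hC⟩

/-- A further creation operator maps an in-state to the in-state with an additional particle, up to
a rapidly decreasing error. -/
theorem IsInState.exists_norm_gnsRep_sub_le {S : ℝ → A} {L : List (ℝ → A)} {ψ ψ' : GNS ω}
    (hS : IsCreator ω S) (hψ : IsInState ω (S :: L) ψ) (hψ' : IsInState ω L ψ') (N : ℕ) :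
    ∃ C, 0 ≤ C ∧ ∀ t ≤ 0, ‖gnsRep ω (S t) ψ' - ψ‖ ≤ C * ((1 + |t|) ^ N)⁻¹ := by
  obtain ⟨D, K, hD1, hD⟩ := hS.norm_le
  obtain ⟨C₁, hC₁⟩ := hψ' (N + K)
  obtain ⟨C₂, hC₂⟩ := hψ N
  have hC₁0 : 0 ≤ C₁ := le_trans (by positivity) (hC₁ 0 le_rfl)
  have hC₂0 : 0 ≤ C₂ := le_trans (by positivity) (hC₂ 0 le_rfl)
  refine ⟨D * C₁ + C₂, by positivity, fun t ht => le_div_pow_of_mul_pow_le ?_⟩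
  have hdec : gnsRep ω (S t) ψ' - ψ =
      -gnsRep ω (S t) (equalTimeVec ω L t - ψ') + (equalTimeVec ω (S :: L) t - ψ) := by
    rw [equalTimeVec_cons, map_sub]
    abel
  calc _ ≤ (‖S t‖ * ‖equalTimeVec ω L t - ψ'‖ + ‖equalTimeVec ω (S :: L) t - ψ‖) *
        (1 + |t|) ^ N := by
        rw [hdec]
        gcongr
        refine (norm_add_le _ _).trans (add_le_add_left ?_ _)
        rw [norm_neg]
        exact norm_gnsRep_apply_le _ _
    _ ≤ (D * (1 + |t|) ^ K * ‖equalTimeVec ω L t - ψ'‖ + ‖equalTimeVec ω (S :: L) t - ψ‖) *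
        (1 + |t|) ^ N := by gcongr; exact hD t
    _ = D * (‖equalTimeVec ω L t - ψ'‖ * (1 + |t|) ^ (N + K)) +
        ‖equalTimeVec ω (S :: L) t - ψ‖ * (1 + |t|) ^ N := by ring
    _ ≤ _ := add_le_add (mul_le_mul_of_nonneg_left (hC₁ t ht) (by positivity)) (hC₂ t ht)

theorem IsInState.tendsto_gnsRep {S : ℝ → A} {L : List (ℝ → A)} {ψ ψ' : GNS ω}
    (hS : IsCreator ω S) (hψ : IsInState ω (S :: L) ψ) (hψ' : IsInState ω L ψ') :
    Filter.Tendsto (fun t => gnsRep ω (S t) ψ') Filter.atBot (𝓝 ψ) := by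
  obtain ⟨C, -, hC⟩ := hψ.exists_norm_gnsRep_sub_le hS hψ' 1
  exact tendsto_of_forall_norm_sub_mul_le hC

theorem IsInState.exists_norm_gnsVec_sub_le (M : ℕ) :
    ∀ {n : ℕ} {S : Fin n → ℝ → A} {ψ : GNS ω}, (∀ m, IsCreator ω (S m)) →
      (List.ofFn S).Pairwise (RapidlyCommute ω) → IsInState ω (List.ofFn S) ψ → ∀ N : ℕ,
      ∃ C, 0 ≤ C ∧ ∀ τ : Fin n → ℝ, (∀ a, τ a ≤ 0) → (∀ a b, a < b → |τ a| ≤ |τ b| ^ M) →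
        ‖gnsVec ω (List.ofFn fun m => S m (τ m)).prod - ψ‖ ≤ C * ∑ b, ((1 + |τ b|) ^ N)⁻¹ := by
  intro n
  induction n with
  | zero =>
    intro S ψ _ _ hψ N
    refine ⟨0, le_rfl, fun τ _ _ => ?_⟩
    have h1 : equalTimeVec ω (List.ofFn S) = fun _ => gnsVec ω 1 := by
      funext t
      simp [equalTimeVec]
    have h2 := hψ.tendsto
    rw [h1] at h2
    simp [tendsto_nhds_unique h2 tendsto_const_nhds]
  | succ n ih =>
    intro S ψ hS hc hψ N
    rw [List.ofFn_succ] at hc hψ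
    have hS' : ∀ m : Fin n, IsCreator ω (S m.succ) := fun m => hS m.succ
    have hc' := (List.pairwise_cons.1 hc).2
    obtain ⟨ψ', hψ'⟩ := exists_isInState (List.ofFn fun m : Fin n => S m.succ)
      (by simpa using hS') hc'
    obtain ⟨D, K, hD1, hD⟩ := (hS 0).norm_le
    obtain ⟨C₁, hC₁0, hC₁⟩ := ih hS' hc' hψ' (N + M * K)
    obtain ⟨C₂, hC₂0, hC₂⟩ := hψ.exists_norm_gnsRep_sub_le (hS 0) hψ' N
    refine ⟨D * 2 ^ K * C₁ + C₂, by positivity, fun τ hτ hτM => ?_⟩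
    set v := gnsVec ω (List.ofFn fun m : Fin n => S m.succ (τ m.succ)).prod with hv
    have hdec : gnsVec ω (List.ofFn fun m => S m (τ m)).prod - ψ =
        gnsRep ω (S 0 (τ 0)) (v - ψ') + (gnsRep ω (S 0 (τ 0)) ψ' - ψ) := by
      rw [List.ofFn_succ, List.prod_cons, ← gnsRep_gnsVec, map_sub]
      abel
    have h1 := hC₁ (fun m => τ m.succ) (fun a => hτ a.succ)
      fun a b hab => hτM _ _ (Fin.succ_lt_succ_iff.2 hab)
    have h2 := hC₂ (τ 0) (hτ 0)
    have h3 : ∀ b : Fin n, ‖S 0 (τ 0)‖ * ((1 + |τ b.succ|) ^ (N + M * K))⁻¹ ≤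
        D * 2 ^ K * ((1 + |τ b.succ|) ^ N)⁻¹ := by
      intro b
      have hb := abs_nonneg (τ b.succ)
      have h4 : 1 + |τ 0| ≤ 2 * (1 + |τ b.succ|) ^ M := by
        have h5 := hτM 0 b.succ (Fin.succ_pos b)
        have h6 : |τ b.succ| ^ M ≤ (1 + |τ b.succ|) ^ M := by gcongr; linarith
        have h7 : (1 : ℝ) ≤ (1 + |τ b.succ|) ^ M := one_le_pow₀ (by linarith)
        linarith
      rw [← div_eq_mul_inv, ← div_eq_mul_inv, div_le_div_iff₀ (by positivity) (by positivity)]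
      calc ‖S 0 (τ 0)‖ * (1 + |τ b.succ|) ^ N
          ≤ D * (2 * (1 + |τ b.succ|) ^ M) ^ K * (1 + |τ b.succ|) ^ N := by
            gcongr
            exact (hD _).trans (by gcongr)
        _ = _ := by rw [mul_pow, ← pow_mul, pow_add]; ring
    calc _ ≤ ‖S 0 (τ 0)‖ * ‖v - ψ'‖ + ‖gnsRep ω (S 0 (τ 0)) ψ' - ψ‖ := by
          rw [hdec]
          exact (norm_add_le _ _).trans (add_le_add_left (norm_gnsRep_apply_le _ _) _)
      _ ≤ ‖S 0 (τ 0)‖ * (C₁ * ∑ b : Fin n, ((1 + |τ b.succ|) ^ (N + M * K))⁻¹) +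
          C₂ * ((1 + |τ 0|) ^ N)⁻¹ := by gcongr
      _ = C₁ * ∑ b : Fin n, ‖S 0 (τ 0)‖ * ((1 + |τ b.succ|) ^ (N + M * K))⁻¹ +
          C₂ * ((1 + |τ 0|) ^ N)⁻¹ := by rw [← Finset.mul_sum]; ring
      _ ≤ C₁ * ∑ b : Fin n, D * 2 ^ K * ((1 + |τ b.succ|) ^ N)⁻¹ +
          C₂ * ((1 + |τ 0|) ^ N)⁻¹ := by
          gcongr C₁ * ?_ + _
          exact Finset.sum_le_sum fun b _ => h3 b
      _ ≤ _ := by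
          rw [← Finset.mul_sum, Fin.sum_univ_succ]
          have i1 : 0 ≤ ∑ b : Fin n, ((1 + |τ b.succ|) ^ N)⁻¹ :=
            Finset.sum_nonneg fun b _ => by positivity
          have i2 : 0 ≤ ((1 + |τ 0|) ^ N)⁻¹ := by positivity
          have i3 : 0 ≤ D * 2 ^ K * C₁ * ((1 + |τ 0|) ^ N)⁻¹ := by positivity
          have i4 := mul_nonneg hC₂0 i1
          linarith

/-- The in-state is also the limit at different times, if no time is larger than a power of a time
further to the right. -/
theorem IsInState.tendsto_inFilter {n : ℕ} {S : Fin n → ℝ → A} {ψ : GNS ω}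
    (hS : ∀ m, IsCreator ω (S m)) (hc : (List.ofFn S).Pairwise (RapidlyCommute ω))
    (hψ : IsInState ω (List.ofFn S) ψ) (M : ℕ) :
    Filter.Tendsto (fun τ : Fin n → ℝ => gnsVec ω (List.ofFn fun m => S m (τ m)).prod)
      (inFilter n M) (𝓝 ψ) := by
  obtain ⟨C, -, hC⟩ := hψ.exists_norm_gnsVec_sub_le M hS hc 1
  have hpi : Filter.Tendsto (fun τ : Fin n → ℝ => C * ∑ b, ((1 + |τ b|) ^ 1)⁻¹)
      (Filter.pi fun _ => Filter.atBot) (𝓝 (C * ∑ _b : Fin n, 0)) :=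
    (tendsto_finsetSum _ fun b _ =>
      tendsto_inv_one_add_abs_atBot.comp (Filter.tendsto_eval_pi _ b)).const_mul C
  rw [Finset.sum_const_zero, mul_zero] at hpi
  rw [tendsto_iff_norm_sub_tendsto_zero]
  refine squeeze_zero' (.of_forall fun _ => norm_nonneg _) ?_ (hpi.mono_left inf_le_left)
  have h1 : ∀ᶠ τ in inFilter n M, ∀ b, τ b ≤ 0 := by
    refine Filter.eventually_inf_principal.2 (Filter.Eventually.mono ?_ fun τ h _ => h)
    rw [Filter.eventually_all]
    exact fun b => (Filter.tendsto_eval_pi (fun _ => (Filter.atBot : Filter ℝ)) b).eventually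
      (Filter.eventually_le_atBot 0)
  have h2 : ∀ᶠ τ in inFilter n M, ∀ a b, a < b → |τ a| ≤ |τ b| ^ M :=
    Filter.eventually_inf_principal.2 (.of_forall fun τ h => h)
  filter_upwards [h1, h2] with τ h1 h2 using hC τ h1 h2

end Cook

/-! ### The cluster expansion -/

section Truncated

variable {Z : Type*}

open Classical in
/-- The sign of the permutation of the odd letters of the word `z` that puts the blocks of `P` one
after another. -/
noncomputable def wordSign (odd : Set Z) {N : ℕ} (z : Fin N → Z)
    (P : Finpartition (Finset.univ : Finset (Fin N))) : ℂ :=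
  ∏ p : Fin N × Fin N,
    if p.1 < p.2 ∧ z p.1 ∈ odd ∧ z p.2 ∈ odd ∧ (P.part p.2).min < (P.part p.1).min then -1 else 1

open Classical in
/-- The recursive definition of the truncated functions, with positions indexed by `Fin N`. -/
theorem truncated_ofFn (odd : Set Z) (w : List Z → ℂ) {N : ℕ} (z : Fin N → Z) :
    truncated odd w (List.ofFn z) = w (List.ofFn z) -
      ∑ P : {P : Finpartition (Finset.univ : Finset (Fin N)) // Finset.univ ∉ P.parts},
        wordSign odd z P.1 * ∏ b ∈ P.1.parts, truncated odd w ((b.sort (· ≤ ·)).map z) := by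
  have key : ∀ (l : List Z) (N : ℕ) (h : l.length = N), truncated odd w l = w l -
      ∑ P : {P : Finpartition (Finset.univ : Finset (Fin N)) // Finset.univ ∉ P.parts},
        wordSign odd (fun m => l.get (Fin.cast h.symm m)) P.1 * ∏ b ∈ P.1.parts,
          truncated odd w ((b.sort (· ≤ ·)).map fun m => l.get (Fin.cast h.symm m)) := by
    rintro l N rfl
    rw [truncated]
    congr 1
    refine Finset.sum_congr rfl fun P _ => ?_
    congr 1
    exact Finset.prod_coe_sort P.1.parts fun b => truncated odd w (subword l b)
  have h := key (List.ofFn z) N List.length_ofFn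
  have hz : (fun m => (List.ofFn z).get (Fin.cast List.length_ofFn.symm m)) = z := by
    funext m
    simp
  rw [hz] at h
  exact h

theorem eq_of_univ_mem_parts {N : ℕ} {P : Finpartition (Finset.univ : Finset (Fin N))}
    (h : Finset.univ ∈ P.parts) : P.parts = {Finset.univ} := by
  refine Finset.eq_singleton_iff_unique_mem.2 ⟨h, fun b hb => ?_⟩
  by_contra hne
  have hd := P.disjoint hb h hne
  exact P.ne_bot hb (disjoint_top.1 hd)

theorem sort_univ_map {N : ℕ} (z : Fin N → Z) :
    ((Finset.univ : Finset (Fin N)).sort (· ≤ ·)).map z = List.ofFn z := by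
  rw [Fin.sort_univ, List.ofFn_eq_map]

open Classical in
/-- The expansion of a function of words into its truncated functions. -/
theorem eq_sum_truncated (odd : Set Z) (w : List Z → ℂ) {N : ℕ} (hN : 0 < N) (z : Fin N → Z) :
    w (List.ofFn z) = ∑ P : Finpartition (Finset.univ : Finset (Fin N)),
      wordSign odd z P * ∏ b ∈ P.parts, truncated odd w ((b.sort (· ≤ ·)).map z) := by
  have hne : (Finset.univ : Finset (Fin N)) ≠ ⊥ := by
    have : Nonempty (Fin N) := ⟨⟨0, hN⟩⟩
    exact Finset.univ_nonempty.ne_empty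
  set F : Finpartition (Finset.univ : Finset (Fin N)) → ℂ := fun P =>
    wordSign odd z P * ∏ b ∈ P.parts, truncated odd w ((b.sort (· ≤ ·)).map z) with hF
  rw [← Fintype.sum_subtype_add_sum_subtype (fun P => Finset.univ ∈ P.parts) F]
  have hu : ∀ P : {P : Finpartition (Finset.univ : Finset (Fin N)) // Finset.univ ∈ P.parts},
      P = ⟨Finpartition.indiscrete hne, by simp⟩ := by
    rintro ⟨P, hP⟩
    refine Subtype.ext (Finpartition.ext ?_)
    rw [eq_of_univ_mem_parts hP]
    rfl
  rw [Fintype.sum_eq_single _ fun P hP => absurd (hu P) hP]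
  have hsign : wordSign odd z (Finpartition.indiscrete hne) = 1 := by
    refine Finset.prod_eq_one fun p _ => if_neg ?_
    have : ∀ q, (Finpartition.indiscrete hne).part q = Finset.univ := fun q => by
      have := (Finpartition.indiscrete hne).part_mem.2 (Finset.mem_univ q)
      simpa using this
    rw [this, this]
    simp
  have h1 : F (Finpartition.indiscrete hne) = truncated odd w (List.ofFn z) := by
    simp only [hF, hsign, one_mul, Finpartition.indiscrete_parts, Finset.prod_singleton,
      sort_univ_map]
  rw [h1, truncated_ofFn]
  ring

theorem sort_map_eq_ofFn {N : ℕ} (b : Finset (Fin N)) (z : Fin N → Z) :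
    (b.sort (· ≤ ·)).map z = List.ofFn fun m : Fin b.card => z (b.orderEmbOfFin rfl m) := by
  refine List.ext_getElem (by simp) fun k h1 h2 => ?_
  simp [Finset.orderEmbOfFin_apply]

theorem truncated_singleton (odd : Set Z) (w : List Z → ℂ) (z : Z) :
    truncated odd w [z] = w [z] := by
  classical
  have h := truncated_ofFn odd w (fun _ : Fin 1 => z)
  have e : List.ofFn (fun _ : Fin 1 => z) = [z] := by simp
  rw [e] at h
  rw [h, sub_eq_self]
  refine Finset.sum_eq_zero fun P _ => ?_
  exfalso
  obtain ⟨b, hb⟩ := P.1.parts_nonempty (Finset.univ_nonempty (α := Fin 1)).ne_empty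
  have h1 := card_lt_of_univ_notMem P.2 hb
  have h2 := Finset.card_pos.2 (P.1.nonempty_of_mem_parts hb)
  omega

/-- If the one-point functions vanish, the two-point functions are already truncated. -/
theorem truncated_pair (odd : Set Z) (w : List Z → ℂ) (h0 : ∀ z, w [z] = 0) (z z' : Z) :
    truncated odd w [z, z'] = w [z, z'] := by
  classical
  have h := truncated_ofFn odd w ![z, z']
  have e : List.ofFn ![z, z'] = [z, z'] := by simp
  rw [e] at h
  rw [h, sub_eq_self]
  refine Finset.sum_eq_zero fun P _ => ?_
  obtain ⟨b, hb⟩ := P.1.parts_nonempty (Finset.univ_nonempty (α := Fin 2)).ne_empty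
  have h1 := card_lt_of_univ_notMem P.2 hb
  have h2 := Finset.card_pos.2 (P.1.nonempty_of_mem_parts hb)
  obtain ⟨a, rfl⟩ := Finset.card_eq_one.1 (show b.card = 1 by omega)
  rw [Finset.prod_eq_zero hb, mul_zero]
  rw [Finset.sort_singleton, List.map_singleton, truncated_singleton, h0]

end Truncated

section Correlation

theorem continuous_prod_ofFn {X R : Type*} [TopologicalSpace X] [NormedRing R] {N : ℕ}
    {a : Fin N → X → R} (ha : ∀ m, Continuous (a m)) :
    Continuous fun x => (List.ofFn fun m => a m x).prod := by
  simp only [List.ofFn_eq_map]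
  exact continuous_list_prod _ fun m _ => ha m

variable {d : ℕ} {A J ι : Type*} [NormedRing A] [StarRing A] [NormedAlgebra ℂ A]
  {α : Translations d A}

/-- The letters `A_m(x_m, 0)` of a word at time zero. -/
def letter {N : ℕ} (c : Fin N → ι × Bool) (x : Fin N → Momentum d) (m : Fin N) :
    (ι × Bool) × (Momentum d × ℝ) :=
  (c m, x m, 0)

theorem fieldAt_eq_of_time (B : ι → A) (c : ι × Bool) (x : Momentum d) (s : ℝ) :
    fieldAt α B (c, x, s) = α.toFun 0 s (fieldAt α B (c, x, 0)) := by
  simp only [fieldAt]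
  rw [← α.map_add, zero_add, add_zero]

/-- Correlation functions at equal times do not depend on the time. -/
theorem correlation_equalTime (ω : StationaryState α) (B : ι → A) {N : ℕ} (c : Fin N → ι × Bool)
    (x : Fin N → Momentum d) (s : ℝ) :
    ω.toCLM (List.ofFn fun m => fieldAt α B (c m, x m, s)).prod =
      correlation ω B (List.ofFn (letter c x)) := by
  have : (List.ofFn fun m => fieldAt α B (c m, x m, s)).prod =
      α.toFun 0 s (List.ofFn fun m => fieldAt α B (c m, x m, 0)).prod := by
    rw [map_list_prod, List.map_ofFn]
    congr 2
    funext m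
    exact fieldAt_eq_of_time B (c m) (x m) s
  rw [this, ω.invariant, correlation, List.map_ofFn]
  rfl

/-- The cluster property for a block of a word at time zero. -/
theorem StrongClusterProperty.exists_norm_truncated_block_le {ω : StationaryState α}
    {fermi : Set J} {κ : ι → J} {B : ι → A} (h : StrongClusterProperty ω fermi κ B) {N : ℕ}
    (c : Fin N → ι × Bool) (b : Finset (Fin N)) (L : ℕ) :
    ∃ C, 0 ≤ C ∧ ∀ x : Fin N → Momentum d, ∀ p ∈ b, ∀ q ∈ b,
      ‖truncated {z | z.1.1 ∈ κ ⁻¹' fermi} (correlation ω B) ((b.sort (· ≤ ·)).map (letter c x))‖ ≤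
        C * (1 + ‖x p - x q‖ ^ L)⁻¹ := by
  obtain ⟨C, M, hC⟩ := h b.card (fun m => c (b.orderEmbOfFin rfl m)) L
  refine ⟨max C 0, le_max_right _ _, fun x p hp q hq => ?_⟩
  obtain ⟨p', rfl⟩ : p ∈ Set.range (b.orderEmbOfFin rfl) := by
    rw [Finset.range_orderEmbOfFin]; exact hp
  obtain ⟨q', rfl⟩ : q ∈ Set.range (b.orderEmbOfFin rfl) := by
    rw [Finset.range_orderEmbOfFin]; exact hq
  have h1 := hC (fun m => x (b.orderEmbOfFin rfl m)) (fun _ => 0) p' q'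
  simp only [abs_zero, Finset.sum_const_zero, add_zero, one_pow, mul_one] at h1
  rw [sort_map_eq_ofFn]
  refine h1.trans ?_
  rw [div_eq_mul_inv]
  gcongr
  exact le_max_left _ _

variable [NormedStarGroup A]

theorem continuous_fieldAt {B : ι → A}
    (hB : ∀ i, Continuous fun p : Momentum d × ℝ => α.toFun p.1 p.2 (B i)) (c : ι × Bool) (s : ℝ) :
    Continuous fun x => fieldAt α B (c, x, s) := by
  have h1 := continuous_translate_space (hB c.1) s
  rcases c with ⟨i, _ | _⟩
  · exact h1
  · simp only [fieldAt, if_true, map_star]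
    exact h1.star

theorem norm_fieldAt (B : ι → A) (z : (ι × Bool) × (Momentum d × ℝ)) :
    ‖fieldAt α B z‖ = ‖B z.1.1‖ := by
  rw [fieldAt, α.norm_map]
  split_ifs <;> simp

theorem continuous_correlation (ω : StationaryState α) {B : ι → A}
    (hB : ∀ i, Continuous fun p : Momentum d × ℝ => α.toFun p.1 p.2 (B i)) {N : ℕ}
    (c : Fin N → ι × Bool) :
    Continuous fun x : Fin N → Momentum d => correlation ω B (List.ofFn (letter c x)) := by
  simp only [correlation, List.map_ofFn]
  exact ω.toCLM.continuous.comp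
    (continuous_prod_ofFn fun m => (continuous_fieldAt hB (c m) 0).comp (continuous_apply m))

theorem continuous_truncated (ω : StationaryState α) {B : ι → A}
    (hB : ∀ i, Continuous fun p : Momentum d × ℝ => α.toFun p.1 p.2 (B i)) (odd : Set ι) (N : ℕ) :
    ∀ c : Fin N → ι × Bool, Continuous fun x : Fin N → Momentum d =>
      truncated {z | z.1.1 ∈ odd} (correlation ω B) (List.ofFn (letter c x)) := by
  classical
  induction N using Nat.strong_induction_on with
  | _ N ih =>
    intro c
    simp only [truncated_ofFn]
    refine (continuous_correlation ω hB c).sub (continuous_finsetSum _ fun P _ =>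
      Continuous.mul ?_ (continuous_finsetProd _ fun b hb => ?_))
    · exact continuous_of_const fun _ _ => rfl
    · simp only [sort_map_eq_ofFn]
      exact (ih b.card (card_lt_of_univ_notMem P.2 hb) fun m => c (b.orderEmbOfFin rfl m)).comp
        (continuous_pi fun m => continuous_apply _)

theorem continuous_truncated_block (ω : StationaryState α) {B : ι → A}
    (hB : ∀ i, Continuous fun p : Momentum d × ℝ => α.toFun p.1 p.2 (B i)) (odd : Set ι) {N : ℕ}
    (c : Fin N → ι × Bool) (b : Finset (Fin N)) : Continuous fun x : Fin N → Momentum d =>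
      truncated {z | z.1.1 ∈ odd} (correlation ω B) ((b.sort (· ≤ ·)).map (letter c x)) := by
  simp only [sort_map_eq_ofFn]
  exact (continuous_truncated ω hB odd b.card fun m => c (b.orderEmbOfFin rfl m)).comp
    (continuous_pi fun m => continuous_apply _)

end Correlation

/-! ### Partitions into pairs -/

section Pairing

variable {n m : ℕ}

/-- The block that pairs the position `r` of the left half of a word with the position `σ r` of its
right half. -/
def pairBlock (σ : Fin n ≃ Fin m) (r : Fin n) : Finset (Fin (n + m)) :=
  {Fin.castAdd m r, Fin.natAdd n (σ r)}

theorem castAdd_ne_natAdd (r : Fin n) (b : Fin m) : Fin.castAdd m r ≠ Fin.natAdd n b := by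
  intro h
  have := congrArg Fin.val h
  simp at this
  omega

theorem castAdd_mem_pairBlock {σ : Fin n ≃ Fin m} {r r' : Fin n} :
    Fin.castAdd m r ∈ pairBlock σ r' ↔ r = r' := by
  simp [pairBlock, castAdd_ne_natAdd]

theorem natAdd_mem_pairBlock {σ : Fin n ≃ Fin m} {b : Fin m} {r : Fin n} :
    Fin.natAdd n b ∈ pairBlock σ r ↔ b = σ r := by
  simp [pairBlock, (castAdd_ne_natAdd _ _).symm]

theorem pairBlock_injective (σ : Fin n ≃ Fin m) : Function.Injective (pairBlock σ) := by
  intro r r' h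
  have : Fin.castAdd m r ∈ pairBlock σ r' := h ▸ castAdd_mem_pairBlock.2 rfl
  exact castAdd_mem_pairBlock.1 this

/-- The partition of the positions of a word into pairs given by a bijection from the left half of
the word to its right half. -/
def pairing (σ : Fin n ≃ Fin m) : Finpartition (Finset.univ : Finset (Fin (n + m))) :=
  Finpartition.ofExistsUnique (Finset.univ.image (pairBlock σ)) (fun _ _ => Finset.subset_univ _)
    (by
      intro a _
      simp only [Finset.mem_image, Finset.mem_univ, true_and]
      refine Fin.addCases (fun r => ?_) (fun b => ?_) a
      · refine ⟨pairBlock σ r, ⟨⟨r, rfl⟩, castAdd_mem_pairBlock.2 rfl⟩, ?_⟩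
        rintro _ ⟨⟨r', rfl⟩, h⟩
        rw [castAdd_mem_pairBlock.1 h]
      · refine ⟨pairBlock σ (σ.symm b), ⟨⟨_, rfl⟩, natAdd_mem_pairBlock.2 (by simp)⟩, ?_⟩
        rintro _ ⟨⟨r', rfl⟩, h⟩
        rw [natAdd_mem_pairBlock.1 h, Equiv.symm_apply_apply])
    (by
      simp only [Finset.mem_image, Finset.mem_univ, true_and, not_exists]
      intro r h
      have := castAdd_mem_pairBlock (σ := σ).2 (rfl : r = r)
      rw [h] at this
      simp at this)

theorem pairing_parts (σ : Fin n ≃ Fin m) :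
    (pairing σ).parts = Finset.univ.image (pairBlock σ) := rfl

theorem pairBlock_mem_parts (σ : Fin n ≃ Fin m) (r : Fin n) :
    pairBlock σ r ∈ (pairing σ).parts := by
  simp [pairing_parts]

theorem pairing_part_castAdd (σ : Fin n ≃ Fin m) (r : Fin n) :
    (pairing σ).part (Fin.castAdd m r) = pairBlock σ r :=
  Finpartition.part_eq_of_mem _ (pairBlock_mem_parts σ r) (castAdd_mem_pairBlock.2 rfl)

theorem pairing_part_natAdd (σ : Fin n ≃ Fin m) (r : Fin n) :
    (pairing σ).part (Fin.natAdd n (σ r)) = pairBlock σ r :=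
  Finpartition.part_eq_of_mem _ (pairBlock_mem_parts σ r) (natAdd_mem_pairBlock.2 rfl)

theorem pairing_injective : Function.Injective (pairing : (Fin n ≃ Fin m) → _) := by
  intro σ σ' h
  refine Equiv.ext fun r => ?_
  have h1 : Fin.natAdd n (σ r) ∈ (pairing σ').part (Fin.castAdd m r) := by
    rw [← h, pairing_part_castAdd]
    exact natAdd_mem_pairBlock.2 rfl
  rw [pairing_part_castAdd] at h1
  exact natAdd_mem_pairBlock.1 h1

/-- A partition without singletons, in which no block contains two positions of the same half of
the word, is a partition into pairs. -/
theorem exists_eq_pairing {P : Finpartition (Finset.univ : Finset (Fin (n + m)))}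
    (h1 : ∀ b ∈ P.parts, b.card ≠ 1)
    (hl : ∀ b ∈ P.parts, ∀ r r', Fin.castAdd m r ∈ b → Fin.castAdd m r' ∈ b → r = r')
    (hr : ∀ b ∈ P.parts, ∀ r r', Fin.natAdd n r ∈ b → Fin.natAdd n r' ∈ b → r = r') :
    ∃ σ, pairing σ = P := by
  have hne : ∀ b ∈ P.parts, ∀ q ∈ b, ∃ q' ∈ b, q' ≠ q := by
    intro b hb q hq
    by_contra! h
    exact h1 b hb (Finset.card_eq_one.2 ⟨q, Finset.eq_singleton_iff_unique_mem.2 ⟨hq, h⟩⟩)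
  have hP : ∀ q, P.part q ∈ P.parts := fun q => P.part_mem.2 (Finset.mem_univ q)
  have hself : ∀ q, q ∈ P.part q := fun q => P.mem_part (Finset.mem_univ q)
  have hL : ∀ r, ∃ b, Fin.natAdd n b ∈ P.part (Fin.castAdd m r) := by
    intro r
    obtain ⟨q, hq, hqr⟩ := hne _ (hP (Fin.castAdd m r)) _ (hself _)
    induction q using Fin.addCases with
    | left r' => exact absurd (by rw [hl _ (hP _) r' r hq (hself _)]) hqr
    | right b => exact ⟨b, hq⟩
  have hR : ∀ b, ∃ r, Fin.castAdd m r ∈ P.part (Fin.natAdd n b) := by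
    intro b
    obtain ⟨q, hq, hqr⟩ := hne _ (hP (Fin.natAdd n b)) _ (hself _)
    induction q using Fin.addCases with
    | left r => exact ⟨r, hq⟩
    | right b' => exact absurd (by rw [hr _ (hP _) b' b hq (hself _)]) hqr
  choose s hs using hL
  choose t ht using hR
  have hpart : ∀ r, P.part (Fin.natAdd n (s r)) = P.part (Fin.castAdd m r) := fun r =>
    P.part_eq_of_mem (hP _) (hs r)
  have hpart' : ∀ b, P.part (Fin.castAdd m (t b)) = P.part (Fin.natAdd n b) := fun b =>
    P.part_eq_of_mem (hP _) (ht b)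
  let σ : Fin n ≃ Fin m := ⟨s, t,
    fun r => hl _ (hP (Fin.castAdd m r)) _ _ (by rw [← hpart r]; exact ht _) (hself _),
    fun b => hr _ (hP (Fin.natAdd n b)) _ _ (by rw [← hpart' b]; exact hs _) (hself _)⟩
  have hblock : ∀ r, pairBlock σ r = P.part (Fin.castAdd m r) := by
    intro r
    ext q
    induction q using Fin.addCases with
    | left r' =>
      rw [castAdd_mem_pairBlock]
      exact ⟨fun h => h ▸ hself _, fun h => hl _ (hP _) _ _ h (hself _)⟩
    | right b =>
      rw [natAdd_mem_pairBlock]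
      exact ⟨fun h => h ▸ hs r, fun h => hr _ (hP _) _ _ h (hs r)⟩
  refine ⟨σ, Finpartition.ext ?_⟩
  ext b
  rw [pairing_parts, Finset.mem_image]
  constructor
  · rintro ⟨r, -, rfl⟩
    rw [hblock]
    exact hP _
  · intro hb
    obtain ⟨q, hq⟩ := P.nonempty_of_mem_parts hb
    rw [← P.part_eq_of_mem hb hq]
    induction q using Fin.addCases with
    | left r => exact ⟨r, Finset.mem_univ _, hblock r⟩
    | right b' => exact ⟨t b', Finset.mem_univ _, by rw [hblock, hpart']⟩

theorem min_pairBlock (σ : Fin n ≃ Fin m) (r : Fin n) :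
    (pairBlock σ r).min = (Fin.castAdd m r : WithTop (Fin (n + m))) := by
  refine le_antisymm (Finset.min_le (castAdd_mem_pairBlock.2 rfl)) (Finset.le_min fun q hq => ?_)
  rw [WithTop.coe_le_coe]
  simp only [pairBlock, Finset.mem_insert, Finset.mem_singleton] at hq
  rcases hq with rfl | rfl
  · exact le_rfl
  · rw [Fin.le_def]
    simp
    omega

theorem sort_pairBlock (σ : Fin n ≃ Fin m) (r : Fin n) :
    (pairBlock σ r).sort (· ≤ ·) = [Fin.castAdd m r, Fin.natAdd n (σ r)] := by
  have hlt : Fin.castAdd m r < Fin.natAdd n (σ r) := by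
    rw [Fin.lt_def]
    simp
    omega
  rw [pairBlock, Finset.sort_insert (r := (· ≤ ·)) (h₂ := by simp [castAdd_ne_natAdd]),
    Finset.sort_singleton]
  intro q hq
  rw [Finset.mem_singleton.1 hq]
  exact hlt.le

/-- The sign with which the permutation `σ` of particles of kinds `k` enters the scalar products
of Fock vectors: a factor for every pair of particles that `σ` interchanges. -/
noncomputable def permSign {J : Type*} (fermi : Set J) (k : Fin n → J) (σ : Fin n ≃ Fin m) : ℂ :=
  ∏ a, ∏ b, if a < b ∧ σ b < σ a then exchangeSign fermi (k a) (k b) else 1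

theorem exchangeSign_mul_self {J : Type*} (fermi : Set J) (j k : J) :
    exchangeSign fermi j k * exchangeSign fermi j k = 1 := by
  unfold exchangeSign
  split_ifs <;> norm_num

theorem exchangeSign_comm {J : Type*} (fermi : Set J) (j k : J) :
    exchangeSign fermi j k = exchangeSign fermi k j := by
  by_cases h : j ∈ fermi <;> by_cases h' : k ∈ fermi <;> simp [exchangeSign, h, h']

theorem norm_exchangeSign {J : Type*} (fermi : Set J) (j k : J) :
    ‖exchangeSign fermi j k‖ = 1 := by
  unfold exchangeSign
  split_ifs <;> simp

/-- The sign of a partition into pairs of equal kinds. The left half of the word is written in the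
opposite order, as befits an adjoint. -/
theorem wordSign_pairing {Z J : Type*} {odd : Set Z} {fermi : Set J} {z : Fin (n + m) → Z}
    {k : Fin n → J} {k' : Fin m → J} (hk : ∀ r, z (Fin.castAdd m r) ∈ odd ↔ k r.rev ∈ fermi)
    (hk' : ∀ r, z (Fin.natAdd n r) ∈ odd ↔ k' r ∈ fermi) (σ : Fin n ≃ Fin m)
    (h : ∀ a, k a = k' (σ a)) :
    wordSign odd z (pairing (Fin.revPerm.trans σ)) = permSign fermi k σ := by
  classical
  set ρ : Fin n ≃ Fin m := Fin.revPerm.trans σ with hρ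
  have hkρ : ∀ r, z (Fin.natAdd n (ρ r)) ∈ odd ↔ k r.rev ∈ fermi := fun r => by
    rw [hk', h, hρ]
    rfl
  have hcc : ∀ r r' : Fin n, Fin.castAdd m r < Fin.castAdd m r' ↔ r < r' := fun r r' => Iff.rfl
  have hcn : ∀ (r : Fin n) (b : Fin m), Fin.castAdd m r < Fin.natAdd n b := fun r b => by
    rw [Fin.lt_def]
    simp
    omega
  have hnn : ∀ b b' : Fin m, Fin.natAdd n b < Fin.natAdd n b' ↔ b < b' := fun b b' => by
    simp
  have hsplit : ∀ F : Fin (n + m) → Fin (n + m) → ℂ, ∏ p : Fin (n + m) × Fin (n + m), F p.1 p.2 =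
      (∏ r, ((∏ r', F (Fin.castAdd m r) (Fin.castAdd m r')) *
        ∏ r', F (Fin.castAdd m r) (Fin.natAdd n (ρ r')))) *
      ∏ r, ((∏ r', F (Fin.natAdd n (ρ r)) (Fin.castAdd m r')) *
        ∏ r', F (Fin.natAdd n (ρ r)) (Fin.natAdd n (ρ r'))) := by
    intro F
    rw [Fintype.prod_prod_type, Fin.prod_univ_add, Equiv.prod_comp ρ fun b =>
      (∏ r', F (Fin.natAdd n b) (Fin.castAdd m r')) *
        ∏ r', F (Fin.natAdd n b) (Fin.natAdd n (ρ r'))]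
    congr 1 <;> refine Finset.prod_congr rfl fun r _ => ?_ <;>
      rw [Fin.prod_univ_add, Equiv.prod_comp ρ fun b => F _ (Fin.natAdd n b)]
  have hrev : permSign fermi k σ = ∏ r : Fin n, ∏ r' : Fin n,
      if r' < r ∧ ρ r' < ρ r then exchangeSign fermi (k r.rev) (k r'.rev) else 1 := by
    rw [permSign, ← Equiv.prod_comp Fin.revPerm]
    refine Finset.prod_congr rfl fun r _ => ?_
    rw [← Equiv.prod_comp Fin.revPerm]
    refine Finset.prod_congr rfl fun r' _ => ?_
    simp [hρ]
  rw [wordSign, hsplit fun p q => if p < q ∧ z p ∈ odd ∧ z q ∈ odd ∧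
    ((pairing ρ).part q).min < ((pairing ρ).part p).min then -1 else 1, hrev]
  simp only [pairing_part_castAdd, pairing_part_natAdd, min_pairBlock,
    WithTop.coe_lt_coe, hcc, hnn, hcn, (hcn _ _).not_gt, hk, hkρ, false_and, true_and, if_false,
    Finset.prod_const_one, one_mul]
  rw [← Finset.prod_mul_distrib]
  refine Finset.prod_congr rfl fun r _ => ?_
  rw [← Finset.prod_mul_distrib, ← Finset.prod_mul_distrib]
  refine Finset.prod_congr rfl fun r' _ => ?_
  rw [if_neg fun h : r < r' ∧ _ => lt_asymm h.1 h.2.2.2, one_mul]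
  by_cases hr : r' < r
  · rcases lt_trichotomy (ρ r') (ρ r) with h1 | h1 | h1
    · simp only [hr, h1, h1.not_gt, and_true, and_self, if_true, exchangeSign, false_and, if_false,
        mul_one]
    · exact absurd (ρ.injective h1) hr.ne
    · simp only [hr, h1, h1.not_gt, and_true, and_false, if_false, true_and]
      split_ifs <;> norm_num
  · simp [hr]

end Pairing

/-! ### Cluster expansion of products of smeared operators -/

section ProductIntegral

variable {X : Type*} [MeasurableSpace X] {μ : Measure X} [SigmaFinite μ]

/-- Fubini's theorem for an ordered product of factors in a noncommutative algebra. -/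
theorem integrable_integral_prod_ofFn {R : Type*} [NormedRing R] [NormedAlgebra ℂ R]
    [CompleteSpace R] {N : ℕ} (u : Fin N → X → R) (hu : ∀ m, Integrable (u m) μ) :
    Integrable (fun x : Fin N → X => (List.ofFn fun m => u m (x m)).prod)
        (Measure.pi fun _ => μ) ∧
      ∫ x : Fin N → X, (List.ofFn fun m => u m (x m)).prod ∂(Measure.pi fun _ => μ) =
        (List.ofFn fun m => ∫ x, u m x ∂μ).prod := by
  induction N with
  | zero =>
    simp only [List.ofFn_zero, List.prod_nil, integral_const, Measure.real, Measure.pi_univ,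
      Finset.univ_eq_empty, Finset.prod_empty, ENNReal.toReal_one, one_smul, and_true]
    have : IsFiniteMeasure (Measure.pi fun _ : Fin 0 => μ) := ⟨by simp⟩
    exact integrable_const 1
  | succ N ih =>
    obtain ⟨h1, h2⟩ := ih (fun m => u m.succ) fun m => hu m.succ
    have hmp := measurePreserving_piFinSuccAbove (fun _ : Fin (N + 1) => μ) 0
    have hfun : (fun x : Fin (N + 1) → X => (List.ofFn fun m => u m (x m)).prod) =
        (fun z : X × (Fin N → X) => u 0 z.1 * (List.ofFn fun m => u m.succ (z.2 m)).prod) ∘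
          MeasurableEquiv.piFinSuccAbove (fun _ => X) 0 := by
      funext x
      simp only [Function.comp_apply, MeasurableEquiv.piFinSuccAbove_apply, List.ofFn_succ,
        List.prod_cons]
      rfl
    rw [hfun]
    refine ⟨(hmp.integrable_comp_emb (MeasurableEquiv.measurableEmbedding _)).2
      ((hu 0).mul_prod h1), ?_⟩
    have h3 := hmp.integral_comp (MeasurableEquiv.measurableEmbedding _)
      fun z : X × (Fin N → X) => u 0 z.1 * (List.ofFn fun m => u m.succ (z.2 m)).prod
    refine h3.trans ?_
    rw [List.ofFn_succ, List.prod_cons, ← h2]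
    exact integral_prod_bilin (ContinuousLinearMap.mul ℂ R) (hu 0) h1

/-- A product over the pairs given by a bijection integrates factor by factor. -/
theorem integral_prod_pairs {E : Type*} [MeasureSpace E] [SigmaFinite (volume : Measure E)]
    {n m : ℕ} (σ : Fin n ≃ Fin m) (G : Fin n → E → E → ℂ) :
    ∫ x : Fin (n + m) → E, ∏ r, G r (x (Fin.castAdd m r)) (x (Fin.natAdd n (σ r))) =
      ∏ r, ∫ z : E × E, G r z.1 z.2 := by
  set e : Fin n ⊕ Fin n ≃ Fin (n + m) := ((Equiv.refl _).sumCongr σ).trans finSumFinEquiv with he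
  have h1 := volume_measurePreserving_arrowProdEquivProdArrow E E (Fin n)
  have h2 := (volume_measurePreserving_sumPiEquivProdPi fun _ : Fin n ⊕ Fin n => E).symm
  have h3 := volume_measurePreserving_piCongrLeft (fun _ : Fin (n + m) => E) e
  have h := h3.comp (h2.comp h1)
  rw [← integral_fintype_prod_volume_eq_prod fun r (z : E × E) => G r z.1 z.2]
  have hemb : MeasurableEmbedding (MeasurableEquiv.piCongrLeft (fun _ : Fin (n + m) => E) e ∘
      (MeasurableEquiv.sumPiEquivProdPi fun _ : Fin n ⊕ Fin n => E).symm ∘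
        MeasurableEquiv.arrowProdEquivProdArrow E E (Fin n)) :=
    (MeasurableEquiv.measurableEmbedding _).comp
      ((MeasurableEquiv.measurableEmbedding _).comp (MeasurableEquiv.measurableEmbedding _))
  rw [← h.integral_comp hemb]
  refine integral_congr_ae (.of_forall fun z => Finset.prod_congr rfl fun r _ => ?_)
  have e1 : Fin.castAdd m r = e (Sum.inl r) := by simp [he]
  have e2 : Fin.natAdd n (σ r) = e (Sum.inr r) := by simp [he]
  simp only [e1, e2, Function.comp_apply, MeasurableEquiv.coe_piCongrLeft,
    Equiv.piCongrLeft_apply_apply]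
  rfl

end ProductIntegral

section Word

variable {d : ℕ} {A J ι : Type*} [NormedRing A] [StarRing A] [NormedAlgebra ℂ A]
  {α : Translations d A} {ω : StationaryState α}
  {ε : J → Momentum d → ℝ} {fermi : Set J} {κ : ι → J} {B : ι → A}

/-- The wave packet of a smeared operator `Bᵢ(f, τ)`, or of its adjoint. -/
noncomputable def wordPacket (ε : J → Momentum d → ℝ) (κ : ι → J) (c : ι × Bool)
    (f : 𝓢(Momentum d, ℂ)) (τ : ℝ) (x : Momentum d) : ℂ :=
  if c.2 then star (packet (ε (κ c.1)) f τ x) else packet (ε (κ c.1)) f τ x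

/-- A smeared operator `Bᵢ(f, τ)`, or its adjoint. -/
noncomputable def wordSmeared (α : Translations d A) (ε : J → Momentum d → ℝ) (κ : ι → J)
    (B : ι → A) (c : ι × Bool) (f : 𝓢(Momentum d, ℂ)) (τ : ℝ) : A :=
  if c.2 then star (smeared α (ε (κ c.1)) (B c.1) f τ) else smeared α (ε (κ c.1)) (B c.1) f τ

theorem norm_wordPacket (c : ι × Bool) (f : 𝓢(Momentum d, ℂ)) (τ : ℝ) (x : Momentum d) :
    ‖wordPacket ε κ c f τ x‖ = ‖packet (ε (κ c.1)) f τ x‖ := by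
  unfold wordPacket
  split_ifs <;> simp

/-- Products of truncated functions are bounded. In the cluster bound of each block a position is
compared with itself, which leaves a constant. -/
theorem exists_norm_prod_truncated_le (hcluster : StrongClusterProperty ω fermi κ B) {N : ℕ}
    (c : Fin N → ι × Bool) (s : Finset (Finset (Fin N))) (hs : ∅ ∉ s) :
    ∃ C, 0 ≤ C ∧ ∀ x : Fin N → Momentum d, ‖∏ b ∈ s, truncated {z | z.1.1 ∈ κ ⁻¹' fermi}
      (correlation ω B) ((b.sort (· ≤ ·)).map (letter c x))‖ ≤ C := by
  choose C hC0 hC using fun b => hcluster.exists_norm_truncated_block_le c b 0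
  refine ⟨∏ b ∈ s, C b, Finset.prod_nonneg fun b _ => hC0 b, fun x => ?_⟩
  rw [norm_prod]
  refine Finset.prod_le_prod (fun _ _ => norm_nonneg _) fun b hb => ?_
  obtain ⟨p, hp⟩ := Finset.nonempty_iff_ne_empty.2 fun h => hs (h ▸ hb)
  refine (hC b x p hp p hp).trans (mul_le_of_le_one_right (hC0 b) (inv_le_one_of_one_le₀ ?_))
  rw [pow_zero]
  norm_num

/-- The contribution of the partition `P` to the vacuum expectation value of a product of smeared
operators at equal times. -/
noncomputable def clusterTerm (ω : StationaryState α) (ε : J → Momentum d → ℝ) (fermi : Set J)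
    (κ : ι → J) (B : ι → A) {N : ℕ} (c : Fin N → ι × Bool) (f : Fin N → 𝓢(Momentum d, ℂ))
    (P : Finpartition (Finset.univ : Finset (Fin N))) (τ : ℝ) : ℂ :=
  ∫ x : Fin N → Momentum d, (∏ q, wordPacket ε κ (c q) (f q) τ (x q)) * ∏ b ∈ P.parts,
    truncated {z | z.1.1 ∈ κ ⁻¹' fermi} (correlation ω B) ((b.sort (· ≤ ·)).map (letter c x))

/-- A partition with a singleton block does not contribute, as the one-point functions vanish. -/
theorem clusterTerm_eq_zero (h0 : ∀ z, correlation ω B [z] = 0) {N : ℕ} (c : Fin N → ι × Bool)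
    (f : Fin N → 𝓢(Momentum d, ℂ)) {P : Finpartition (Finset.univ : Finset (Fin N))}
    {b : Finset (Fin N)} (hb : b ∈ P.parts) (h1 : b.card = 1) (τ : ℝ) :
    clusterTerm ω ε fermi κ B c f P τ = 0 := by
  obtain ⟨q, rfl⟩ := Finset.card_eq_one.1 h1
  refine integral_eq_zero_of_ae (.of_forall fun x => ?_)
  simp only
  rw [Finset.prod_eq_zero hb, mul_zero]
  · rfl
  · rw [Finset.sort_singleton, List.map_singleton, truncated_singleton, h0]

/-- The contribution of a partition vanishes asymptotically if some block contains two operators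
with disjoint sets of velocities: the wave packets separate linearly in time, and the truncated
function of the block is rapidly decreasing in the distance. -/
theorem tendsto_clusterTerm_zero (hε : ∀ j, ContDiff ℝ ((⊤ : ℕ∞) : WithTop ℕ∞) (ε j))
    (hcluster : StrongClusterProperty ω fermi κ B) {N : ℕ} (c : Fin N → ι × Bool)
    {f : Fin N → 𝓢(Momentum d, ℂ)} (hf : ∀ q, HasCompactSupport (f q))
    {P : Finpartition (Finset.univ : Finset (Fin N))} {b : Finset (Fin N)} (hb : b ∈ P.parts)
    {p q : Fin N} (hp : p ∈ b) (hq : q ∈ b) (hpq : p ≠ q)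
    (hdisj : Disjoint (gradient (ε (κ (c p).1)) '' tsupport (f p))
      (gradient (ε (κ (c q).1)) '' tsupport (f q))) :
    Filter.Tendsto (clusterTerm ω ε fermi κ B c f P) Filter.atBot (𝓝 0) := by
  classical
  -- The power `(d + 1) * N` compensates the growth of the other wave packets, the remaining power
  -- of the time is the decay of the contribution.
  choose Cw hCw0 hCw using fun r => exists_norm_packet_le_weight (hε (κ (c r).1)) (hf r)
  obtain ⟨C₁, L, hC₁0, hC₁⟩ := exists_norm_packet_mul_norm_packet_le_weight (hε (κ (c p).1))
    (hε (κ (c q).1)) (hf p) (hf q) hdisj ((d + 1) * N + 1)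
  obtain ⟨C₂, hC₂0, hC₂⟩ := hcluster.exists_norm_truncated_block_le c b L
  obtain ⟨C₃, hC₃0, hC₃⟩ := exists_norm_prod_truncated_le hcluster c (P.parts.erase b)
    fun h => P.bot_notMem (Finset.mem_of_mem_erase h)
  set R : Finset (Fin N) := (Finset.univ.erase p).erase q with hR
  have hqp : q ∈ Finset.univ.erase p := Finset.mem_erase.2 ⟨hpq.symm, Finset.mem_univ _⟩
  have hsplit : ∀ F : Fin N → ℝ, ∏ r, F r = F p * (F q * ∏ r ∈ R, F r) := fun F => by
    rw [hR, Finset.mul_prod_erase _ _ hqp, Finset.mul_prod_erase _ _ (Finset.mem_univ p)]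
  set C := C₁ * (∏ r ∈ R, Cw r) * C₂ * C₃ with hC
  have hCR : 0 ≤ ∏ r ∈ R, Cw r := Finset.prod_nonneg fun r _ => hCw0 r
  have hbound : ∀ τ (x : Fin N → Momentum d), ‖(∏ q, wordPacket ε κ (c q) (f q) τ (x q)) *
      ∏ b ∈ P.parts, truncated {z | z.1.1 ∈ κ ⁻¹' fermi} (correlation ω B)
        ((b.sort (· ≤ ·)).map (letter c x))‖ ≤ C * (1 + |τ|)⁻¹ * ∏ r, weight (x r) := by
    intro τ x
    have hW : 0 ≤ ∏ r ∈ R, weight (x r) := Finset.prod_nonneg fun r _ => weight_nonneg _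
    have h1 : ∏ r ∈ R, ‖wordPacket ε κ (c r) (f r) τ (x r)‖ ≤
        (∏ r ∈ R, Cw r) * (1 + |τ|) ^ ((d + 1) * N) * ∏ r ∈ R, weight (x r) := by
      calc _ ≤ ∏ r ∈ R, (Cw r * (1 + |τ|) ^ (d + 1) * weight (x r)) :=
            Finset.prod_le_prod (fun _ _ => norm_nonneg _) fun r _ => by
              rw [norm_wordPacket]
              exact hCw r τ (x r)
        _ = (∏ r ∈ R, Cw r) * (1 + |τ|) ^ ((d + 1) * R.card) * ∏ r ∈ R, weight (x r) := by
          rw [Finset.prod_mul_distrib, Finset.prod_mul_distrib, Finset.prod_const, pow_mul]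
        _ ≤ _ := by
          gcongr
          · linarith [abs_nonneg τ]
          · exact (Finset.card_le_univ R).trans_eq (Fintype.card_fin N)
    have h2 := hC₁ τ τ (x p) (x q) (by simp)
    have h3 := hC₂ x p hp q hq
    have h4 := hC₃ x
    rw [norm_mul, norm_prod, ← Finset.mul_prod_erase _ _ hb, norm_mul, hsplit, hsplit]
    rw [norm_wordPacket, norm_wordPacket]
    set a := ‖packet (ε (κ (c p).1)) (f p) τ (x p)‖
    set a' := ‖packet (ε (κ (c q).1)) (f q) τ (x q)‖
    have hpos : 0 < 1 + |τ| := by positivity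
    have hD : 0 ≤ (1 + ‖x p - x q‖ ^ L)⁻¹ := by positivity
    calc _ ≤ a * (a' * ((∏ r ∈ R, Cw r) * (1 + |τ|) ^ ((d + 1) * N) * ∏ r ∈ R, weight (x r))) *
          (C₂ * (1 + ‖x p - x q‖ ^ L)⁻¹ * C₃) := by gcongr
      _ = (a * a' * (1 + ‖x p - x q‖ ^ L)⁻¹ * (1 + |τ|) ^ ((d + 1) * N + 1)) *
          ((∏ r ∈ R, Cw r) * C₂ * C₃ * (∏ r ∈ R, weight (x r)) * (1 + |τ|)⁻¹) := by
        rw [pow_succ]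
        field_simp
      _ ≤ (C₁ * (weight (x p) * weight (x q))) *
          ((∏ r ∈ R, Cw r) * C₂ * C₃ * (∏ r ∈ R, weight (x r)) * (1 + |τ|)⁻¹) := by
        gcongr
      _ = _ := by rw [hC]; ring
  have hWint : Integrable fun x : Fin N → Momentum d => ∏ r, weight (x r) :=
    Integrable.fintype_prod fun _ => integrable_weight
  have hle : ∀ τ, ‖clusterTerm ω ε fermi κ B c f P τ‖ ≤
      C * (∫ x : Fin N → Momentum d, ∏ r, weight (x r)) * ((1 + |τ|) ^ 1)⁻¹ := fun τ => by
    refine (norm_integral_le_of_norm_le (hWint.const_mul _)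
      (.of_forall fun x => hbound τ x)).trans_eq ?_
    rw [integral_const_mul, pow_one]
    ring
  refine squeeze_zero_norm hle ?_
  simpa using tendsto_inv_one_add_abs_atBot.const_mul
    (C * (∫ x : Fin N → Momentum d, ∏ r, weight (x r)))

variable [NormedStarGroup A]

theorem continuous_wordPacket (hε : ∀ j, ContDiff ℝ ((⊤ : ℕ∞) : WithTop ℕ∞) (ε j)) (c : ι × Bool)
    {f : 𝓢(Momentum d, ℂ)} (hf : HasCompactSupport f) (τ : ℝ) :
    Continuous (wordPacket ε κ c f τ) := by
  unfold wordPacket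
  have h := continuous_packet (hε (κ c.1)) hf τ
  split_ifs
  · exact h.star
  · exact h

theorem integrable_wordPacket (hε : ∀ j, ContDiff ℝ ((⊤ : ℕ∞) : WithTop ℕ∞) (ε j)) (c : ι × Bool)
    {f : 𝓢(Momentum d, ℂ)} (hf : HasCompactSupport f) (τ : ℝ) :
    Integrable (wordPacket ε κ c f τ) :=
  (integrable_packet (hε (κ c.1)) hf τ).mono
    (continuous_wordPacket hε c hf τ).aestronglyMeasurable
    (.of_forall fun x => (norm_wordPacket c f τ x).le)

theorem integrable_wordPacket_smul (hε : ∀ j, ContDiff ℝ ((⊤ : ℕ∞) : WithTop ℕ∞) (ε j))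
    (hB : ∀ i, Continuous fun p : Momentum d × ℝ => α.toFun p.1 p.2 (B i)) (c : ι × Bool)
    {f : 𝓢(Momentum d, ℂ)} (hf : HasCompactSupport f) (τ : ℝ) :
    Integrable fun x => wordPacket ε κ c f τ x • fieldAt α B (c, x, τ) := by
  refine ((integrable_wordPacket (κ := κ) hε c hf τ).norm.mul_const ‖B c.1‖).mono' ?_
    (.of_forall fun x => ?_)
  · exact ((continuous_wordPacket hε c hf τ).smul (continuous_fieldAt hB c τ)).aestronglyMeasurable
  · rw [norm_smul, norm_fieldAt]

theorem wordSmeared_eq_integral [StarModule ℂ A] [CompleteSpace A]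
    (hε : ∀ j, ContDiff ℝ ((⊤ : ℕ∞) : WithTop ℕ∞) (ε j))
    (hB : ∀ i, Continuous fun p : Momentum d × ℝ => α.toFun p.1 p.2 (B i)) (c : ι × Bool)
    {f : 𝓢(Momentum d, ℂ)} (hf : HasCompactSupport f) (τ : ℝ) :
    wordSmeared α ε κ B c f τ = ∫ x, wordPacket ε κ c f τ x • fieldAt α B (c, x, τ) := by
  rcases c with ⟨i, _ | _⟩
  · simp [wordSmeared, wordPacket, fieldAt, smeared]
  · simp only [wordSmeared, wordPacket, fieldAt, smeared, if_true]
    have h := (starL ℂ : A ≃L⋆[ℂ] A).toContinuousLinearMap.integral_comp_commSL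
      (fun c x => by simp) (integrable_packet_smul (hε (κ i)) hf (hB i) τ)
    refine h.symm.trans (integral_congr_ae (.of_forall fun x => ?_))
    simp [map_star]

theorem integrable_clusterTerm (hε : ∀ j, ContDiff ℝ ((⊤ : ℕ∞) : WithTop ℕ∞) (ε j))
    (hB : ∀ i, Continuous fun p : Momentum d × ℝ => α.toFun p.1 p.2 (B i))
    (hcluster : StrongClusterProperty ω fermi κ B) {N : ℕ} (c : Fin N → ι × Bool)
    {f : Fin N → 𝓢(Momentum d, ℂ)} (hf : ∀ q, HasCompactSupport (f q))
    (P : Finpartition (Finset.univ : Finset (Fin N))) (τ : ℝ) :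
    Integrable fun x : Fin N → Momentum d => (∏ q, wordPacket ε κ (c q) (f q) τ (x q)) *
      ∏ b ∈ P.parts, truncated {z | z.1.1 ∈ κ ⁻¹' fermi} (correlation ω B)
        ((b.sort (· ≤ ·)).map (letter c x)) := by
  obtain ⟨C, hC0, hC⟩ := exists_norm_prod_truncated_le hcluster c P.parts P.bot_notMem
  have h1 : Integrable fun x : Fin N → Momentum d => ∏ q, wordPacket ε κ (c q) (f q) τ (x q) :=
    Integrable.fintype_prod fun q => integrable_wordPacket hε (c q) (hf q) τ
  refine h1.mul_bdd (c := C) ?_ (.of_forall hC)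
  exact (continuous_finsetProd _ fun b _ =>
    continuous_truncated_block ω hB (κ ⁻¹' fermi) c b).aestronglyMeasurable

/-- The vacuum expectation of a product of smeared operators at a common time `τ` is the integral of
the correlation function at time zero; the time enters through the wave packets alone. -/
theorem map_prod_wordSmeared [StarModule ℂ A] [CompleteSpace A]
    (hε : ∀ j, ContDiff ℝ ((⊤ : ℕ∞) : WithTop ℕ∞) (ε j))
    (hB : ∀ i, Continuous fun p : Momentum d × ℝ => α.toFun p.1 p.2 (B i)) {N : ℕ}
    (c : Fin N → ι × Bool) {f : Fin N → 𝓢(Momentum d, ℂ)} (hf : ∀ q, HasCompactSupport (f q))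
    (τ : ℝ) :
    ω.toCLM (List.ofFn fun q => wordSmeared α ε κ B (c q) (f q) τ).prod =
      ∫ x : Fin N → Momentum d, (∏ q, wordPacket ε κ (c q) (f q) τ (x q)) *
        correlation ω B (List.ofFn (letter c x)) := by
  have hint := fun q => integrable_wordPacket_smul (κ := κ) hε hB (c q) (hf q) τ
  obtain ⟨h1, h2⟩ := integrable_integral_prod_ofFn _ hint
  simp only [fun q => wordSmeared_eq_integral (κ := κ) hε hB (c q) (hf q) τ]
  rw [← h2]
  refine (ω.toCLM.integral_comp_comm h1).symm.trans (integral_congr_ae (.of_forall fun x => ?_))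
  simp only
  rw [← correlation_equalTime ω B c x τ]
  have hsm : ∀ (M : ℕ) (k : Fin M → ℂ) (a : Fin M → A),
      (List.ofFn fun q => k q • a q).prod = (∏ q, k q) • (List.ofFn a).prod := by
    intro M
    induction M with
    | zero => simp
    | succ M ih =>
      intro k a
      simp only [List.ofFn_succ, List.prod_cons, ih, Fin.prod_univ_succ, smul_mul_smul_comm]
  rw [hsm, map_smul, smul_eq_mul]

open Classical in
/-- The cluster expansion of the vacuum expectation of a product of smeared operators. -/
theorem map_prod_wordSmeared_eq_sum [StarModule ℂ A] [CompleteSpace A]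
    (hε : ∀ j, ContDiff ℝ ((⊤ : ℕ∞) : WithTop ℕ∞) (ε j))
    (hB : ∀ i, Continuous fun p : Momentum d × ℝ => α.toFun p.1 p.2 (B i))
    (hcluster : StrongClusterProperty ω fermi κ B) {N : ℕ} (hN : 0 < N)
    (c : Fin N → ι × Bool) {f : Fin N → 𝓢(Momentum d, ℂ)} (hf : ∀ q, HasCompactSupport (f q))
    (τ : ℝ) :
    ω.toCLM (List.ofFn fun q => wordSmeared α ε κ B (c q) (f q) τ).prod =
      ∑ P : Finpartition (Finset.univ : Finset (Fin N)),
        wordSign {q | κ (c q).1 ∈ fermi} id P * clusterTerm ω ε fermi κ B c f P τ := by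
  rw [map_prod_wordSmeared hε hB c hf]
  simp only [fun x => eq_sum_truncated {z | z.1.1 ∈ κ ⁻¹' fermi} (correlation ω B) hN (letter c x),
    Finset.mul_sum]
  rw [integral_finsetSum]
  · refine Finset.sum_congr rfl fun P _ => ?_
    rw [clusterTerm, ← integral_const_mul]
    refine integral_congr_ae (.of_forall fun x => ?_)
    exact mul_left_comm _ _ _
  · intro P _
    have := (integrable_clusterTerm hε hB hcluster c hf P τ).const_mul
      (wordSign {q | κ (c q).1 ∈ fermi} id P)
    refine this.congr (.of_forall fun x => ?_)
    exact mul_left_comm _ _ _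

/-- The contribution of a partition into pairs is the product of the two-point functions. -/
theorem clusterTerm_pairing [StarModule ℂ A] [CompleteSpace A]
    (hε : ∀ j, ContDiff ℝ ((⊤ : ℕ∞) : WithTop ℕ∞) (ε j))
    (hB : ∀ i, Continuous fun p : Momentum d × ℝ => α.toFun p.1 p.2 (B i))
    (h0 : ∀ z, correlation ω B [z] = 0) {n m : ℕ} (σ : Fin n ≃ Fin m)
    (c : Fin (n + m) → ι × Bool) {f : Fin (n + m) → 𝓢(Momentum d, ℂ)}
    (hf : ∀ q, HasCompactSupport (f q)) (τ : ℝ) :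
    clusterTerm ω ε fermi κ B c f (pairing σ) τ =
      ∏ r, ω.toCLM (wordSmeared α ε κ B (c (Fin.castAdd m r)) (f (Fin.castAdd m r)) τ *
        wordSmeared α ε κ B (c (Fin.natAdd n (σ r))) (f (Fin.natAdd n (σ r))) τ) := by
  have hpair : ∀ r, ω.toCLM (wordSmeared α ε κ B (c (Fin.castAdd m r)) (f (Fin.castAdd m r)) τ *
        wordSmeared α ε κ B (c (Fin.natAdd n (σ r))) (f (Fin.natAdd n (σ r))) τ) =
      ∫ z : Momentum d × Momentum d,
        wordPacket ε κ (c (Fin.castAdd m r)) (f (Fin.castAdd m r)) τ z.1 *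
          wordPacket ε κ (c (Fin.natAdd n (σ r))) (f (Fin.natAdd n (σ r))) τ z.2 *
          correlation ω B [(c (Fin.castAdd m r), z.1, 0), (c (Fin.natAdd n (σ r)), z.2, 0)] := by
    intro r
    have h := map_prod_wordSmeared (ω := ω) (κ := κ) hε hB
      ![c (Fin.castAdd m r), c (Fin.natAdd n (σ r))]
      (f := ![f (Fin.castAdd m r), f (Fin.natAdd n (σ r))])
      (fun q => by fin_cases q <;> simp [hf]) τ
    simp only [List.ofFn_succ, List.ofFn_zero, List.prod_cons, List.prod_nil, mul_one,
      Fin.prod_univ_two, letter] at h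
    refine h.trans ?_
    rw [← (volume_preserving_finTwoArrow (Momentum d)).integral_comp
      (MeasurableEquiv.measurableEmbedding _)]
    rfl
  simp only [hpair]
  rw [← integral_prod_pairs σ fun r x y =>
    wordPacket ε κ (c (Fin.castAdd m r)) (f (Fin.castAdd m r)) τ x *
      wordPacket ε κ (c (Fin.natAdd n (σ r))) (f (Fin.natAdd n (σ r))) τ y *
      correlation ω B [(c (Fin.castAdd m r), x, 0), (c (Fin.natAdd n (σ r)), y, 0)]]
  refine integral_congr_ae (.of_forall fun x => ?_)
  simp only
  rw [Finset.prod_mul_distrib, Finset.prod_mul_distrib, Fin.prod_univ_add, pairing_parts,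
    Finset.prod_image (pairBlock_injective σ).injOn,
    ← Equiv.prod_comp σ fun b => wordPacket ε κ (c (Fin.natAdd n b)) (f (Fin.natAdd n b)) τ
      (x (Fin.natAdd n b))]
  congr 1
  refine Finset.prod_congr rfl fun r _ => ?_
  rw [sort_pairBlock]
  exact truncated_pair _ _ h0 _ _

end Word

/-! ### Scalar products of in-states -/

section InnerInStates

theorem star_prod_ofFn {R : Type*} [Monoid R] [StarMul R] {n : ℕ} (a : Fin n → R) :
    star (List.ofFn a).prod = (List.ofFn fun r : Fin n => star (a r.rev)).prod := by
  have h : ∀ l : List R, star l.prod = (l.map star).reverse.prod := fun l => by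
    induction l with
    | nil => simp
    | cons x l ih => simp [ih]
  rw [h]
  congr 1
  refine List.ext_getElem (by simp) fun k h1 h2 => ?_
  simp only [List.getElem_reverse, List.getElem_map, List.getElem_ofFn, List.length_map,
    List.length_ofFn]
  congr 2
  ext
  simp [Fin.rev]
  omega

variable {d : ℕ} {A J ι : Type*} [NormedRing A] [StarRing A] [NormedStarGroup A]
  [NormedAlgebra ℂ A] [StarModule ℂ A] [CompleteSpace A] {α : Translations d A}
  {ω : StationaryState α} {ε : J → Momentum d → ℝ} {fermi : Set J} {κ : ι → J}
  {φ : ι → 𝓢(Momentum d, ℂ)} {B : ι → A}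

theorem correlation_singleton (hd : 0 < d) (Φ : ElementaryExcitation ω ε)
    (hε : ∀ j, ContDiff ℝ ((⊤ : ℕ∞) : WithTop ℕ∞) (ε j))
    (hB : ∀ i, gnsVec ω.toState (B i) = Φ.toFun (κ i) (φ i))
    (hBc : ∀ i, Continuous fun p : Momentum d × ℝ => α.toFun p.1 p.2 (B i))
    (z : (ι × Bool) × (Momentum d × ℝ)) : correlation ω B [z] = 0 := by
  have h := map_eq_zero_of_gnsVec_eq hd Φ hε (hB z.1.1) (hBc z.1.1)
  simp only [correlation, List.map_singleton, List.prod_singleton, fieldAt]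
  rw [ω.invariant]
  split_ifs
  · rw [ω.map_star, h, star_zero]
  · exact h

theorem map_star_smeared_mul_smeared (Φ : ElementaryExcitation ω ε)
    (hε : ∀ j, ContDiff ℝ ((⊤ : ℕ∞) : WithTop ℕ∞) (ε j))
    (hB : ∀ i, gnsVec ω.toState (B i) = Φ.toFun (κ i) (φ i))
    (hBc : ∀ i, Continuous fun p : Momentum d × ℝ => α.toFun p.1 p.2 (B i)) (i i' : ι)
    {f f' : 𝓢(Momentum d, ℂ)} (hf : HasCompactSupport f) (hf' : HasCompactSupport f') (τ : ℝ) :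
    ω.toCLM (star (smeared α (ε (κ i)) (B i) f τ) * smeared α (ε (κ i')) (B i') f' τ) =
      ⟪Φ.toFun (κ i) (schwartzMul f (φ i)), Φ.toFun (κ i') (schwartzMul f' (φ i'))⟫_ℂ := by
  rw [← inner_gnsVec, gnsVec_smeared Φ hε (hB i) (hBc i) hf,
    gnsVec_smeared Φ hε (hB i') (hBc i') hf']

/-- The scalar products of in-states are given by the same sum over permutations as those of Fock
vectors: of the cluster expansion, only the partitions into pairs survive. -/
theorem tendsto_inner_scatteringVec (hd : 0 < d) (Φ : ElementaryExcitation ω ε)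
    (hε : ∀ j, ContDiff ℝ ((⊤ : ℕ∞) : WithTop ℕ∞) (ε j))
    (hB : ∀ i, gnsVec ω.toState (B i) = Φ.toFun (κ i) (φ i))
    (hBc : ∀ i, Continuous fun p : Momentum d × ℝ => α.toFun p.1 p.2 (B i))
    (hcluster : StrongClusterProperty ω fermi κ B) {n m : ℕ} {i : Fin n → ι} {i' : Fin m → ι}
    {f : Fin n → 𝓢(Momentum d, ℂ)} {f' : Fin m → 𝓢(Momentum d, ℂ)}
    (hf : NonOverlapping ε (fun a => κ (i a)) f) (hf' : NonOverlapping ε (fun a => κ (i' a)) f') :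
    Filter.Tendsto (fun τ => ⟪scatteringVec ω ε κ B i f fun _ => τ,
        scatteringVec ω ε κ B i' f' fun _ => τ⟫_ℂ) Filter.atBot
      (𝓝 (∑ σ : Fin n ≃ Fin m, permSign fermi (fun a => κ (i a)) σ *
        ∏ a, ⟪Φ.toFun (κ (i a)) (schwartzMul (f a) (φ (i a))),
          Φ.toFun (κ (i' (σ a))) (schwartzMul (f' (σ a)) (φ (i' (σ a))))⟫_ℂ)) := by
  classical
  set c : Fin (n + m) → ι × Bool :=
    Fin.append (fun r : Fin n => (i r.rev, true)) fun b => (i' b, false) with hc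
  set F : Fin (n + m) → 𝓢(Momentum d, ℂ) := Fin.append (fun r : Fin n => f r.rev) f' with hF
  have hFc : ∀ q, HasCompactSupport (F q) := by
    intro q
    refine Fin.addCases (fun r => ?_) (fun b => ?_) q
    · simpa [hF] using hf.1 r.rev
    · simpa [hF] using hf'.1 b
  have hword : ∀ τ, ⟪scatteringVec ω ε κ B i f fun _ => τ,
      scatteringVec ω ε κ B i' f' fun _ => τ⟫_ℂ =
        ω.toCLM (List.ofFn fun q => wordSmeared α ε κ B (c q) (F q) τ).prod := by
    intro τ
    have : (fun q => wordSmeared α ε κ B (c q) (F q) τ) =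
        Fin.append (fun r : Fin n => star (smeared α (ε (κ (i r.rev))) (B (i r.rev)) (f r.rev) τ))
          fun b => smeared α (ε (κ (i' b))) (B (i' b)) (f' b) τ := by
      funext q
      refine Fin.addCases (fun r => ?_) (fun b => ?_) q <;> simp [hc, hF, wordSmeared]
    rw [this, List.ofFn_fin_append, List.prod_append, scatteringVec, scatteringVec, inner_gnsVec,
      star_prod_ofFn]
  simp only [hword]
  rcases Nat.eq_zero_or_pos (n + m) with h0 | hN
  · obtain ⟨rfl, rfl⟩ : n = 0 ∧ m = 0 := by omega
    simp [permSign, ω.map_one]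
  simp only [map_prod_wordSmeared_eq_sum hε hBc hcluster hN c hFc]
  have hsing := correlation_singleton hd Φ hε hB hBc
  set e : (Fin n ≃ Fin m) → Finpartition (Finset.univ : Finset (Fin (n + m))) :=
    fun σ => pairing (Fin.revPerm.trans σ) with he
  have hinj : Function.Injective e := by
    intro σ σ' h
    refine Equiv.ext fun a => ?_
    have := congrArg (fun ρ : Fin n ≃ Fin m => ρ a.rev) (pairing_injective h)
    simpa using this
  have hterm : ∀ σ τ, wordSign {q | κ (c q).1 ∈ fermi} id (e σ) *
      clusterTerm ω ε fermi κ B c F (e σ) τ =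
        permSign fermi (fun a => κ (i a)) σ *
        ∏ a, ⟪Φ.toFun (κ (i a)) (schwartzMul (f a) (φ (i a))),
          Φ.toFun (κ (i' (σ a))) (schwartzMul (f' (σ a)) (φ (i' (σ a))))⟫_ℂ := by
    intro σ τ
    have h1 : clusterTerm ω ε fermi κ B c F (e σ) τ =
        ∏ a, ⟪Φ.toFun (κ (i a)) (schwartzMul (f a) (φ (i a))),
          Φ.toFun (κ (i' (σ a))) (schwartzMul (f' (σ a)) (φ (i' (σ a))))⟫_ℂ := by
      rw [he, clusterTerm_pairing hε hBc hsing _ c hFc, ← Equiv.prod_comp Fin.revPerm]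
      refine Finset.prod_congr rfl fun a _ => ?_
      simp only [hc, hF, Fin.append_left, Fin.append_right, wordSmeared, if_true,
        Bool.false_eq_true, if_false, Fin.revPerm_apply, Fin.rev_rev, Equiv.trans_apply]
      exact map_star_smeared_mul_smeared Φ hε hB hBc _ _ (hf.1 _) (hf'.1 _) τ
    rw [h1]
    by_cases hk : ∀ a, κ (i a) = κ (i' (σ a))
    · rw [wordSign_pairing (fermi := fermi) (k := fun a => κ (i a)) (k' := fun a => κ (i' a))
        (fun r => by simp [hc]) (fun r => by simp [hc]) σ hk]
    · obtain ⟨a, ha⟩ := not_forall.1 hk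
      rw [Finset.prod_eq_zero (Finset.mem_univ a) (by rw [Φ.inner_eq, if_neg ha]), mul_zero,
        mul_zero]
  set Lim : Finpartition (Finset.univ : Finset (Fin (n + m))) → ℂ := fun P =>
    if P ∈ Set.range e then wordSign {q | κ (c q).1 ∈ fermi} id P *
      clusterTerm ω ε fermi κ B c F P 0 else 0 with hLim
  rw [Fintype.sum_of_injective e hinj _ Lim (fun P hP => if_neg hP) fun σ => by
    rw [hLim]
    simp only [Set.mem_range_self, if_true]
    exact (hterm σ 0).symm]
  refine tendsto_finsetSum _ fun P _ => ?_
  by_cases hP : P ∈ Set.range e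
  · obtain ⟨σ, rfl⟩ := hP
    simp only [hLim, Set.mem_range_self, if_true, hterm]
    exact tendsto_const_nhds
  rw [hLim]
  simp only [if_neg hP]
  by_cases h1 : ∃ b ∈ P.parts, b.card = 1
  · obtain ⟨b, hb, hb1⟩ := h1
    simp only [clusterTerm_eq_zero hsing c F hb hb1, mul_zero]
    exact tendsto_const_nhds
  have hdisj : ∃ b ∈ P.parts, ∃ p q, p ∈ b ∧ q ∈ b ∧ p ≠ q ∧
      Disjoint (gradient (ε (κ (c p).1)) '' tsupport (F p))
        (gradient (ε (κ (c q).1)) '' tsupport (F q)) := by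
    by_contra! h
    push Not at h1
    obtain ⟨ρ, hρ⟩ := exists_eq_pairing h1
      (fun b hb r r' hr hr' => by
        by_contra hne
        refine h b hb _ _ hr hr' (fun h => hne (by simpa using h)) ?_
        simp only [hc, hF, Fin.append_left]
        exact hf.2 fun h => hne (Fin.rev_injective h))
      (fun b hb r r' hr hr' => by
        by_contra hne
        refine h b hb _ _ hr hr' (fun h => hne (by simpa using h)) ?_
        simp only [hc, hF, Fin.append_right]
        exact hf'.2 hne)
    refine hP ⟨Fin.revPerm.trans ρ, ?_⟩
    rw [← hρ, he]
    simp only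
    congr 1
    ext a
    simp
  obtain ⟨b, hb, p, q, hp, hq, hpq, hdis⟩ := hdisj
  simpa using (tendsto_clusterTerm_zero hε hcluster c hFc hb hp hq hpq hdis).const_mul
    (wordSign {q | κ (c q).1 ∈ fermi} id P)

end InnerInStates

section InStates

variable {d : ℕ} {A J ι : Type*} [NormedRing A] [StarRing A] [NormedStarGroup A]
  [NormedAlgebra ℂ A] [StarModule ℂ A] [CompleteSpace A] {α : Translations d A}
  {ω : StationaryState α} {ε : J → Momentum d → ℝ} {fermi : Set J} {κ : ι → J}
  {φ : ι → 𝓢(Momentum d, ℂ)} {B : ι → A}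

theorem isCreator_smeared (Φ : ElementaryExcitation ω ε)
    (hε : ∀ j, ContDiff ℝ ((⊤ : ℕ∞) : WithTop ℕ∞) (ε j)) (i : ι)
    (hB : gnsVec ω.toState (B i) = Φ.toFun (κ i) (φ i))
    (hBc : Continuous fun p : Momentum d × ℝ => α.toFun p.1 p.2 (B i)) {f : 𝓢(Momentum d, ℂ)}
    (hf : HasCompactSupport f) : IsCreator ω.toState (smeared α (ε (κ i)) (B i) f) where
  norm_le := by
    obtain ⟨C, hC1, hC⟩ := exists_norm_smeared_le (α := α) (hε (κ i)) hf (B i)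
    exact ⟨C, d + 1, hC1, hC⟩
  vec_eq s t := by rw [gnsVec_smeared Φ hε hB hBc hf, gnsVec_smeared Φ hε hB hBc hf]

theorem rapidlyCommute_smeared (hε : ∀ j, ContDiff ℝ ((⊤ : ℕ∞) : WithTop ℕ∞) (ε j))
    (hBc : ∀ i, Continuous fun p : Momentum d × ℝ => α.toFun p.1 p.2 (B i))
    (hcomm : AsymptoticallyCommuting ω fermi κ B) (i l : ι) {f g : 𝓢(Momentum d, ℂ)}
    (hf : HasCompactSupport f) (hg : HasCompactSupport g)
    (hfg : Disjoint (gradient (ε (κ i)) '' tsupport f) (gradient (ε (κ l)) '' tsupport g)) :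
    RapidlyCommute ω.toState (smeared α (ε (κ i)) (B i) f) (smeared α (ε (κ l)) (B l) g) :=
  ⟨exchangeSign fermi (κ i) (κ l), (norm_exchangeSign _ _ _).le,
    exists_norm_commutator_smeared_le hcomm hBc hε i l hf hg hfg⟩

end InStates

/-! ### Products of creation operators in Fock space -/

section PermSign

variable {J : Type*} {fermi : Set J}

theorem star_permSign {n m : ℕ} (k : Fin n → J) (σ : Fin n ≃ Fin m) :
    star (permSign fermi k σ) = permSign fermi k σ := by
  simp only [permSign, star_prod]
  refine Finset.prod_congr rfl fun a _ => Finset.prod_congr rfl fun b _ => ?_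
  unfold exchangeSign
  split_ifs <;> simp

theorem norm_permSign {n m : ℕ} (k : Fin n → J) (σ : Fin n ≃ Fin m) :
    ‖permSign fermi k σ‖ = 1 := by
  simp only [permSign, norm_prod]
  refine Finset.prod_eq_one fun a _ => Finset.prod_eq_one fun b _ => ?_
  split_ifs
  · exact norm_exchangeSign _ _ _
  · simp

theorem permSign_mul_self {n m : ℕ} (k : Fin n → J) (σ : Fin n ≃ Fin m) :
    permSign fermi k σ * permSign fermi k σ = 1 := by
  simp only [permSign, ← Finset.prod_mul_distrib]
  refine Finset.prod_eq_one fun a _ => Finset.prod_eq_one fun b _ => ?_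
  split_ifs
  · exact exchangeSign_mul_self _ _ _
  · simp

/-- A product over ordered pairs, rearranged as a product over unordered pairs. -/
theorem prod_prod_eq_prod_lt {n : ℕ} (H : Fin n → Fin n → ℂ) (hH : ∀ a, H a a = 1) :
    ∏ a, ∏ b, H a b = ∏ a, ∏ b, if a < b then H a b * H b a else 1 := by
  have h1 : ∀ a b, H a b = (if a < b then H a b else 1) * if b < a then H a b else 1 := by
    intro a b
    rcases lt_trichotomy a b with h | h | h
    · simp [h, h.not_gt]
    · simp [h, hH]
    · simp [h, h.not_gt]
  have h2 : ∏ a, ∏ b, H a b = (∏ a, ∏ b, if a < b then H a b else 1) *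
      ∏ a, ∏ b, if b < a then H a b else 1 := by
    simp only [← Finset.prod_mul_distrib]
    exact Finset.prod_congr rfl fun a _ => Finset.prod_congr rfl fun b _ => h1 a b
  rw [h2, Finset.prod_comm (f := fun a b => if b < a then H a b else 1)]
  simp only [← Finset.prod_mul_distrib]
  refine Finset.prod_congr rfl fun a _ => Finset.prod_congr rfl fun b _ => ?_
  split_ifs <;> simp

/-- The sign of a composition of permutations: each pair of particles is interchanged by the
composition if it is interchanged by exactly one of the factors. -/
theorem permSign_trans {n m l : ℕ} (k : Fin n → J) (τ : Fin n ≃ Fin m) (ρ : Fin m ≃ Fin l) :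
    permSign fermi k (τ.trans ρ) =
      permSign fermi k τ * permSign fermi (fun c => k (τ.symm c)) ρ := by
  have h : permSign fermi (fun c => k (τ.symm c)) ρ =
      ∏ a, ∏ b, if τ a < τ b ∧ ρ (τ b) < ρ (τ a) then exchangeSign fermi (k a) (k b) else 1 := by
    rw [permSign, ← Equiv.prod_comp τ]
    refine Finset.prod_congr rfl fun a _ => ?_
    rw [← Equiv.prod_comp τ]
    simp
  rw [h, prod_prod_eq_prod_lt _ (by simp), permSign, permSign]
  simp only [← Finset.prod_mul_distrib]
  refine Finset.prod_congr rfl fun a _ => Finset.prod_congr rfl fun b _ => ?_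
  by_cases hab : a < b
  · rw [exchangeSign_comm fermi (k b) (k a)]
    rcases lt_or_gt_of_ne (fun h => hab.ne (τ.injective h)) with h1 | h1 <;>
      rcases lt_or_gt_of_ne (fun h => hab.ne (τ.injective (ρ.injective h))) with h2 | h2 <;>
        simp [hab, h1, h1.not_gt, h2, h2.not_gt, exchangeSign_mul_self]
  · simp [hab]

/-- The permutation which puts `m` in front of the permutation `σ` of the remaining indices. -/
noncomputable def consPerm {n : ℕ} (m : Fin (n + 1)) (σ : Equiv.Perm (Fin n)) :
    Equiv.Perm (Fin (n + 1)) :=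
  Equiv.ofBijective (Fin.cons m fun l => m.succAbove (σ l)) (Finite.injective_iff_bijective.1
    (Fin.cons_injective_iff.2 ⟨by
      rintro ⟨l, hl⟩
      exact Fin.succAbove_ne m _ hl, (Fin.succAbove_right_injective).comp σ.injective⟩))

theorem consPerm_zero {n : ℕ} (m : Fin (n + 1)) (σ : Equiv.Perm (Fin n)) :
    consPerm m σ 0 = m := rfl

theorem consPerm_succ {n : ℕ} (m : Fin (n + 1)) (σ : Equiv.Perm (Fin n)) (l : Fin n) :
    consPerm m σ l.succ = m.succAbove (σ l) := rfl

theorem bijective_consPerm (n : ℕ) : Function.Bijective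
    fun p : Fin (n + 1) × Equiv.Perm (Fin n) => consPerm p.1 p.2 := by
  refine (Fintype.bijective_iff_injective_and_card _).2 ⟨?_, ?_⟩
  · rintro ⟨m, σ⟩ ⟨m', σ'⟩ h
    simp only at h
    have h0 := congrArg (fun ρ : Equiv.Perm (Fin (n + 1)) => ρ 0) h
    simp only [consPerm_zero] at h0
    subst h0
    refine Prod.ext rfl (Equiv.ext fun l => ?_)
    have hl := congrArg (fun ρ : Equiv.Perm (Fin (n + 1)) => ρ l.succ) h
    simp only [consPerm_succ] at hl
    exact Fin.succAbove_right_injective hl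
  · simp [Fintype.card_perm, Nat.factorial_succ]

/-- Moving the particle `m` to the front passes it through the particles before it, which is the
sign in the definition of the creation operator. -/
theorem permSign_consPerm {n : ℕ} (k : Fin (n + 1) → J) (m : Fin (n + 1))
    (σ : Equiv.Perm (Fin n)) :
    permSign fermi (fun a => k (consPerm m σ a)) (consPerm m σ) =
      (∏ l ∈ Finset.Iio m, exchangeSign fermi (k l) (k m)) *
        permSign fermi (fun a => k (m.succAbove (σ a))) σ := by
  have h1 : ∏ l ∈ Finset.Iio m, exchangeSign fermi (k l) (k m) =
      ∏ l : Fin n, if m.succAbove (σ l) < m then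
        exchangeSign fermi (k m) (k (m.succAbove (σ l))) else 1 := by
    rw [Equiv.prod_comp σ fun l => if m.succAbove l < m then
      exchangeSign fermi (k m) (k (m.succAbove l)) else 1]
    have h2 := Fin.prod_univ_succAbove
      (fun l => if l < m then exchangeSign fermi (k m) (k l) else 1) m
    rw [if_neg (lt_irrefl m), one_mul] at h2
    rw [← h2, ← Finset.prod_filter]
    refine Finset.prod_congr (by ext; simp) fun l _ => exchangeSign_comm _ _ _
  rw [h1, permSign, Fin.prod_univ_succ]
  simp only [Fin.prod_univ_succ, consPerm_zero, consPerm_succ, lt_self_iff_false, false_and,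
    if_false, one_mul, Fin.succ_pos, true_and, Fin.not_lt_zero, Fin.succ_lt_succ_iff,
    (Fin.strictMono_succAbove m).lt_iff_lt]
  rfl

end PermSign

section FockFun

variable {d : ℕ} {J : Type*} {fermi : Set J}

/-- The wave function of `b⁺(g₁) ⋯ b⁺(gₙ) |0⟩`, as a sum over all permutations. -/
noncomputable def fockFun (fermi : Set J) {n : ℕ} (g : Fin n → Momentum d × J → ℂ)
    (x : Fin n → Momentum d × J) : ℂ :=
  ((√(n.factorial : ℝ))⁻¹ : ℝ) * ∑ σ : Equiv.Perm (Fin n),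
    permSign fermi (fun a => (x (σ a)).2) σ * ∏ a, g a (x (σ a))

/-- Every permutation of `n + 1` particles arises in exactly one way by choosing the first particle
and permuting the others; the normalization factors `(n + 1)^{-1/2}` and `(n!)^{-1/2}` multiply. -/
theorem creationFun_fockFun {n : ℕ} (g : Fin (n + 1) → Momentum d × J → ℂ)
    (x : Fin (n + 1) → Momentum d × J) :
    creationFun fermi (g 0) (fockFun fermi fun a => g a.succ) x = fockFun fermi g x := by
  rw [creationFun, fockFun, ← (bijective_consPerm n).sum_comp, Fintype.sum_prod_type]
  have hs : ((√((n + 1).factorial : ℝ))⁻¹ : ℝ) = (√(n + 1 : ℝ))⁻¹ * (√(n.factorial : ℝ))⁻¹ := by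
    rw [Nat.factorial_succ, Nat.cast_mul, Real.sqrt_mul (by positivity), mul_inv]
    push_cast
    rfl
  rw [hs, Complex.ofReal_mul, mul_assoc]
  congr 1
  rw [Finset.mul_sum]
  refine Finset.sum_congr rfl fun m _ => ?_
  rw [fockFun, Finset.mul_sum, Finset.mul_sum, Finset.mul_sum, Finset.mul_sum]
  refine Finset.sum_congr rfl fun σ _ => ?_
  rw [permSign_consPerm (fun a => (x a).2), Fin.prod_univ_succ]
  simp only [consPerm_zero, consPerm_succ]
  ring

/-- On functions `gₐ` supported at the kinds `kₐ` the sign does not depend on the momenta. -/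
theorem fockFun_of_support {n : ℕ} {g : Fin n → Momentum d × J → ℂ} {k : Fin n → J}
    (hg : ∀ a x, g a x ≠ 0 → x.2 = k a) (x : Fin n → Momentum d × J) :
    fockFun fermi g x = ((√(n.factorial : ℝ))⁻¹ : ℝ) * ∑ σ : Equiv.Perm (Fin n),
      permSign fermi k σ * ∏ a, g a (x (σ a)) := by
  rw [fockFun]
  congr 1
  refine Finset.sum_congr rfl fun σ _ => ?_
  by_cases h : ∀ a, g a (x (σ a)) ≠ 0
  · simp only [fun a => hg a _ (h a)]
  · obtain ⟨a, ha⟩ := not_forall.1 h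
    rw [Finset.prod_eq_zero (Finset.mem_univ a) (not_not.1 ha), mul_zero, mul_zero]

variable [MeasurableSpace J] [Countable J] [DiscreteMeasurableSpace J]

theorem fockFun_congr {n : ℕ} {g h : Fin n → Momentum d × J → ℂ}
    (hgh : ∀ a, g a =ᵐ[modeMeasure d J] h a) :
    fockFun fermi g =ᵐ[Measure.pi fun _ => modeMeasure d J] fockFun fermi h := by
  have h1 : ∀ (σ : Equiv.Perm (Fin n)) (a : Fin n),
      ∀ᵐ x : Fin n → Momentum d × J ∂(Measure.pi fun _ => modeMeasure d J),
        g a (x (σ a)) = h a (x (σ a)) := fun σ a =>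
    (Measure.quasiMeasurePreserving_eval (fun _ => modeMeasure d J) (σ a)).ae (hgh a)
  filter_upwards [ae_all_iff.2 fun σ => ae_all_iff.2 (h1 σ)] with x hx
  simp only [fockFun, hx]

/-- The recursively defined product of creation operators is the (anti)symmetrized tensor
product. -/
theorem coeFn_creationProduct : ∀ {n : ℕ} (g : Fin n → OneParticle d J),
    creationProduct fermi n g =ᵐ[Measure.pi fun _ => modeMeasure d J]
      fockFun fermi fun a => g a
  | 0, g => by
    refine (memLp_vacuumFun (d := d) (J := J)).coeFn_toLp.trans (.of_forall fun x => ?_)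
    simp [fockFun, permSign]
  | n + 1, g => by
    refine (memLp_creationFun fermi (g 0)
      (creationProduct fermi n (Fin.tail g))).coeFn_toLp.trans ?_
    have ih := coeFn_creationProduct (Fin.tail g)
    have h1 : ∀ m : Fin (n + 1), ∀ᵐ x : Fin (n + 1) → Momentum d × J
        ∂(Measure.pi fun _ => modeMeasure d J),
        creationProduct fermi n (Fin.tail g) (fun l => x (m.succAbove l)) =
          fockFun fermi (fun a => Fin.tail g a) (fun l => x (m.succAbove l)) := fun m =>
      (Measure.quasiMeasurePreserving_snd.comp (measurePreserving_piFinSuccAbove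
        (fun _ : Fin (n + 1) => modeMeasure d J) m).quasiMeasurePreserving).ae ih
    filter_upwards [ae_all_iff.2 h1] with x hx
    rw [← creationFun_fockFun (fun a => (g a : Momentum d × J → ℂ)) x]
    simp only [creationFun, hx]
    rfl

/-- Of the double sum over permutations `ρ, σ` the terms depend on `ρ⁻¹σ` only, which cancels the
normalization `1 / n!`. The kinds are fixed, so that the signs are constant on the supports. -/
theorem inner_creationProduct {n : ℕ} (g g' : Fin n → OneParticle d J)
    {G G' : Fin n → Momentum d × J → ℂ} {k k' : Fin n → J}
    (hg : ∀ a, g a =ᵐ[modeMeasure d J] G a) (hg' : ∀ a, g' a =ᵐ[modeMeasure d J] G' a)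
    (hG : ∀ a x, G a x ≠ 0 → x.2 = k a) (hG' : ∀ a x, G' a x ≠ 0 → x.2 = k' a) :
    ⟪creationProduct fermi n g, creationProduct fermi n g'⟫_ℂ =
      ∑ σ : Equiv.Perm (Fin n), permSign fermi k σ * ∏ a, ⟪g a, g' (σ a)⟫_ℂ := by
  set μ := modeMeasure d J
  have hinner : ∀ a b, ⟪g a, g' b⟫_ℂ = ∫ y, star (G a y) * G' b y ∂μ := fun a b => by
    rw [L2.inner_def]
    refine integral_congr_ae ?_
    filter_upwards [hg a, hg' b] with y h1 h2
    rw [h1, h2, RCLike.inner_apply, mul_comm]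
    rfl
  have hint : ∀ a b, Integrable (fun y => star (G a y) * G' b y) μ := fun a b => by
    refine (L2.integrable_inner (𝕜 := ℂ) (g a) (g' b)).congr ?_
    filter_upwards [hg a, hg' b] with y h1 h2
    rw [h1, h2, RCLike.inner_apply, mul_comm]
    rfl
  have hkind : ∀ a b, k a ≠ k' b → ⟪g a, g' b⟫_ℂ = 0 := fun a b hab => by
    rw [hinner]
    refine integral_eq_zero_of_ae (.of_forall fun y => ?_)
    by_contra hne
    simp only [Pi.zero_apply, mul_eq_zero, star_eq_zero, not_or] at hne
    exact hab ((hG a y hne.1).symm.trans (hG' b y hne.2))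
  set K : ℂ := (((√(n.factorial : ℝ))⁻¹ : ℝ) : ℂ) with hK
  have hKK : K * K * (n.factorial : ℂ) = 1 := by
    rw [hK, ← Complex.ofReal_mul, ← mul_inv, Real.mul_self_sqrt (by positivity)]
    push_cast
    exact inv_mul_cancel₀ (by exact_mod_cast n.factorial_ne_zero)
  -- the integrand, arranged as a product over the coordinates
  have hprod : ∀ (σ ρ : Equiv.Perm (Fin n)) (x : Fin n → Momentum d × J),
      star (∏ a, G a (x (σ a))) * ∏ a, G' a (x (ρ a)) =
        ∏ y, star (G (σ.symm y) (x y)) * G' (ρ.symm y) (x y) := by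
    intro σ ρ x
    rw [Finset.prod_mul_distrib, star_prod]
    congr 1
    · refine Eq.trans ?_ (Equiv.prod_comp σ fun y => star (G (σ.symm y) (x y)))
      simp
    · refine Eq.trans ?_ (Equiv.prod_comp ρ fun y => G' (ρ.symm y) (x y))
      simp
  have h1 : ⟪creationProduct fermi n g, creationProduct fermi n g'⟫_ℂ =
      ∫ x, ∑ ρ : Equiv.Perm (Fin n), ∑ σ : Equiv.Perm (Fin n),
        K * K * (permSign fermi k σ * permSign fermi k' ρ) *
          ∏ y, star (G (σ.symm y) (x y)) * G' (ρ.symm y) (x y) ∂(Measure.pi fun _ => μ) := by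
    rw [L2.inner_def]
    refine integral_congr_ae ?_
    filter_upwards [(coeFn_creationProduct g).trans (fockFun_congr hg),
      (coeFn_creationProduct g').trans (fockFun_congr hg')] with x hx hx'
    rw [hx, hx', RCLike.inner_apply, fockFun_of_support hG, fockFun_of_support hG']
    change (K * _) * star (K * _) = _
    have hKs : star K = K := by simp [hK]
    rw [star_mul', hKs, star_sum]
    simp only [star_mul', star_permSign, ← hprod]
    rw [mul_mul_mul_comm, Finset.sum_mul_sum, Finset.mul_sum]
    refine Finset.sum_congr rfl fun ρ _ => ?_
    rw [Finset.mul_sum]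
    refine Finset.sum_congr rfl fun σ _ => ?_
    ring
  have hint2 : ∀ ρ σ : Equiv.Perm (Fin n), Integrable (fun x : Fin n → Momentum d × J =>
      K * K * (permSign fermi k σ * permSign fermi k' ρ) *
        ∏ y, star (G (σ.symm y) (x y)) * G' (ρ.symm y) (x y)) (Measure.pi fun _ => μ) :=
    fun ρ σ => (Integrable.fintype_prod
      (f := fun y z => star (G (σ.symm y) z) * G' (ρ.symm y) z) fun y => hint _ _).const_mul _
  rw [h1, integral_finsetSum _ fun ρ _ => integrable_finsetSum _ fun σ _ => hint2 ρ σ]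
  have h2 : ∀ ρ : Equiv.Perm (Fin n), ∫ x, ∑ σ : Equiv.Perm (Fin n),
        K * K * (permSign fermi k σ * permSign fermi k' ρ) *
          ∏ y, star (G (σ.symm y) (x y)) * G' (ρ.symm y) (x y) ∂(Measure.pi fun _ => μ) =
      K * K * ∑ τ : Equiv.Perm (Fin n), permSign fermi k τ * ∏ a, ⟪g a, g' (τ a)⟫_ℂ := by
    intro ρ
    rw [integral_finsetSum _ fun σ _ => hint2 ρ σ, ← Equiv.sum_comp (Equiv.mulLeft ρ),
      Finset.mul_sum]
    refine Finset.sum_congr rfl fun τ _ => ?_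
    rw [integral_const_mul, integral_fintype_prod_eq_prod
      (f := fun y z => star (G ((Equiv.mulLeft ρ τ).symm y) z) * G' (ρ.symm y) z), mul_assoc]
    congr 1
    have h3 : ∏ y, ∫ z, star (G ((Equiv.mulLeft ρ τ).symm y) z) * G' (ρ.symm y) z ∂μ =
        ∏ a, ⟪g a, g' (τ a)⟫_ℂ := by
      rw [← Equiv.prod_comp (ρ * τ)]
      refine Finset.prod_congr rfl fun a _ => ?_
      have e1 : (Equiv.mulLeft ρ τ).symm ((ρ * τ) a) = a := (ρ * τ).symm_apply_apply a
      have e2 : ρ.symm ((ρ * τ) a) = τ a := ρ.symm_apply_apply (τ a)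
      rw [hinner, e1, e2]
    rw [h3]
    by_cases hk : ∀ a, k a = k' (τ a)
    · have h4 : permSign fermi k (Equiv.mulLeft ρ τ) =
          permSign fermi k τ * permSign fermi k' ρ := by
        have := permSign_trans (fermi := fermi) k τ ρ
        simp only [hk, Equiv.apply_symm_apply] at this ⊢
        exact this
      rw [h4, mul_assoc (permSign fermi k τ), permSign_mul_self, mul_one]
    · obtain ⟨a, ha⟩ := not_forall.1 hk
      rw [Finset.prod_eq_zero (Finset.mem_univ a) (hkind _ _ ha), mul_zero, mul_zero]
  simp only [h2, Finset.sum_const, Finset.card_univ, Fintype.card_perm, Fintype.card_fin,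
    nsmul_eq_mul]
  rw [← mul_assoc, mul_comm _ (K * K), hKK, one_mul]

theorem coeFn_mode (j : J) (f φ : 𝓢(Momentum d, ℂ)) :
    mode j f φ =ᵐ[modeMeasure d J]
      fun p => Set.indicator {p | p.2 = j} (fun p => f p.1 * φ p.1) p := by
  refine (memLp_mode j f φ).coeFn_toLp.trans (.of_forall fun p => ?_)
  by_cases h : p.2 = j <;> simp [h]

/-- Scalar products of Fock vectors as sums over bijections; for different particle numbers there
are no bijections, and the sum is empty. -/
theorem inner_fockVec_mode {n m : ℕ} (k : Fin n → J) (f φ : Fin n → 𝓢(Momentum d, ℂ))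
    (k' : Fin m → J) (f' φ' : Fin m → 𝓢(Momentum d, ℂ)) :
    ⟪fockVec fermi fun a => mode (k a) (f a) (φ a),
        fockVec fermi fun a => mode (k' a) (f' a) (φ' a)⟫_ℂ =
      ∑ σ : Fin n ≃ Fin m, permSign fermi k σ *
        ∏ a, ⟪mode (k a) (f a) (φ a), mode (k' (σ a)) (f' (σ a)) (φ' (σ a))⟫_ℂ := by
  rw [Submodule.coe_inner, fockVec, fockVec, lp.inner_single_left]
  by_cases h : n = m
  · subst h
    rw [lp.single_apply_self, inner_creationProduct _ _ (fun a => coeFn_mode (k a) (f a) (φ a))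
      (fun a => coeFn_mode (k' a) (f' a) (φ' a)) (k := k) (k' := k')]
    · exact fun a x hx => Set.mem_of_indicator_ne_zero (s := {p : Momentum d × J | p.2 = k a}) hx
    · exact fun a x hx => Set.mem_of_indicator_ne_zero (s := {p : Momentum d × J | p.2 = k' a}) hx
  · have : IsEmpty (Fin n ≃ Fin m) := ⟨fun σ => h (Fin.equiv_iff_eq.1 ⟨σ⟩)⟩
    rw [lp.single_apply, Pi.single_eq_of_ne h, inner_zero_right, Finset.univ_eq_empty,
      Finset.sum_empty]

theorem inner_mode (j j' : J) (f φ f' φ' : 𝓢(Momentum d, ℂ)) [DecidableEq J] :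
    ⟪mode j f φ, mode j' f' φ'⟫_ℂ =
      if j = j' then ∫ p, star (f p * φ p) * (f' p * φ' p) else 0 := by
  have h1 : ⟪mode j f φ, mode j' f' φ'⟫_ℂ = ∫ z : Momentum d × J, (star (f z.1 * φ z.1) *
      (f' z.1 * φ' z.1)) * (if z.2 = j ∧ z.2 = j' then 1 else 0) ∂(modeMeasure d J) := by
    rw [L2.inner_def]
    refine integral_congr_ae ?_
    filter_upwards [coeFn_mode j f φ, coeFn_mode j' f' φ'] with z h h'
    rw [h, h', RCLike.inner_apply]
    simp only [Set.indicator_apply, Set.mem_ofPred_eq]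
    by_cases h2 : z.2 = j
    · by_cases h3 : z.2 = j'
      · rw [if_pos h2, if_pos h3, if_pos ⟨h2, h3⟩, mul_one, mul_comm]
        rfl
      · rw [if_neg h3, if_neg (fun h : z.2 = j ∧ z.2 = j' => h3 h.2), zero_mul, mul_zero]
    · rw [if_neg h2, if_neg (fun h : z.2 = j ∧ z.2 = j' => h2 h.1), map_zero, mul_zero, mul_zero]
  rw [h1, modeMeasure, integral_prod_mul (fun p => star (f p * φ p) * (f' p * φ' p))
    fun i : J => if i = j ∧ i = j' then (1 : ℂ) else 0]
  split_ifs with h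
  · subst h
    have : ∫ i : J, (if i = j ∧ i = j then (1 : ℂ) else 0) ∂Measure.count = 1 := by
      have h2 : (fun i : J => if i = j ∧ i = j then (1 : ℂ) else 0) =
          Set.indicator {j} fun _ => 1 := by
        funext i
        by_cases hi : i = j <;> simp [hi]
      rw [h2, integral_indicator_const _ (.singleton j)]
      simp [Measure.real]
    rw [this, mul_one]
  · have : ∀ i : J, ¬(i = j ∧ i = j') := fun i hi => h (hi.1.symm.trans hi.2)
    simp [this]

end FockFun

/-! ### Non-overlapping families are generic -/

section Velocities

variable {d : ℕ}

/-- Different momenta have different velocities, by strict convexity. -/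
theorem gradient_injective {ε : Momentum d → ℝ} (hε : ContDiff ℝ ((⊤ : ℕ∞) : WithTop ℕ∞) ε)
    (hconv : StrictConvexOn ℝ Set.univ ε) : Function.Injective (gradient ε) := by
  intro x y hxy
  by_contra hne
  have hdiff : Differentiable ℝ ε := hε.differentiable (by simp)
  -- On the line through `x` and `y` the function is strictly convex, with the same slope at both.
  set h : ℝ → ℝ := fun t => ε (AffineMap.lineMap x y t) with hh
  have hderiv : ∀ t, HasDerivAt h (fderiv ℝ ε (AffineMap.lineMap x y t) (y - x)) t := fun t =>
    (hdiff _).hasFDerivAt.comp_hasDerivAt t AffineMap.hasDerivAt_lineMap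
  have hstrict : StrictConvexOn ℝ Set.univ h := by
    refine ⟨convex_univ, fun s _ t _ hst a b ha hb hab => ?_⟩
    have hL := Convex.combo_affine_apply (f := AffineMap.lineMap (k := ℝ) x y) (x := s) (y := t) hab
    simp only [hh]
    rw [hL]
    exact hconv.2 trivial trivial (fun h => hst (AffineMap.lineMap_injective ℝ hne h)) ha hb hab
  have hmono := hstrict.strictMonoOn_deriv fun t _ => (hderiv t).differentiableAt
  have h01 := hmono (Set.mem_univ 0) (Set.mem_univ 1) zero_lt_one
  rw [(hderiv 0).deriv, (hderiv 1).deriv, AffineMap.lineMap_apply_zero,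
    AffineMap.lineMap_apply_one, ← inner_gradient_left, ← inner_gradient_left, hxy] at h01
  exact lt_irrefl _ h01

/-- Configurations of momenta in which two particles have the same velocity form a null set: given
the momentum of one of them, at most one momentum of the other is excluded. For `d = 0` this would be
false. -/
theorem ae_ne_of_injective (hd : 0 < d) {n : ℕ} {F : Fin n → Momentum d → Momentum d}
    (hF : ∀ a, Continuous (F a)) (hinj : ∀ a, Function.Injective (F a)) {a b : Fin n}
    (hab : a ≠ b) : ∀ᵐ p : Fin n → Momentum d, F a (p a) ≠ F b (p b) := by
  obtain ⟨n, rfl⟩ : ∃ n', n = n' + 1 := ⟨n - 1, by have := a.pos; omega⟩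
  obtain ⟨l, rfl⟩ := Fin.exists_succAbove_eq hab.symm
  have : Nonempty (Fin d) := ⟨⟨0, hd⟩⟩
  have hmp := volume_preserving_piFinSuccAbove (fun _ : Fin (n + 1) => Momentum d) a
  have hnull : ∀ᵐ z : Momentum d × (Fin n → Momentum d), F a z.1 ≠ F (a.succAbove l) (z.2 l) := by
    have hmeas : MeasurableSet
        {z : Momentum d × (Fin n → Momentum d) | F a z.1 = F (a.succAbove l) (z.2 l)} :=
      (isClosed_eq ((hF a).comp continuous_fst)
        ((hF _).comp ((continuous_apply l).comp continuous_snd))).measurableSet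
    rw [ae_iff]
    simp only [ne_eq, not_not]
    rw [Measure.volume_eq_prod, Measure.prod_apply_symm hmeas]
    refine lintegral_eq_zero_of_ae_eq_zero (.of_forall fun q => ?_)
    refine Set.Subsingleton.measure_zero (fun x hx y hy => ?_) _
    exact hinj a (Eq.trans hx (Eq.symm hy))
  exact hmp.quasiMeasurePreserving.ae hnull

/-- A locally integrable function on a product of copies of `ℝ^d` vanishes almost everywhere if,
near almost every point, its integrals against products of smooth functions vanish: balls for the
supremum metric are products of balls, and their indicators are limits of products of bump
functions. -/
theorem ae_eq_zero_of_integral_mul_prod_eq_zero {n : ℕ} {w : (Fin n → Momentum d) → ℂ}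
    (hw : LocallyIntegrable w)
    (h : ∀ᵐ p : Fin n → Momentum d, ∃ δ > 0, ∀ b : Fin n → Momentum d → ℝ,
      (∀ m, ContDiff ℝ ((⊤ : ℕ∞) : WithTop ℕ∞) (b m)) →
      (∀ m, tsupport (b m) ⊆ Metric.closedBall (p m) δ) →
        ∫ q, w q * ∏ m, (b m (q m) : ℂ) = 0) :
    ∀ᵐ p, w p = 0 := by
  filter_upwards [h, IsUnifLocDoublingMeasure.ae_tendsto_average volume hw 1] with p hp hL
  obtain ⟨δ, hδ, hp⟩ := hp
  have hball : ∀ r, 0 < r → r < δ → ∫ q in Metric.closedBall p r, w q = 0 := by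
    intro r hr hrδ
    obtain ⟨u, -, hu, hur⟩ := exists_seq_strictAnti_tendsto' hrδ
    let bump : ∀ (k : ℕ) (m : Fin n), ContDiffBump (p m) := fun k m => ⟨r, u k, hr, (hu k).1⟩
    have hzero : ∀ k, ∫ q, w q * ∏ m, ((bump k m (q m) : ℝ) : ℂ) = 0 := fun k =>
      hp (fun m => bump k m) (fun m => (bump k m).contDiff) fun m => by
        rw [(bump k m).tsupport_eq]
        exact Metric.closedBall_subset_closedBall (hu k).2.le
    have hlim : Filter.Tendsto (fun k => ∫ q, w q * ∏ m, ((bump k m (q m) : ℝ) : ℂ)) Filter.atTop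
        (𝓝 (∫ q, (Metric.closedBall p r).indicator w q)) := by
      have hdom : Integrable ((Metric.closedBall p δ).indicator fun q => ‖w q‖) :=
        (integrable_indicator_iff Metric.isClosed_closedBall.measurableSet).2
          (hw.integrableOn_isCompact (isCompact_closedBall p δ)).norm
      refine tendsto_integral_of_dominated_convergence _ (fun k => ?_) hdom (fun k => ?_) ?_
      · refine hw.aestronglyMeasurable.mul (Continuous.aestronglyMeasurable ?_)
        exact continuous_finsetProd _ fun m _ => Complex.continuous_ofReal.comp
          ((bump k m).continuous.comp (continuous_apply m))
      · refine .of_forall fun q => ?_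
        by_cases hq : q ∈ Metric.closedBall p δ
        · rw [Set.indicator_of_mem hq, norm_mul, norm_prod]
          refine mul_le_of_le_one_right (norm_nonneg _)
            (Finset.prod_le_one (fun _ _ => norm_nonneg _) fun m _ => ?_)
          rw [Complex.norm_real, Real.norm_of_nonneg (bump k m).nonneg]
          exact (bump k m).le_one
        · rw [Set.indicator_of_notMem hq]
          rw [Metric.mem_closedBall, dist_pi_le_iff hδ.le, not_forall] at hq
          obtain ⟨m, hm⟩ := hq
          rw [Finset.prod_eq_zero (Finset.mem_univ m), mul_zero, norm_zero]
          rw [(bump k m).zero_of_le_dist ((hu k).2.le.trans (not_le.1 hm).le), Complex.ofReal_zero]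
      · refine .of_forall fun q => ?_
        by_cases hq : q ∈ Metric.closedBall p r
        · rw [Set.indicator_of_mem hq]
          rw [Metric.mem_closedBall, dist_pi_le_iff hr.le] at hq
          have : ∀ k m, bump k m (q m) = 1 := fun k m =>
            (bump k m).one_of_mem_closedBall (Metric.mem_closedBall.2 (hq m))
          simp [this]
        · rw [Set.indicator_of_notMem hq]
          rw [Metric.mem_closedBall, dist_pi_le_iff hr.le, not_forall] at hq
          obtain ⟨m, hm⟩ := hq
          refine tendsto_const_nhds.congr' ?_
          filter_upwards [hur.eventually_lt_const (not_le.1 hm)] with k hk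
          rw [Finset.prod_eq_zero (Finset.mem_univ m), mul_zero]
          rw [(bump k m).zero_of_le_dist hk.le, Complex.ofReal_zero]
    rw [← integral_indicator Metric.isClosed_closedBall.measurableSet]
    refine tendsto_nhds_unique hlim ?_
    simp only [hzero]
    exact tendsto_const_nhds
  have h1 := hL (l := 𝓝[>] (0 : ℝ)) (fun _ => p) id Filter.tendsto_id (by
    filter_upwards [self_mem_nhdsWithin] with r hr
    simpa using (Set.mem_Ioi.1 hr).le)
  refine tendsto_nhds_unique h1 (tendsto_const_nhds.congr' ?_)
  filter_upwards [Ioo_mem_nhdsGT hδ] with r hr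
  rw [setAverage_eq, id, hball r hr.1 hr.2, smul_zero]

/-- A smooth function divided by a Schwartz function without zeros on its support. -/
theorem exists_schwartzMap_mul_eq {b : Momentum d → ℝ} (hb : ContDiff ℝ ((⊤ : ℕ∞) : WithTop ℕ∞) b)
    (hbc : HasCompactSupport b) (φ : 𝓢(Momentum d, ℂ)) (hφ : ∀ p ∈ tsupport b, φ p ≠ 0) :
    ∃ f : 𝓢(Momentum d, ℂ), tsupport f ⊆ tsupport b ∧ ∀ p, f p * φ p = b p := by
  have hzero : ∀ p ∉ tsupport b, (b p : ℂ) = 0 := fun p hp => by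
    rw [image_eq_zero_of_notMem_tsupport hp, Complex.ofReal_zero]
  have hsub : tsupport (fun p => (b p : ℂ) / φ p) ⊆ tsupport b := by
    refine closure_minimal (fun p hp => ?_) (isClosed_tsupport b)
    by_contra hpb
    exact hp (by simp only [hzero p hpb, zero_div])
  have hsmooth : ContDiff ℝ ((⊤ : ℕ∞) : WithTop ℕ∞) fun p => (b p : ℂ) / φ p := by
    rw [contDiff_iff_contDiffAt]
    intro p
    by_cases hp : p ∈ tsupport b
    · simp only [div_eq_mul_inv]
      exact (Complex.ofRealCLM.contDiff.comp hb).contDiffAt.mul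
        (φ.smooth'.contDiffAt.inv (hφ p hp))
    · have : (fun p => (b p : ℂ) / φ p) =ᶠ[𝓝 p] fun _ => 0 := by
        filter_upwards [(isClosed_tsupport b).isOpen_compl.mem_nhds hp] with q hq
        rw [hzero q hq, zero_div]
      exact contDiffAt_const.congr_of_eventuallyEq this
  have hcs : HasCompactSupport fun p => (b p : ℂ) / φ p := hbc.of_isClosed_subset
    (isClosed_tsupport _) hsub
  refine ⟨hcs.toSchwartzMap hsmooth, hsub, fun p => ?_⟩
  change (b p : ℂ) / φ p * φ p = b p
  by_cases hp : p ∈ tsupport b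
  · exact div_mul_cancel₀ _ (hφ p hp)
  · rw [hzero p hp, zero_div, zero_mul]

/-- Near a configuration of momenta with distinct velocities there is room for non-overlapping wave
functions. -/
theorem exists_pos_disjoint_gradient_closedBall {J : Type*} {ε : J → Momentum d → ℝ}
    (hε : ∀ j, ContDiff ℝ ((⊤ : ℕ∞) : WithTop ℕ∞) (ε j)) {n : ℕ} (k : Fin n → J)
    {p : Fin n → Momentum d}
    (hp : ∀ a b, a ≠ b → gradient (ε (k a)) (p a) ≠ gradient (ε (k b)) (p b))
    {U : Fin n → Set (Momentum d)} (hU : ∀ a, U a ∈ 𝓝 (p a)) :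
    ∃ δ > 0, (∀ a, Metric.closedBall (p a) δ ⊆ U a) ∧
      Pairwise fun a b => Disjoint (gradient (ε (k a)) '' Metric.closedBall (p a) δ)
        (gradient (ε (k b)) '' Metric.closedBall (p b) δ) := by
  have h1 : ∀ a, ∀ᶠ δ in 𝓝[>] (0 : ℝ), Metric.closedBall (p a) δ ⊆ U a := fun a =>
    (eventually_closedBall_subset (hU a)).filter_mono nhdsWithin_le_nhds
  have h2 : ∀ a b, ∀ᶠ δ in 𝓝[>] (0 : ℝ), a ≠ b →
      Disjoint (gradient (ε (k a)) '' Metric.closedBall (p a) δ)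
        (gradient (ε (k b)) '' Metric.closedBall (p b) δ) := by
    intro a b
    by_cases hab : a = b
    · simp [hab]
    obtain ⟨V, W, hV, hW, hpV, hpW, hVW⟩ := t2_separation (hp a b hab)
    have e1 := eventually_closedBall_subset
      ((contDiff_gradient (hε (k a))).continuous.continuousAt.preimage_mem_nhds (hV.mem_nhds hpV))
    have e2 := eventually_closedBall_subset
      ((contDiff_gradient (hε (k b))).continuous.continuousAt.preimage_mem_nhds (hW.mem_nhds hpW))
    filter_upwards [nhdsWithin_le_nhds e1, nhdsWithin_le_nhds e2] with δ hδ1 hδ2 _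
    exact hVW.mono (Set.image_subset_iff.2 hδ1) (Set.image_subset_iff.2 hδ2)
  obtain ⟨δ, hδ1, hδ2, hδ⟩ := ((Filter.eventually_all.2 h1).and ((Filter.eventually_all.2 fun a =>
    Filter.eventually_all.2 (h2 a)).and self_mem_nhdsWithin)).exists
  exact ⟨δ, hδ, hδ1, fun a b hab => hδ2 a b hab⟩

end Velocities

section Kinds

variable {d : ℕ} {J : Type*} [MeasurableSpace J]

/-- The `n`-particle configurations in which the particles have the kinds `k`. -/
def kindSet (d : ℕ) {n : ℕ} (k : Fin n → J) : Set (Fin n → Momentum d × J) :=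
  Set.univ.pi fun m => {x | x.2 = k m}

/-- The configuration with momenta `p` and kinds `k`. -/
def withKinds {n : ℕ} (k : Fin n → J) (p : Fin n → Momentum d) (m : Fin n) : Momentum d × J :=
  (p m, k m)

theorem measurable_withKinds {n : ℕ} (k : Fin n → J) : Measurable (withKinds (d := d) k) :=
  measurable_pi_iff.2 fun m => (measurable_pi_apply m).prodMk measurable_const

variable [Countable J] [DiscreteMeasurableSpace J]

/-- On configurations with fixed kinds the measure is Lebesgue measure in the momenta. -/
theorem restrict_kindSet {n : ℕ} (k : Fin n → J) :
    (Measure.pi fun _ : Fin n => modeMeasure d J).restrict (kindSet d k) =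
      Measure.map (withKinds k) volume := by
  have h1 : ∀ j : J, (modeMeasure d J).restrict {x | x.2 = j} =
      Measure.map (fun p => (p, j)) volume := by
    intro j
    have : {x : Momentum d × J | x.2 = j} = Set.univ ×ˢ {j} := by
      ext x
      simp
    rw [this, modeMeasure, ← Measure.prod_restrict, Measure.restrict_univ,
      Measure.restrict_singleton, Measure.count_singleton, one_smul, Measure.prod_dirac]
  rw [kindSet, Measure.restrict_pi_pi]
  simp only [h1]
  have hsf : ∀ m : Fin n, SigmaFinite (Measure.map (fun p : Momentum d => (p, k m)) volume) :=
    fun m => by rw [← h1]; infer_instance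
  exact (Measure.pi_map_pi (μ := fun _ : Fin n => (volume : Measure (Momentum d)))
    (f := fun m p => (p, k m)) fun m => measurable_prodMk_right.aemeasurable).symm

theorem ae_of_forall_kinds {n : ℕ} {P : (Fin n → Momentum d × J) → Prop}
    (hP : MeasurableSet {x | P x}) (h : ∀ k : Fin n → J, ∀ᵐ p : Fin n → Momentum d,
      P (withKinds k p)) : ∀ᵐ x ∂(Measure.pi fun _ : Fin n => modeMeasure d J), P x := by
  have hU : (⋃ k : Fin n → J, kindSet d k) = Set.univ :=
    Set.eq_univ_of_forall fun x => Set.mem_iUnion.2 ⟨fun m => (x m).2, fun m _ => rfl⟩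
  rw [← Measure.restrict_univ (μ := Measure.pi fun _ : Fin n => modeMeasure d J), ← hU,
    ae_restrict_iUnion_iff]
  intro k
  rw [restrict_kindSet, ae_map_iff (measurable_withKinds k).aemeasurable hP]
  exact h k

theorem integral_kinds {n : ℕ} (k : Fin n → J) {H : (Fin n → Momentum d × J) → ℂ}
    (hH : AEStronglyMeasurable H (Measure.pi fun _ : Fin n => modeMeasure d J))
    (hsupp : ∀ x, H x ≠ 0 → x ∈ kindSet d k) :
    ∫ x, H x ∂(Measure.pi fun _ : Fin n => modeMeasure d J) = ∫ p, H (withKinds k p) := by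
  rw [← setIntegral_eq_integral_of_forall_compl_eq_zero
    (fun x hx => by_contra fun h => hx (hsupp x h)), restrict_kindSet, integral_map]
  · exact (measurable_withKinds k).aemeasurable
  · rw [← restrict_kindSet]
    exact hH.restrict

theorem memLp_withKinds {n : ℕ} (k : Fin n → J) {H : (Fin n → Momentum d × J) → ℂ}
    (hH : MemLp H 2 (Measure.pi fun _ : Fin n => modeMeasure d J)) :
    MemLp (fun p => H (withKinds k p)) 2 volume := by
  have h := hH.restrict (kindSet d k)
  rw [restrict_kindSet] at h
  exact (memLp_map_measure_iff h.1 (measurable_withKinds k).aemeasurable).1 h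

end Kinds

/-! ### Density of the non-overlapping products in Fock space -/

section Density

variable {d : ℕ} {J : Type*} [MeasurableSpace J] [Countable J] [DiscreteMeasurableSpace J]
  {fermi : Set J}

/-- The function `u` with `⟨v, b⁺(g₁) ⋯ b⁺(gₙ) |0⟩ = (n!)^{-1/2} ∫ u ∏ gₘ`. -/
noncomputable def dualFun (fermi : Set J) {n : ℕ} (v : (Fin n → Momentum d × J) → ℂ)
    (y : Fin n → Momentum d × J) : ℂ :=
  ∑ σ : Equiv.Perm (Fin n), permSign fermi (fun a => (y a).2) σ *
    star (v (MeasurableEquiv.piCongrLeft (fun _ => Momentum d × J) σ y))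

theorem measurable_permSign {n : ℕ} (σ : Equiv.Perm (Fin n)) :
    Measurable fun y : Fin n → Momentum d × J => permSign fermi (fun a => (y a).2) σ :=
  (measurable_of_countable fun k : Fin n → J => permSign fermi k σ).comp
    (measurable_pi_iff.2 fun a => measurable_snd.comp (measurable_pi_apply a))

theorem measurePreserving_perm {n : ℕ} (σ : Equiv.Perm (Fin n)) :
    MeasurePreserving (MeasurableEquiv.piCongrLeft (fun _ : Fin n => Momentum d × J) σ)
      (Measure.pi fun _ => modeMeasure d J) (Measure.pi fun _ => modeMeasure d J) :=
  measurePreserving_piCongrLeft (fun _ => modeMeasure d J) σ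

theorem measurable_dualFun {n : ℕ} {v : (Fin n → Momentum d × J) → ℂ} (hv : Measurable v) :
    Measurable (dualFun fermi v) :=
  Finset.measurable_sum _ fun σ _ => (measurable_permSign σ).mul
    (continuous_star.measurable.comp (hv.comp (MeasurableEquiv.measurable _)))

theorem memLp_dualFun_term {n : ℕ} (v : NParticle d J n) (σ : Equiv.Perm (Fin n)) :
    MemLp (fun y => permSign fermi (fun a => (y a).2) σ *
      star (v (MeasurableEquiv.piCongrLeft (fun _ => Momentum d × J) σ y))) 2
      (Measure.pi fun _ => modeMeasure d J) := by
  have h := (Lp.memLp v).comp_measurePreserving (measurePreserving_perm σ)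
  refine h.of_le ((measurable_permSign σ).aestronglyMeasurable.mul
    (continuous_star.comp_aestronglyMeasurable h.1)) (.of_forall fun y => ?_)
  rw [norm_mul, norm_permSign, one_mul, norm_star]
  rfl

theorem memLp_dualFun {n : ℕ} (v : NParticle d J n) :
    MemLp (dualFun fermi v) 2 (Measure.pi fun _ => modeMeasure d J) :=
  memLp_finsetSum Finset.univ fun σ _ => memLp_dualFun_term v σ

theorem memLp_prod {n : ℕ} {g : Fin n → Momentum d × J → ℂ}
    (hg : ∀ a, MemLp (g a) 2 (modeMeasure d J)) :
    MemLp (fun x : Fin n → Momentum d × J => ∏ a, g a (x a)) 2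
      (Measure.pi fun _ => modeMeasure d J) := by
  have hm : AEStronglyMeasurable (fun x : Fin n → Momentum d × J => ∏ a, g a (x a))
      (Measure.pi fun _ => modeMeasure d J) :=
    Finset.aestronglyMeasurable_fun_prod _ fun a _ => (hg a).1.comp_quasiMeasurePreserving
      (Measure.quasiMeasurePreserving_eval (fun _ => modeMeasure d J) a)
  rw [memLp_two_iff_integrable_sq_norm hm]
  simp only [norm_prod, ← Finset.prod_pow]
  exact Integrable.fintype_prod (f := fun a y => ‖g a y‖ ^ 2) fun a =>
    (memLp_two_iff_integrable_sq_norm (hg a).1).1 (hg a)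

/-- The (anti)symmetrization is moved from the product of one-particle functions to the other
factor. -/
theorem inner_creationProduct_eq_integral {n : ℕ} (v : NParticle d J n)
    (g : Fin n → OneParticle d J) {G : Fin n → Momentum d × J → ℂ}
    (hG : ∀ a, g a =ᵐ[modeMeasure d J] G a) :
    ⟪v, creationProduct fermi n g⟫_ℂ = ((√(n.factorial : ℝ))⁻¹ : ℝ) *
      ∫ y, dualFun fermi v y * ∏ a, G a (y a) ∂(Measure.pi fun _ => modeMeasure d J) := by
  have hGm : ∀ a, MemLp (G a) 2 (modeMeasure d J) := fun a => (memLp_congr_ae (hG a)).1 (Lp.memLp _)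
  set P : Equiv.Perm (Fin n) → (Fin n → Momentum d × J) ≃ᵐ (Fin n → Momentum d × J) := fun σ =>
    MeasurableEquiv.piCongrLeft (fun _ => Momentum d × J) σ with hP
  have hPapp : ∀ σ y a, P σ y (σ a) = y a := fun σ y a => by
    rw [hP, MeasurableEquiv.coe_piCongrLeft, Equiv.piCongrLeft_apply_apply]
  set H : Equiv.Perm (Fin n) → (Fin n → Momentum d × J) → ℂ := fun σ x => star (v x) *
    (permSign fermi (fun a => (x (σ a)).2) σ * ∏ a, G a (x (σ a))) with hH
  have hHP : ∀ σ y, H σ (P σ y) = permSign fermi (fun a => (y a).2) σ * star (v (P σ y)) *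
      ∏ a, G a (y a) := fun σ y => by
    simp only [hH, hPapp]
    ring
  have hint : ∀ σ, Integrable (fun y => H σ (P σ y)) (Measure.pi fun _ => modeMeasure d J) :=
    fun σ => by
      simp only [hHP]
      exact (memLp_dualFun_term v σ).integrable_mul (memLp_prod hGm)
  have hint' : ∀ σ, Integrable (H σ) (Measure.pi fun _ => modeMeasure d J) := fun σ =>
    ((measurePreserving_perm σ).integrable_comp_emb (MeasurableEquiv.measurableEmbedding _)).1
      (hint σ)
  have h1 : ⟪v, creationProduct fermi n g⟫_ℂ = ∫ x, ((√(n.factorial : ℝ))⁻¹ : ℝ) * ∑ σ, H σ x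
      ∂(Measure.pi fun _ => modeMeasure d J) := by
    rw [L2.inner_def]
    refine integral_congr_ae ?_
    filter_upwards [(coeFn_creationProduct g).trans (fockFun_congr hG)] with x hx
    rw [hx, RCLike.inner_apply, fockFun, mul_assoc]
    congr 1
    rw [mul_comm, Finset.mul_sum]
    rfl
  rw [h1, integral_const_mul, integral_finsetSum _ fun σ _ => hint' σ]
  congr 1
  simp only [dualFun, Finset.sum_mul]
  rw [integral_finsetSum]
  · refine Finset.sum_congr rfl fun σ _ => ?_
    rw [← (measurePreserving_perm σ).integral_comp (MeasurableEquiv.measurableEmbedding _)]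
    exact integral_congr_ae (.of_forall fun y => hHP σ y)
  · intro σ _
    refine (hint σ).congr (.of_forall fun y => ?_)
    exact hHP σ y

variable {ι : Type*} {ε : J → Momentum d → ℝ} {κ : ι → J} {φ : ι → 𝓢(Momentum d, ℂ)}

/-- A wave function orthogonal to all non-overlapping products vanishes after (anti)symmetrization:
almost every configuration has distinct velocities and lies where suitable `φ i` do not vanish, and
near such a configuration all products of localized functions are non-overlapping and available. -/
theorem dualFun_ae_eq_zero (hd : 0 < d) (hε : ∀ j, ContDiff ℝ ((⊤ : ℕ∞) : WithTop ℕ∞) (ε j))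
    (hconv : ∀ j, StrictConvexOn ℝ Set.univ (ε j))
    (hφ : ∀ j, ∀ᵐ p : Momentum d, ∃ i, κ i = j ∧ φ i p ≠ 0) {n : ℕ} (v : NParticle d J n)
    (hv : ∀ (i : Fin n → ι) (f : Fin n → 𝓢(Momentum d, ℂ)),
      NonOverlapping ε (fun m => κ (i m)) f →
        ⟪v, creationProduct fermi n fun m => mode (κ (i m)) (f m) (φ (i m))⟫_ℂ = 0) :
    ∀ᵐ y ∂(Measure.pi fun _ => modeMeasure d J), dualFun fermi v y = 0 := by
  have hmeas : Measurable (dualFun fermi v) :=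
    measurable_dualFun (Lp.stronglyMeasurable v).measurable
  refine ae_of_forall_kinds (measurableSet_eq_fun hmeas measurable_const) fun k => ?_
  refine ae_eq_zero_of_integral_mul_prod_eq_zero
    ((memLp_withKinds k (memLp_dualFun v)).locallyIntegrable one_le_two) ?_
  have h1 : ∀ᵐ p : Fin n → Momentum d, ∀ a b, a ≠ b →
      gradient (ε (k a)) (p a) ≠ gradient (ε (k b)) (p b) := by
    simp only [ae_all_iff]
    intro a b hab
    exact ae_ne_of_injective hd (F := fun a => gradient (ε (k a)))
      (fun a => (contDiff_gradient (hε _)).continuous)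
      (fun a => gradient_injective (hε _) (hconv _)) hab
  have h2 : ∀ᵐ p : Fin n → Momentum d, ∀ a, ∃ i, κ i = k a ∧ φ i (p a) ≠ 0 :=
    ae_all_iff.2 fun a => (Measure.quasiMeasurePreserving_eval
      (fun _ : Fin n => (volume : Measure (Momentum d))) a).ae (hφ (k a))
  filter_upwards [h1, h2] with p hp1 hp2
  choose i hik hi using hp2
  obtain ⟨δ, hδ, hδU, hdisj⟩ := exists_pos_disjoint_gradient_closedBall hε k hp1
    (U := fun a => {q | φ (i a) q ≠ 0})
    fun a => (φ (i a)).continuous.continuousAt.eventually_ne (hi a)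
  refine ⟨δ, hδ, fun b hb hbs => ?_⟩
  have hbc : ∀ a, HasCompactSupport (b a) := fun a =>
    (isCompact_closedBall (p a) δ).of_isClosed_subset (isClosed_tsupport _) (hbs a)
  -- The wave function of the particle created by `B i` is `f φ i`; so `f` has to be `b / φ i`.
  choose f hfs hf using fun a => exists_schwartzMap_mul_eq (hb a) (hbc a) (φ (i a))
    fun q hq => hδU a (hbs a hq)
  have hno : NonOverlapping ε (fun m => κ (i m)) f := by
    refine ⟨fun a => (hbc a).of_isClosed_subset (isClosed_tsupport _) (hfs a), fun a a' haa' => ?_⟩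
    simp only [hik]
    exact (hdisj haa').mono (Set.image_mono ((hfs a).trans (hbs a)))
      (Set.image_mono ((hfs a').trans (hbs a')))
  have h := hv i f hno
  rw [inner_creationProduct_eq_integral v _ fun a => coeFn_mode (κ (i a)) (f a) (φ (i a)),
    mul_eq_zero] at h
  have hK : ((√(n.factorial : ℝ))⁻¹ : ℝ) ≠ 0 :=
    inv_ne_zero (Real.sqrt_ne_zero'.2 (by exact_mod_cast n.factorial_pos))
  have h := h.resolve_left (by exact_mod_cast hK)
  rw [integral_kinds k] at h
  · rw [← h]
    refine integral_congr_ae (.of_forall fun q => ?_)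
    simp only
    congr 1
    refine Finset.prod_congr rfl fun a _ => ?_
    rw [Set.indicator_of_mem (show withKinds k q a ∈ {x : Momentum d × J | x.2 = κ (i a)} from
      (hik a).symm)]
    exact (hf a _).symm
  · refine hmeas.aestronglyMeasurable.mul ?_
    exact (memLp_prod fun a => (memLp_congr_ae (coeFn_mode (κ (i a)) (f a) (φ (i a)))).1
      (Lp.memLp _)).1
  · intro x hx a _
    have h3 := (Finset.prod_ne_zero_iff.1 (right_ne_zero_of_mul hx)) a (Finset.mem_univ a)
    have h4 := Set.mem_of_indicator_ne_zero
      (s := {x : Momentum d × J | x.2 = κ (i a)}) h3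
    exact Eq.trans h4 (hik a)

/-- A vector of the Fock space which is orthogonal to all products of creation operators of
non-overlapping wave functions vanishes. -/
theorem eq_zero_of_inner_fockVec_eq_zero (hd : 0 < d)
    (hε : ∀ j, ContDiff ℝ ((⊤ : ℕ∞) : WithTop ℕ∞) (ε j))
    (hconv : ∀ j, StrictConvexOn ℝ Set.univ (ε j))
    (hφ : ∀ j, ∀ᵐ p : Momentum d, ∃ i, κ i = j ∧ φ i p ≠ 0) (v : asymptoticFock d fermi)
    (hv : ∀ (n : ℕ) (i : Fin n → ι) (f : Fin n → 𝓢(Momentum d, ℂ)),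
      NonOverlapping ε (fun m => κ (i m)) f →
        ⟪v, fockVec fermi fun m => mode (κ (i m)) (f m) (φ (i m))⟫_ℂ = 0) : v = 0 := by
  have hall : ∀ (n : ℕ) (g : Fin n → OneParticle d J),
      ⟪(v : FullFock d J), lp.single 2 n (creationProduct fermi n g)⟫_ℂ = 0 := by
    intro n g
    have h := dualFun_ae_eq_zero (fermi := fermi) hd hε hconv hφ ((v : FullFock d J) n)
      fun i f hf => by
        have := hv n i f hf
        rwa [Submodule.coe_inner, fockVec, lp.inner_single_right] at this
    rw [lp.inner_single_right, inner_creationProduct_eq_integral _ g fun a => .rfl]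
    rw [integral_eq_zero_of_ae, mul_zero]
    filter_upwards [h] with y hy
    rw [hy, zero_mul]
    rfl
  have hspan : (Submodule.span ℂ (Set.range fun p : Σ n, Fin n → OneParticle d J =>
      (lp.single 2 p.1 (creationProduct fermi p.1 p.2) : FullFock d J))).topologicalClosure ≤
        (ℂ ∙ (v : FullFock d J))ᗮ := by
    refine Submodule.topologicalClosure_minimal _ (Submodule.span_le.2 ?_)
      (Submodule.isClosed_orthogonal _)
    rintro _ ⟨p, rfl⟩
    exact Submodule.mem_orthogonal_singleton_iff_inner_right.2 (hall p.1 p.2)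
  have h0 := Submodule.mem_orthogonal_singleton_iff_inner_right.1 (hspan v.2)
  exact Subtype.ext (inner_self_eq_zero.1 h0)

end Density

/-! ### The Møller matrix -/

section Isometry

variable {I E H : Type*} [NormedAddCommGroup E] [InnerProductSpace ℂ E] [CompleteSpace E]
  [NormedAddCommGroup H] [InnerProductSpace ℂ H] [CompleteSpace H]

theorem denseRange_linearCombination {x : I → E} (hx : ∀ v, (∀ a, ⟪v, x a⟫_ℂ = 0) → v = 0) :
    DenseRange (Finsupp.linearCombination ℂ x) := by
  have h : (Submodule.span ℂ (Set.range x)).topologicalClosure = ⊤ := by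
    rw [Submodule.topologicalClosure_eq_top_iff, Submodule.eq_bot_iff]
    exact fun v hv => hx v fun a =>
      (Submodule.mem_orthogonal' _ v).1 hv _ (Submodule.subset_span ⟨a, rfl⟩)
  have h2 := Submodule.dense_iff_topologicalClosure_eq_top.2 h
  rw [← Finsupp.range_linearCombination] at h2
  exact h2

/-- Families of vectors with the same scalar products are related by an isometry, if the first of
them is total. -/
theorem exists_linearIsometry_apply_eq {x : I → E} {y : I → H}
    (hxy : ∀ a b, ⟪x a, x b⟫_ℂ = ⟪y a, y b⟫_ℂ) (hx : ∀ v, (∀ a, ⟪v, x a⟫_ℂ = 0) → v = 0) :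
    ∃ S : E →ₗᵢ[ℂ] H, ∀ a, S (x a) = y a := by
  set e := Finsupp.linearCombination ℂ x
  set f := Finsupp.linearCombination ℂ y
  have hdense : DenseRange e := denseRange_linearCombination hx
  have hinner : ∀ c, ⟪e c, e c⟫_ℂ = ⟪f c, f c⟫_ℂ := by
    intro c
    simp only [e, f, Finsupp.linearCombination_apply, Finsupp.sum, sum_inner, inner_sum,
      inner_smul_left, inner_smul_right, hxy]
  have hnorm : ∀ c, ‖f c‖ = ‖e c‖ := fun c => by
    rw [@norm_eq_sqrt_re_inner ℂ, @norm_eq_sqrt_re_inner ℂ _ _ _ _ (e c), hinner]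
  have hb : ∃ C : ℝ, ∀ c, ‖f c‖ ≤ C * ‖e c‖ := ⟨1, fun c => by rw [one_mul, hnorm]⟩
  have hS : ∀ c, f.extendOfNorm e (e c) = f c := LinearMap.extendOfNorm_eq hdense hb
  refine ⟨⟨(f.extendOfNorm e).toLinearMap, fun v => ?_⟩, fun a => ?_⟩
  · refine hdense.induction_on (p := fun v => ‖f.extendOfNorm e v‖ = ‖v‖) v
      (isClosed_eq (f.extendOfNorm e).continuous.norm continuous_norm) fun c => ?_
    rw [hS, hnorm]
  · have := hS (Finsupp.single a 1)
    simpa [e, f] using this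

end Isometry

section NonOverlapping

variable {d : ℕ} {J ι : Type*} {ε : J → Momentum d → ℝ} {κ : ι → J}

theorem nonOverlapping_cons_iff {n : ℕ} {i₀ : ι} {f₀ : 𝓢(Momentum d, ℂ)} {i : Fin n → ι}
    {f : Fin n → 𝓢(Momentum d, ℂ)} :
    NonOverlapping ε (Fin.cons (κ i₀) fun m => κ (i m)) (Fin.cons f₀ f) ↔
      NonOverlapping ε (fun m => κ ((Fin.cons i₀ i : Fin (n + 1) → ι) m))
        (Fin.cons f₀ f : Fin (n + 1) → 𝓢(Momentum d, ℂ)) := by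
  have : (Fin.cons (κ i₀) fun m => κ (i m) : Fin (n + 1) → J) =
      fun m => κ ((Fin.cons i₀ i : Fin (n + 1) → ι) m) := by
    funext m
    refine Fin.cases ?_ (fun l => ?_) m <;> rfl
  rw [this]

theorem NonOverlapping.tail {n : ℕ} {k : Fin (n + 1) → J} {f : Fin (n + 1) → 𝓢(Momentum d, ℂ)}
    (h : NonOverlapping ε k f) : NonOverlapping ε (fun m => k m.succ) fun m => f m.succ :=
  ⟨fun m => h.1 m.succ, fun _ _ hab => h.2 fun e => hab (Fin.succ_injective _ e)⟩

theorem tendsto_const_inFilter (n : ℕ) :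
    Filter.Tendsto (fun (t : ℝ) (_ : Fin n) => t) Filter.atBot (inFilter n 1) := by
  refine Filter.tendsto_inf.2 ⟨Filter.tendsto_pi.2 fun _ => Filter.tendsto_id, ?_⟩
  rw [Filter.tendsto_principal]
  exact .of_forall fun t a b _ => (pow_one |t|).ge

end NonOverlapping

section Uniqueness

variable {d : ℕ} {A J ι : Type*} [NormedRing A] [StarRing A] [NormedAlgebra ℂ A]
  [StarModule ℂ A] [MeasurableSpace J] [Countable J] [DiscreteMeasurableSpace J]
  {α : Translations d A} {ω : StationaryState α} {ε : J → Momentum d → ℝ}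
  {fermi : Set J} {κ : ι → J} {φ : ι → 𝓢(Momentum d, ℂ)} {B : ι → A}

theorem mode_cons {n : ℕ} (i₀ : ι) (f₀ : 𝓢(Momentum d, ℂ)) (i : Fin n → ι)
    (f : Fin n → 𝓢(Momentum d, ℂ)) :
    (Fin.cons (mode (κ i₀) f₀ (φ i₀)) fun m => mode (κ (i m)) (f m) (φ (i m)) :
        Fin (n + 1) → OneParticle d J) =
      fun m => mode (κ ((Fin.cons i₀ i : Fin (n + 1) → ι) m))
        ((Fin.cons f₀ f : Fin (n + 1) → 𝓢(Momentum d, ℂ)) m)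
        (φ ((Fin.cons i₀ i : Fin (n + 1) → ι) m)) := by
  funext m
  refine Fin.cases ?_ (fun l => ?_) m <;> rfl

/-- Bounded operators that agree on the products of creation operators of non-overlapping wave
functions coincide. -/
theorem eq_of_forall_fockVec_eq (hd : 0 < d) (hε : ∀ j, ContDiff ℝ ((⊤ : ℕ∞) : WithTop ℕ∞) (ε j))
    (hconv : ∀ j, StrictConvexOn ℝ Set.univ (ε j))
    (hφ : ∀ j, ∀ᵐ p : Momentum d, ∃ i, κ i = j ∧ φ i p ≠ 0)
    {T T' : asymptoticFock d fermi →L[ℂ] GNS ω.toState}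
    (h : ∀ (n : ℕ) (i : Fin n → ι) (f : Fin n → 𝓢(Momentum d, ℂ)),
      NonOverlapping ε (fun m => κ (i m)) f →
        T (fockVec fermi fun m => mode (κ (i m)) (f m) (φ (i m))) =
          T' (fockVec fermi fun m => mode (κ (i m)) (f m) (φ (i m)))) : T = T' := by
  have : CompleteSpace (asymptoticFock d fermi) := by
    unfold asymptoticFock
    infer_instance
  let I : Type _ := Σ n, {p : (Fin n → ι) × (Fin n → 𝓢(Momentum d, ℂ)) //
    NonOverlapping ε (fun m => κ (p.1 m)) p.2}
  have hdense := denseRange_linearCombination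
    (x := fun a : I => fockVec fermi fun m => mode (κ (a.2.1.1 m)) (a.2.1.2 m) (φ (a.2.1.1 m)))
    fun v hv => eq_zero_of_inner_fockVec_eq_zero hd hε hconv hφ v
      fun n i f hf => hv ⟨n, (i, f), hf⟩
  refine DFunLike.coe_injective (hdense.equalizer T.continuous T'.continuous (funext fun c => ?_))
  simp only [Function.comp_apply, Finsupp.linearCombination_apply, Finsupp.sum, map_sum, map_smul]
  refine Finset.sum_congr rfl fun a _ => ?_
  rw [h a.1 a.2.1.1 a.2.1.2 a.2.2]

variable [NormedStarGroup A]

/-- The two characterizations of the Møller matrix determine its values on products of creation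
operators of non-overlapping wave functions. -/
theorem apply_fockVec_eq_of_intertwines {T T' : asymptoticFock d fermi → GNS ω.toState}
    (hT : IntertwinesCreation ω ε fermi κ φ B T) (hT' : IntertwinesCreation ω ε fermi κ φ B T') :
    ∀ (n : ℕ) (i : Fin n → ι) (f : Fin n → 𝓢(Momentum d, ℂ)),
      NonOverlapping ε (fun m => κ (i m)) f →
        T (fockVec fermi fun m => mode (κ (i m)) (f m) (φ (i m))) =
          T' (fockVec fermi fun m => mode (κ (i m)) (f m) (φ (i m))) := by
  intro n
  induction n with
  | zero =>
    intro i f _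
    have : (fun m => mode (κ (i m)) (f m) (φ (i m)) : Fin 0 → OneParticle d J) = Fin.elim0 :=
      Subsingleton.elim _ _
    rw [this]
    exact hT.1.trans hT'.1.symm
  | succ n ih =>
    intro i f hf
    obtain ⟨i₀, i, rfl⟩ : ∃ i₀ i', i = Fin.cons i₀ i' :=
      ⟨i 0, Fin.tail i, (Fin.cons_self_tail i).symm⟩
    obtain ⟨f₀, f, rfl⟩ : ∃ f₀ f', f = Fin.cons f₀ f' :=
      ⟨f 0, Fin.tail f, (Fin.cons_self_tail f).symm⟩
    have h1 := hT.2 n i₀ f₀ i f (nonOverlapping_cons_iff.2 hf)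
    have h2 := hT'.2 n i₀ f₀ i f (nonOverlapping_cons_iff.2 hf)
    rw [ih i f hf.tail] at h1
    rw [← mode_cons]
    exact tendsto_nhds_unique h1 h2

end Uniqueness

section Moller

variable {d : ℕ} {A J ι : Type*} [NormedRing A] [StarRing A] [NormedAlgebra ℂ A]
  [StarModule ℂ A] [NormedStarGroup A] {α : Translations d A} {ω : StationaryState α}
  {ε : J → Momentum d → ℝ} {fermi : Set J} {κ : ι → J} {φ : ι → 𝓢(Momentum d, ℂ)} {B : ι → A}

theorem scatteringVec_eq_equalTimeVec {n : ℕ} (i : Fin n → ι) (f : Fin n → 𝓢(Momentum d, ℂ))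
    (τ : ℝ) : (scatteringVec ω ε κ B i f fun _ => τ) = equalTimeVec ω.toState
      (List.ofFn fun m => smeared α (ε (κ (i m))) (B (i m)) (f m)) τ := by
  rw [scatteringVec, equalTimeVec, List.map_ofFn]
  rfl

variable [CompleteSpace A]

theorem pairwise_rapidlyCommute_smeared (hε : ∀ j, ContDiff ℝ ((⊤ : ℕ∞) : WithTop ℕ∞) (ε j))
    (hBc : ∀ i, Continuous fun p : Momentum d × ℝ => α.toFun p.1 p.2 (B i))
    (hcomm : AsymptoticallyCommuting ω fermi κ B) {n : ℕ} {i : Fin n → ι}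
    {f : Fin n → 𝓢(Momentum d, ℂ)} (hf : NonOverlapping ε (fun m => κ (i m)) f) :
    (List.ofFn fun m => smeared α (ε (κ (i m))) (B (i m)) (f m)).Pairwise
      (RapidlyCommute ω.toState) :=
  List.pairwise_ofFn.2 fun a b hab => rapidlyCommute_smeared hε hBc hcomm (i a) (i b) (hf.1 a)
    (hf.1 b) (hf.2 hab.ne)

theorem exists_isInState_smeared (Φ : ElementaryExcitation ω ε)
    (hε : ∀ j, ContDiff ℝ ((⊤ : ℕ∞) : WithTop ℕ∞) (ε j))
    (hB : ∀ i, gnsVec ω.toState (B i) = Φ.toFun (κ i) (φ i))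
    (hBc : ∀ i, Continuous fun p : Momentum d × ℝ => α.toFun p.1 p.2 (B i))
    (hcomm : AsymptoticallyCommuting ω fermi κ B) {n : ℕ} {i : Fin n → ι}
    {f : Fin n → 𝓢(Momentum d, ℂ)} (hf : NonOverlapping ε (fun m => κ (i m)) f) :
    ∃ ψ, IsInState ω.toState
      (List.ofFn fun m => smeared α (ε (κ (i m))) (B (i m)) (f m)) ψ := by
  refine exists_isInState _ (fun S hS => ?_) (pairwise_rapidlyCommute_smeared hε hBc hcomm hf)
  obtain ⟨m, rfl⟩ := List.mem_ofFn.1 hS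
  exact isCreator_smeared Φ hε (i m) (hB (i m)) (hBc (i m)) (hf.1 m)

variable [MeasurableSpace J] [Countable J] [DiscreteMeasurableSpace J]

/-- In-states have the scalar products of the corresponding Fock vectors. -/
theorem IsInState.inner_eq (hd : 0 < d) (Φ : ElementaryExcitation ω ε)
    (hε : ∀ j, ContDiff ℝ ((⊤ : ℕ∞) : WithTop ℕ∞) (ε j))
    (hB : ∀ i, gnsVec ω.toState (B i) = Φ.toFun (κ i) (φ i))
    (hBc : ∀ i, Continuous fun p : Momentum d × ℝ => α.toFun p.1 p.2 (B i))
    (hcluster : StrongClusterProperty ω fermi κ B) {n m : ℕ} {i : Fin n → ι} {i' : Fin m → ι}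
    {f : Fin n → 𝓢(Momentum d, ℂ)} {f' : Fin m → 𝓢(Momentum d, ℂ)}
    (hf : NonOverlapping ε (fun a => κ (i a)) f) (hf' : NonOverlapping ε (fun a => κ (i' a)) f')
    {ψ ψ' : GNS ω.toState}
    (hψ : IsInState ω.toState (List.ofFn fun m => smeared α (ε (κ (i m))) (B (i m)) (f m)) ψ)
    (hψ' : IsInState ω.toState
      (List.ofFn fun m => smeared α (ε (κ (i' m))) (B (i' m)) (f' m)) ψ') :
    ⟪fockVec fermi fun m => mode (κ (i m)) (f m) (φ (i m)),
      fockVec fermi fun m => mode (κ (i' m)) (f' m) (φ (i' m))⟫_ℂ = ⟪ψ, ψ'⟫_ℂ := by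
  classical
  have h1 := hψ.tendsto.inner (𝕜 := ℂ) hψ'.tendsto
  have h2 := tendsto_inner_scatteringVec hd Φ hε hB hBc hcluster hf hf'
  simp only [scatteringVec_eq_equalTimeVec] at h2
  rw [tendsto_nhds_unique h1 h2, inner_fockVec_mode]
  refine Finset.sum_congr rfl fun σ _ => ?_
  congr 1
  refine Finset.prod_congr rfl fun a _ => ?_
  rw [inner_mode, Φ.inner_eq]
  simp only [schwartzMul_apply]

/-- The isometry which maps the products of creation operators of non-overlapping wave functions to
the in-states. -/
theorem exists_isometry_isInState (hd : 0 < d) (Φ : ElementaryExcitation ω ε)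
    (hε : ∀ j, ContDiff ℝ ((⊤ : ℕ∞) : WithTop ℕ∞) (ε j))
    (hconv : ∀ j, StrictConvexOn ℝ Set.univ (ε j))
    (hB : ∀ i, gnsVec ω.toState (B i) = Φ.toFun (κ i) (φ i))
    (hBc : ∀ i, Continuous fun p : Momentum d × ℝ => α.toFun p.1 p.2 (B i))
    (hφ : ∀ j, ∀ᵐ p : Momentum d, ∃ i, κ i = j ∧ φ i p ≠ 0)
    (hcomm : AsymptoticallyCommuting ω fermi κ B) (hcluster : StrongClusterProperty ω fermi κ B) :
    ∃ S : asymptoticFock d fermi →ₗᵢ[ℂ] GNS ω.toState,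
      ∀ (n : ℕ) (i : Fin n → ι) (f : Fin n → 𝓢(Momentum d, ℂ)),
        NonOverlapping ε (fun m => κ (i m)) f →
          IsInState ω.toState (List.ofFn fun m => smeared α (ε (κ (i m))) (B (i m)) (f m))
            (S (fockVec fermi fun m => mode (κ (i m)) (f m) (φ (i m)))) := by
  have : CompleteSpace (asymptoticFock d fermi) := by
    unfold asymptoticFock
    infer_instance
  let I : Type _ := Σ n, {p : (Fin n → ι) × (Fin n → 𝓢(Momentum d, ℂ)) //
    NonOverlapping ε (fun m => κ (p.1 m)) p.2}
  choose y hy using fun a : I => exists_isInState_smeared Φ hε hB hBc hcomm a.2.2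
  obtain ⟨S, hS⟩ := exists_linearIsometry_apply_eq
    (x := fun a : I => fockVec fermi fun m => mode (κ (a.2.1.1 m)) (a.2.1.2 m) (φ (a.2.1.1 m)))
    (y := y) (fun a b => IsInState.inner_eq hd Φ hε hB hBc hcluster a.2.2 b.2.2 (hy a) (hy b))
    fun v hv => eq_zero_of_inner_fockVec_eq_zero hd hε hconv hφ v
      fun n i f hf => hv ⟨n, (i, f), hf⟩
  refine ⟨S, fun n i f hf => ?_⟩
  have := hS ⟨n, (i, f), hf⟩
  simp only at this
  rw [this]
  exact hy ⟨n, (i, f), hf⟩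

end Moller

end HaagRuelle


open HaagRuelle
theorem mainTheorem2 {d : ℕ} (hd : 0 < d)
    {A : Type*} [NormedRing A] [StarRing A] [NormedStarGroup A] [NormedAlgebra ℂ A]
    [StarModule ℂ A] [CompleteSpace A]
    {J : Type*} [Countable J] [MeasurableSpace J] [DiscreteMeasurableSpace J]
    (α : Translations d A) (ω : StationaryState α)
    (ε : J → Momentum d → ℝ) (hε : ∀ j, ContDiff ℝ ((⊤ : ℕ∞) : WithTop ℕ∞) (ε j))
    (hconv : ∀ j, StrictConvexOn ℝ Set.univ (ε j))
    (Φ : ElementaryExcitation ω ε) (fermi : Set J)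
    {ι : Type*} (κ : ι → J) (φ : ι → 𝓢(Momentum d, ℂ)) (B : ι → A)
    (hB : ∀ i, gnsVec ω.toState (B i) = Φ.toFun (κ i) (φ i))
    (hBcont : ∀ i, Continuous fun p : Momentum d × ℝ => α.toFun p.1 p.2 (B i))
    (hφ : ∀ j, ∀ᵐ p : Momentum d, ∃ i, κ i = j ∧ φ i p ≠ 0)
    (hcomm : AsymptoticallyCommuting ω fermi κ B)
    (hcluster : StrongClusterProperty ω fermi κ B) :
    ∃ S : asymptoticFock d fermi →ₗᵢ[ℂ] GNS ω.toState,
      MapsProductsToInStates ω ε fermi κ φ B S ∧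
      IntertwinesCreation ω ε fermi κ φ B S ∧
      ∀ T : asymptoticFock d fermi →L[ℂ] GNS ω.toState,
        MapsProductsToInStates ω ε fermi κ φ B T ∨ IntertwinesCreation ω ε fermi κ φ B T →
          ∀ v, T v = S v := by
  obtain ⟨S, hS⟩ := exists_isometry_isInState hd Φ hε hconv hB hBcont hφ hcomm hcluster
  have hmaps : MapsProductsToInStates ω ε fermi κ φ B S := fun n i f hf M =>
    (hS n i f hf).tendsto_inFilter
      (fun m => isCreator_smeared Φ hε (i m) (hB (i m)) (hBcont (i m)) (hf.1 m))
      (pairwise_rapidlyCommute_smeared hε hBcont hcomm hf) M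
  have hinter : IntertwinesCreation ω ε fermi κ φ B S := by
    constructor
    · have h0 : NonOverlapping ε (fun m => κ ((Fin.elim0 : Fin 0 → ι) m))
          (Fin.elim0 : Fin 0 → 𝓢(Momentum d, ℂ)) := ⟨fun m => m.elim0, fun m => m.elim0⟩
      have h1 := (hS 0 Fin.elim0 Fin.elim0 h0).tendsto
      have h2 : (fun m => mode (κ ((Fin.elim0 : Fin 0 → ι) m))
          ((Fin.elim0 : Fin 0 → 𝓢(Momentum d, ℂ)) m) (φ ((Fin.elim0 : Fin 0 → ι) m)) :
            Fin 0 → OneParticle d J) = Fin.elim0 := Subsingleton.elim _ _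
      rw [h2] at h1
      exact tendsto_nhds_unique h1 tendsto_const_nhds
    · intro n i₀ f₀ i f hf
      have hf' := nonOverlapping_cons_iff.1 hf
      rw [mode_cons]
      have h1 := hS (n + 1) _ _ hf'
      rw [List.ofFn_succ] at h1
      exact h1.tendsto_gnsRep (isCreator_smeared Φ hε i₀ (hB i₀) (hBcont i₀) (hf.1 0))
        (hS n i f hf'.tail)
  refine ⟨S, hmaps, hinter, fun T hT v => ?_⟩
  have heq : T = S.toContinuousLinearMap := by
    refine eq_of_forall_fockVec_eq (κ := κ) (φ := φ) hd hε hconv hφ ?_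
    rcases hT with hT | hT
    · exact fun n i f hf => tendsto_nhds_unique ((hT n i f hf 1).comp (tendsto_const_inFilter n))
        ((hmaps n i f hf 1).comp (tendsto_const_inFilter n))
    · exact apply_fockVec_eq_of_intertwines hT hinter
  rw [heq]
  rfl
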